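/- Let $B\subset\mathbb C$ be a nonempty connected open set and let $q$ be a holomorphic function on $B$. Consider the Ince-X system $$x'=y,\qquad y'=-xy+x^3-12\,q(t)\,x+12\,q'(t),\qquad t\in B.$$ Let $a,b$ be functions on $B$ of one of the following two forms: * (i) $a=12\,(6q^2-C_1t-C_2)$ and $b=144\,q\,q'-24\,C_1$, with given constants $C_1,C_2\in\mathbb C$; * (ii) $a=12\,q''$ and $b=24\,q'''-144\,q\,q'$. For fixed $t\in B$ embed the plane with coordinates $(x,y)$ in $\mathbb P^2$, with homogeneous coordinates $[1:x:y]$, and blow up successively the following eleven points, where $\xi_{n+1}$ and $\eta_{n+1}$ denote the new coordinates produced by the blow-ups in which they are introduced: * the point $(x/y,\,1/y)=(0,0)$, and then the point $(x/y,\,1/x)=(0,0)$; * with $\xi_0=y/x^2$ and $\xi_{n+1}=(\xi_n-z_n)x$, the six points $(\xi_n,1/x)=(z_n,0)$, $n=0,\dots,5$, where $(z_0,\dots,z_5)=\left(\tfrac12,\,0,\,-6q(t),\,12q'(t),\,-a(t),\,b(t)\right)$; * with $\eta_0=y/x^2$ and $\eta_{n+1}=(\eta_n-w_n)x$, the three points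 $(\eta_n,1/x)=(w_n,0)$, $n=0,1,2$, where $(w_0,w_1,w_2)=\left(-1,\,0,\,12q(t)\right)$. Then the following holds. 1. (Surface.) Each of these points lies on the surface reached before it is blown up. After the eleven blow-ups the strict transform of the line at infinity is a smooth rational curve of self-intersection $-1$, and that of the second exceptional curve is a smooth rational curve of self-intersection $-3$. Blowing down the line at infinity, one obtains a rational surface of type $E_8^{(1)}$, in the sense that the (strict transforms of the) exceptional curves other than the last ones of the chains of six and of three blow-ups are nine distinct smooth rational $(-2)$-curves whose intersection graph is the Dynkin diagram $E_8^{(1)}$. 2. (Phase space.) For each $t\in B$, the complement of these nine curves is the union of three affine planes $\mathbb C^2\ni(x_j,y_j)$, $j=0,1,2$, with coordinates given by the birational transformations $$x_0=x,\quad y_0=y;\qquad x_1=\frac1x,\quad y_1=(y+x^2-12q)\,x;$$ $$x_2=\frac1x,\quad y_2=\Big\{\big(((y-x^2/2+6q)\,x-12q')\,x+a\big)\,x-b\Big\}\,x.$$ The phase space over $B$, i.e. the family of these complements for $t\in B$, is obtained by gluing three copies of $\mathbb C^2\times B\ni(x_j,y_j,t)$ via these transformations, and is Hausdorff: a point of the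 copy $j=0$ is identified with a point of the copy $j\in\{1,2\}$ if and only if they have the same $t$, $x\ne0$, and the transformation takes one to the other; a point of the copy $1$ is identified with a point of the copy $2$ if and only if both are identified with the same point of the copy $0$. 3. (Polynomiality.) Say that the system is polynomial in the chart $j$ if, written in the coordinates $(x_j,y_j)$, its right-hand sides are polynomials in $x_j,y_j$ with coefficients holomorphic in $t\in B$. In case (i), the system is polynomial in all three charts if and only if $$q''=6q^2-C_1t-C_2\quad\text{on }B.$$ In case (ii), the system is polynomial in all three charts if and only if there are constants $C_1,C_2\in\mathbb C$ with $q''=6q^2-C_1t-C_2$ on $B$. -/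

import Mathlib

noncomputable section

namespace InceX

open MvPolynomial

/-! ### Points and curves of rational surfaces

A smooth projective rational surface over `ℂ` is handled in the classical (Zariski, Chevalley) way:
its closed points are identified with their local rings, which are subrings of the function field
`K = ℂ(x, y)`, and its irreducible curves with their local rings, which are discrete valuation rings
of `K`. A point lies on a curve iff the local ring of the point is contained in that of the curve.
Gluing is automatic: two points are equal iff their local rings are the same subring of `K`. -/

/-- The function field `ℂ(x, y)`. -/
abbrev K : Type := FractionRing (MvPolynomial (Fin 2) ℂ)

/-- The coordinate function `x`. -/
def xK : K := algebraMap (MvPolynomial (Fin 2) ℂ) K (X 0)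

/-- The coordinate function `y`. -/
def yK : K := algebraMap (MvPolynomial (Fin 2) ℂ) K (X 1)

/-- The local ring at the point `(u, v) = (a, b)` of the affine plane with coordinates `u, v`:
all `p(u,v) / r(u,v)` with polynomials `p, r` such that `r(a, b) ≠ 0`. -/
def pointAt (u v : K) (a b : ℂ) : Subalgebra ℂ K where
  carrier := {w | ∃ p r : MvPolynomial (Fin 2) ℂ, eval ![a, b] r ≠ 0 ∧ aeval ![u, v] r ≠ 0 ∧
    w * aeval ![u, v] r = aeval ![u, v] p}
  mul_mem' := by
    rintro w₁ w₂ ⟨p₁, r₁, h₁, g₁, e₁⟩ ⟨p₂, r₂, h₂, g₂, e₂⟩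
    refine ⟨p₁ * p₂, r₁ * r₂, ?_, ?_, ?_⟩
    · rw [map_mul]; exact mul_ne_zero h₁ h₂
    · rw [map_mul]; exact mul_ne_zero g₁ g₂
    · rw [map_mul, map_mul, ← e₁, ← e₂]; ring
  add_mem' := by
    rintro w₁ w₂ ⟨p₁, r₁, h₁, g₁, e₁⟩ ⟨p₂, r₂, h₂, g₂, e₂⟩
    refine ⟨p₁ * r₂ + p₂ * r₁, r₁ * r₂, ?_, ?_, ?_⟩
    · rw [map_mul]; exact mul_ne_zero h₁ h₂
    · rw [map_mul]; exact mul_ne_zero g₁ g₂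
    · rw [map_mul, map_add, map_mul, map_mul, ← e₁, ← e₂]; ring
  algebraMap_mem' := by
    intro z
    exact ⟨C z, 1, by simp, by simp, by simp⟩

/-- The local ring of the curve `v = 0` of the affine plane with coordinates `u, v`:
all `p(u,v) / r(u,v)` with polynomials `p, r` such that `r(·, 0)` is not the zero polynomial. -/
def curveAt (u v : K) : Subalgebra ℂ K where
  carrier := {w | ∃ p r : MvPolynomial (Fin 2) ℂ,
    aeval ![(Polynomial.X : Polynomial ℂ), 0] r ≠ 0 ∧ aeval ![u, v] r ≠ 0 ∧
    w * aeval ![u, v] r = aeval ![u, v] p}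
  mul_mem' := by
    rintro w₁ w₂ ⟨p₁, r₁, h₁, g₁, e₁⟩ ⟨p₂, r₂, h₂, g₂, e₂⟩
    refine ⟨p₁ * p₂, r₁ * r₂, ?_, ?_, ?_⟩
    · rw [map_mul]; exact mul_ne_zero h₁ h₂
    · rw [map_mul]; exact mul_ne_zero g₁ g₂
    · rw [map_mul, map_mul, ← e₁, ← e₂]; ring
  add_mem' := by
    rintro w₁ w₂ ⟨p₁, r₁, h₁, g₁, e₁⟩ ⟨p₂, r₂, h₂, g₂, e₂⟩
    refine ⟨p₁ * r₂ + p₂ * r₁, r₁ * r₂, ?_, ?_, ?_⟩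
    · rw [map_mul]; exact mul_ne_zero h₁ h₂
    · rw [map_mul]; exact mul_ne_zero g₁ g₂
    · rw [map_mul, map_add, map_mul, map_mul, ← e₁, ← e₂]; ring
  algebraMap_mem' := by
    intro z
    exact ⟨C z, 1, by simp, by simp, by simp⟩

/-- The non-units of a subring of `K`; for a local ring this is its maximal ideal. -/
def nonunitSet (R : Subalgebra ℂ K) : Set K := {w | w ∈ R ∧ (w = 0 ∨ w⁻¹ ∉ R)}

/-- `w` is a unit of `R`. -/
def IsUnitOf (R : Subalgebra ℂ K) (w : K) : Prop := w ≠ 0 ∧ w ∈ R ∧ w⁻¹ ∈ R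

/-- `(u, v)` is a regular system of parameters of the two-dimensional regular local ring `R`:
the maximal ideal of `R` is generated by `u` and `v`. -/
def IsParameters (R : Subalgebra ℂ K) (u v : K) : Prop :=
  nonunitSet R = {w | ∃ r ∈ R, ∃ s ∈ R, w = r * u + s * v}

/-! ### Blowing up and blowing down -/

/-- The ring `R[v/u]`, coordinate ring of an affine chart of the blow-up of the point `R`. -/
def blowUpChart (R : Subalgebra ℂ K) (u v : K) : Subalgebra ℂ K := R ⊔ Algebra.adjoin ℂ {v / u}

/-- `S` is (the local ring of) a point lying over the point `R` in the blow-up of `R`: there is a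
regular system of parameters `(u, v)` of `R` such that `S` is the localization of the chart `R[v/u]`
at the ideal `(u, v/u)`, i.e. `S` corresponds to the tangent direction `v = 0`. -/
def IsPointOver (R S : Subalgebra ℂ K) : Prop :=
  ∃ u v : K, IsParameters R u v ∧
    (S : Set K) = {w | ∃ p ∈ blowUpChart R u v, ∃ r ∈ blowUpChart R u v,
      (¬ ∃ f ∈ blowUpChart R u v, ∃ g ∈ blowUpChart R u v, r = f * u + g * (v / u)) ∧ w = p / r}

/-- `V` is (the local ring of) the exceptional curve of the blow-up of the point `R`: the
localization of a chart `R[v/u]` at the prime ideal `(u)`. -/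
def IsExceptionalCurve (R V : Subalgebra ℂ K) : Prop :=
  ∃ u v : K, IsParameters R u v ∧
    (V : Set K) = {w | ∃ p ∈ blowUpChart R u v, ∃ r ∈ blowUpChart R u v,
      (¬ ∃ f ∈ blowUpChart R u v, r = f * u) ∧ w = p / r}

/-- The blow-up of the surface `M` at its point `R`. -/
def blowUp (M : Set (Subalgebra ℂ K)) (R : Subalgebra ℂ K) : Set (Subalgebra ℂ K) :=
  (M \ {R}) ∪ {S | IsPointOver R S}

/-- `N` is obtained from the surface `M` by blowing down the curve `V` to the point `R` of `N`:
`M` is the blow-up of `N` at `R`, with exceptional curve `V`. -/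
def IsBlowDown (M : Set (Subalgebra ℂ K)) (V : Subalgebra ℂ K)
    (N : Set (Subalgebra ℂ K)) (R : Subalgebra ℂ K) : Prop :=
  R ∈ N ∧ (∀ S, IsPointOver R S → S ∉ N) ∧ blowUp N R = M ∧ IsExceptionalCurve R V

/-! ### Curves on a surface and their intersection numbers -/

/-- `f` is a local equation of the curve `V` at the point `R` (a unit, if `R` is not on `V`). -/
def IsLocalEquation (R V : Subalgebra ℂ K) (f : K) : Prop :=
  (R ≤ V ∧ {w | w ∈ R ∧ w ∈ nonunitSet V} = {w | ∃ r ∈ R, w = r * f}) ∨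
  (¬ R ≤ V ∧ IsUnitOf R f)

/-- `V` is a smooth rational curve (a `ℙ¹`) on the surface `M`: some point of `M` lies on `V`, at each
such point the local equation of `V` is part of a regular system of parameters, and the function
field of `V` is purely transcendental, of the form `ℂ(u)`. -/
def IsSmoothRationalCurve (M : Set (Subalgebra ℂ K)) (V : Subalgebra ℂ K) : Prop :=
  (∃ R ∈ M, R ≤ V) ∧
  (∀ R ∈ M, R ≤ V → ∃ f g : K, IsParameters R f g ∧ IsLocalEquation R V f) ∧
  ∃ u ∈ V, (∀ r : Polynomial ℂ, r ≠ 0 → IsUnitOf V (Polynomial.aeval u r)) ∧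
    ∀ w ∈ V, ∃ p r : Polynomial ℂ, r ≠ 0 ∧
      w - Polynomial.aeval u p / Polynomial.aeval u r ∈ nonunitSet V

/-- The restriction to the curve `V` (smooth at its point `R`) of the function `φ` has order `k` at
the point `R`: here `f` is a local equation of `V`, and `g` restricts to a uniformizer of `V` at `R`. -/
def HasOrderAlong (R V : Subalgebra ℂ K) (φ : K) (k : ℤ) : Prop :=
  ∃ f g e : K, IsParameters R f g ∧ IsLocalEquation R V f ∧ IsUnitOf R e ∧
    φ - e * g ^ k ∈ nonunitSet V

/-- The smooth complete curve `V` and the curve `W` (possibly `W = V`) on the surface `M` have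
intersection number `n`, which is by definition the degree of the line bundle `O(W)` on `V`: after
moving `W` by the principal divisor of some `h`, so that the local equations `w / h` of `W - div h` do
not vanish identically on `V`, it is the sum over the points of `V` of the orders of `(w / h)|_V`. -/
def HasIntersectionNumber (M : Set (Subalgebra ℂ K)) (V W : Subalgebra ℂ K) (n : ℤ) : Prop :=
  ∃ h : K, h ≠ 0 ∧ ∃ m : Subalgebra ℂ K →₀ ℤ,
    (∀ R ∈ m.support, R ∈ M ∧ R ≤ V) ∧
    (∀ R ∈ M, R ≤ V → ∃ w : K, IsLocalEquation R W w ∧ HasOrderAlong R V (w / h) (m R)) ∧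
    n = m.sum fun _ k => k

/-- The generalized Cartan matrix of the affine Dynkin diagram `E₈⁽¹⁾`: the first eight nodes form the
diagram `E₈`, in Mathlib's (Bourbaki's) order, and the last node is the affine one. -/
def affineE8 : Matrix (Fin 9) (Fin 9) ℤ :=
  !![ 2,  0, -1,  0,  0,  0,  0,  0,  0;
      0,  2,  0, -1,  0,  0,  0,  0,  0;
     -1,  0,  2, -1,  0,  0,  0,  0,  0;
      0, -1, -1,  2, -1,  0,  0,  0,  0;
      0,  0,  0, -1,  2, -1,  0,  0,  0;
      0,  0,  0,  0, -1,  2, -1,  0,  0;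
      0,  0,  0,  0,  0, -1,  2, -1,  0;
      0,  0,  0,  0,  0,  0, -1,  2, -1;
      0,  0,  0,  0,  0,  0,  0, -1,  2]

/-- The nine curves `D 0, …, D 8` on `M` are distinct smooth rational `(-2)`-curves which intersect
according to the Dynkin diagram `E₈⁽¹⁾`. -/
def IsE8Configuration (M : Set (Subalgebra ℂ K)) (D : Fin 9 → Subalgebra ℂ K) : Prop :=
  Function.Injective D ∧ (∀ i, IsSmoothRationalCurve M (D i)) ∧
    ∀ i j, HasIntersectionNumber M (D i) (D j) (-affineE8 i j)

/-! ### The eleven blow-ups -/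

/-- The projective plane with homogeneous coordinates `[1 : x : y]`, covered by the affine planes
with coordinates `(x, y)`, `(1/x, y/x)` and `(x/y, 1/y)`. -/
def projPlane : Set (Subalgebra ℂ K) :=
  {R | ∃ a b : ℂ, R = pointAt xK yK a b} ∪
  {R | ∃ a b : ℂ, R = pointAt (1 / xK) (yK / xK) a b} ∪
  {R | ∃ a b : ℂ, R = pointAt (xK / yK) (1 / yK) a b}

/-- The line at infinity of the projective plane. -/
def lineAtInfinity : Subalgebra ℂ K := curveAt (yK / xK) (1 / xK)

/-- The data on which the centres of the blow-ups depend (at a fixed time `t`):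
the values `q = q(t)`, `dq = q'(t)` and two further numbers `a`, `b`. -/
structure CenterData (F : Type*) where
  q : F
  dq : F
  a : F
  b : F

/-- The centre data, viewed as constants of the function field. -/
def CenterData.toK (c : CenterData ℂ) : CenterData K :=
  ⟨algebraMap ℂ K c.q, algebraMap ℂ K c.dq, algebraMap ℂ K c.a, algebraMap ℂ K c.b⟩

/-- A chain of blow-ups, starting from the chart with coordinates `(y/x², 1/x)`: blowing up the point
`(z n, 0)` of the chart with coordinates `(chain z n, 1/x)` leads to the chart with coordinates
`(chain z (n+1), 1/x)`, where `chain z (n+1) = (chain z n - z n) / (1/x)`. -/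
def chain (z : ℕ → ℂ) : ℕ → K
  | 0 => yK / xK ^ 2
  | n + 1 => (chain z n - algebraMap ℂ K (z n)) / (1 / xK)

/-- The centres of the six blow-ups over the point `y/x² = 1/2, 1/x = 0`. -/
def zA (c : CenterData ℂ) : ℕ → ℂ
  | 0 => 1 / 2
  | 1 => 0
  | 2 => -6 * c.q
  | 3 => 12 * c.dq
  | 4 => -c.a
  | 5 => c.b
  | _ => 0

/-- The centres of the three blow-ups over the point `y/x² = -1, 1/x = 0`. -/
def zB (c : CenterData ℂ) : ℕ → ℂ
  | 0 => -1
  | 1 => 0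
  | 2 => 12 * c.q
  | _ => 0

/-- The centres of the eleven blow-ups, in order: two blow-ups over the point `[0 : 0 : 1]`,
six over `y/x² = 1/2, 1/x = 0` and three over `y/x² = -1, 1/x = 0`. -/
def center (c : CenterData ℂ) : Fin 11 → Subalgebra ℂ K :=
  ![pointAt (xK / yK) (1 / yK) 0 0,
    pointAt (xK / yK) (1 / xK) 0 0,
    pointAt (chain (zA c) 0) (1 / xK) (zA c 0) 0,
    pointAt (chain (zA c) 1) (1 / xK) (zA c 1) 0,
    pointAt (chain (zA c) 2) (1 / xK) (zA c 2) 0,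
    pointAt (chain (zA c) 3) (1 / xK) (zA c 3) 0,
    pointAt (chain (zA c) 4) (1 / xK) (zA c 4) 0,
    pointAt (chain (zA c) 5) (1 / xK) (zA c 5) 0,
    pointAt (chain (zB c) 0) (1 / xK) (zB c 0) 0,
    pointAt (chain (zB c) 1) (1 / xK) (zB c 1) 0,
    pointAt (chain (zB c) 2) (1 / xK) (zB c 2) 0]

/-- The surface obtained from the projective plane by the first `n` blow-ups. -/
def stage (c : CenterData ℂ) : ℕ → Set (Subalgebra ℂ K)
  | 0 => projPlane
  | n + 1 => if h : n < 11 then blowUp (stage c n) (center c ⟨n, h⟩) else stage c n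

/-- The exceptional curves of the eleven blow-ups. -/
def excCurve (c : CenterData ℂ) : Fin 11 → Subalgebra ℂ K :=
  ![curveAt (1 / xK) (xK / yK),
    curveAt (yK / xK ^ 2) (1 / xK),
    curveAt (chain (zA c) 1) (1 / xK),
    curveAt (chain (zA c) 2) (1 / xK),
    curveAt (chain (zA c) 3) (1 / xK),
    curveAt (chain (zA c) 4) (1 / xK),
    curveAt (chain (zA c) 5) (1 / xK),
    curveAt (chain (zA c) 6) (1 / xK),
    curveAt (chain (zB c) 1) (1 / xK),
    curveAt (chain (zB c) 2) (1 / xK),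
    curveAt (chain (zB c) 3) (1 / xK)]

/-- The point `y/x² = 0, 1/x = 0`, to which the line at infinity is blown down. -/
def contractedPoint : Subalgebra ℂ K := pointAt (yK / xK ^ 2) (1 / xK) 0 0

/-- The surface obtained after the eleven blow-ups by blowing down the line at infinity. -/
def surface (c : CenterData ℂ) : Set (Subalgebra ℂ K) :=
  {R | R ∈ stage c 11 ∧ ¬ R ≤ lineAtInfinity} ∪ {contractedPoint}

/-- The nine boundary curves: all exceptional curves except the last one of each of the two chains. -/
def boundary (c : CenterData ℂ) : Fin 9 → Subalgebra ℂ K :=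
  ![excCurve c 9, excCurve c 0, excCurve c 8, excCurve c 1, excCurve c 2,
    excCurve c 3, excCurve c 4, excCurve c 5, excCurve c 6]

/-- The phase space at a fixed time: the complement of the boundary curves in the surface. -/
def phaseFiber (c : CenterData ℂ) : Set (Subalgebra ℂ K) :=
  {R | R ∈ surface c ∧ ∀ i, ¬ R ≤ boundary c i}

/-! ### The charts and the gluing -/

/-- The three coordinate systems `(x_j, y_j)`, as functions of `(x, y)`. -/
def chartMap {F : Type*} [Field F] (c : CenterData F) (x y : F) : Fin 3 → F × F :=
  ![(x, y),
    (1 / x, (y + x ^ 2 - 12 * c.q) * x),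
    (1 / x, ((((y - x ^ 2 / 2 + 6 * c.q) * x - 12 * c.dq) * x + c.a) * x - c.b) * x)]

/-- The point with coordinates `(x_j, y_j) = (a, b)` in the `j`-th chart at a fixed time. -/
def chartPoint (c : CenterData ℂ) (j : Fin 3) (a b : ℂ) : Subalgebra ℂ K :=
  pointAt (chartMap c.toK xK yK j).1 (chartMap c.toK xK yK j).2 a b

/-- The space `ℂ² × B`, with points `(x_j, y_j, t)`. -/
abbrev ChartSpace (B : Set ℂ) : Type := {p : ℂ × ℂ × ℂ // p.2.2 ∈ B}

/-- The total phase space over the time domain `B`, with points `(t, R)`, `R` in the phase space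
at time `t`. -/
def PhaseSpace (B : Set ℂ) (c : ℂ → CenterData ℂ) : Type :=
  {p : ℂ × Subalgebra ℂ K // p.1 ∈ B ∧ p.2 ∈ phaseFiber (c p.1)}

/-- The `j`-th chart, as a map from `ℂ² × B`. -/
def chartParam (B : Set ℂ) (c : ℂ → CenterData ℂ) (j : Fin 3) (p : ChartSpace B) :
    ℂ × Subalgebra ℂ K :=
  (p.1.2.2, chartPoint (c p.1.2.2) j p.1.1 p.1.2.1)

/-- The gluing topology: a set is open iff its preimages under the three charts are open. -/
instance (B : Set ℂ) (c : ℂ → CenterData ℂ) : TopologicalSpace (PhaseSpace B c) :=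
  TopologicalSpace.induced Subtype.val
    (⨆ j : Fin 3, TopologicalSpace.coinduced (chartParam B c j) inferInstance)

/-- The phase space over `B` is obtained by gluing three copies of `ℂ² × B` via the birational maps
`(x, y, t) ↦ (x_j, y_j, t)`: the charts are well-defined open embeddings into the phase space, which is
Hausdorff and covered by them; a point of the `0`-th and a point of the `j`-th copy (`j = 1, 2`) are
identified iff `x ≠ 0` and the stated map takes one to the other; and a point of the first and a point
of the second copy are identified iff they are identified with the same point of the `0`-th copy. -/
def IsGluedFromCharts (B : Set ℂ) (c : ℂ → CenterData ℂ) : Prop :=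
  ∃ ι : Fin 3 → ChartSpace B → PhaseSpace B c,
    (∀ j p, (ι j p).1 = chartParam B c j p) ∧
    (∀ j, Topology.IsOpenEmbedding (ι j)) ∧
    (⋃ j, Set.range (ι j)) = Set.univ ∧
    T2Space (PhaseSpace B c) ∧
    (∀ j, j ≠ 0 → ∀ p p' : ChartSpace B, ι 0 p = ι j p' ↔
      p.1.1 ≠ 0 ∧ p'.1.2.2 = p.1.2.2 ∧
        (p'.1.1, p'.1.2.1) = chartMap (c p.1.2.2) p.1.1 p.1.2.1 j) ∧
    (∀ p p' : ChartSpace B, ι 1 p = ι 2 p' ↔ ∃ p₀, ι 0 p₀ = ι 1 p ∧ ι 0 p₀ = ι 2 p')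

/-! ### The differential system -/

/-- The vector field `(x', y', t')` of the system `x' = y`, `y' = -xy + x³ - 12 q(t) x + 12 q'(t)`
on the space with coordinates `(x, y, t)`. -/
def vectorField (q : ℂ → ℂ) (p : ℂ × ℂ × ℂ) : ℂ × ℂ × ℂ :=
  (p.2.1, -p.1 * p.2.1 + p.1 ^ 3 - 12 * q p.2.2 * p.1 + 12 * deriv q p.2.2, 1)

/-- The system written in the `j`-th chart, `x_j' = P(x_j, y_j, t)`, `y_j' = Q(x_j, y_j, t)`, has right
hand sides `P`, `Q` that are polynomials in `x_j, y_j` with coefficients holomorphic in `t ∈ B`. -/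
def IsPolynomialInChart (B : Set ℂ) (q : ℂ → ℂ) (c : ℂ → CenterData ℂ) (j : Fin 3) : Prop :=
  ∃ P Q : MvPolynomial (Fin 2) (ℂ → ℂ),
    (∀ m, DifferentiableOn ℂ (P.coeff m) B ∧ DifferentiableOn ℂ (Q.coeff m) B) ∧
    ∀ x y t : ℂ, t ∈ B → (j ≠ 0 → x ≠ 0) →
      fderiv ℂ (fun p : ℂ × ℂ × ℂ => chartMap (c p.2.2) p.1 p.2.1 j) (x, y, t)
          (vectorField q (x, y, t)) =
        (eval₂ (Pi.evalRingHom (fun _ : ℂ => ℂ) t)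
            ![(chartMap (c t) x y j).1, (chartMap (c t) x y j).2] P,
         eval₂ (Pi.evalRingHom (fun _ : ℂ => ℂ) t)
            ![(chartMap (c t) x y j).1, (chartMap (c t) x y j).2] Q)

/-- The centre data with `a = 12 (6 q² - C₁ t - C₂)` and `b = 144 q q' - 24 C₁`. -/
def centersOfConstants (q : ℂ → ℂ) (C₁ C₂ : ℂ) (t : ℂ) : CenterData ℂ :=
  ⟨q t, deriv q t, 12 * (6 * q t ^ 2 - C₁ * t - C₂), 144 * q t * deriv q t - 24 * C₁⟩

/-- The centre data with `a = 12 q''` and `b = 24 q''' - 144 q q'`. -/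
def centersOfDerivatives (q : ℂ → ℂ) (t : ℂ) : CenterData ℂ :=
  ⟨q t, deriv q t, 12 * iteratedDeriv 2 q t, 24 * iteratedDeriv 3 q t - 144 * q t * deriv q t⟩

/-- The explicit eleven blow-ups of the projective plane with the centre data `c` lead to a rational
surface of type `E₈⁽¹⁾`: each centre is a point of the surface reached before, the curves listed as
exceptional curves are the exceptional curves of the blow-ups; the line at infinity then is
a smooth rational `(-1)`-curve, the second exceptional curve a smooth rational `(-3)`-curve, the
line at infinity can be blown down, and on the resulting surface the nine boundary curves form a
configuration of `(-2)`-curves of type `E₈⁽¹⁾`. The complement of these curves, the phase space at a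
fixed time, is the union of the three affine planes with the coordinates `(x_j, y_j)`, where
`(x, y) ↦ (x_j, y_j)` is birational. -/
structure IsResolutionOfTypeE8 (c : CenterData ℂ) : Prop where
  center_mem : ∀ i : Fin 11, center c i ∈ stage c i
  exceptional : ∀ i : Fin 11, IsExceptionalCurve (center c i) (excCurve c i)
  line_smooth : IsSmoothRationalCurve (stage c 11) lineAtInfinity
  line_self : HasIntersectionNumber (stage c 11) lineAtInfinity lineAtInfinity (-1)
  second_smooth : IsSmoothRationalCurve (stage c 11) (excCurve c 1)
  second_self : HasIntersectionNumber (stage c 11) (excCurve c 1) (excCurve c 1) (-3)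
  blowDown : IsBlowDown (stage c 11) lineAtInfinity (surface c) contractedPoint
  typeE8 : IsE8Configuration (surface c) (boundary c)
  birational : ∀ j, IntermediateField.adjoin ℂ
    {(chartMap c.toK xK yK j).1, (chartMap c.toK xK yK j).2} = ⊤
  phaseFiber_eq : phaseFiber c = {R | ∃ j, ∃ a b : ℂ, R = chartPoint c j a b}

end InceX

end

open InceX

/-! Points and curves are subrings of `K`, so every geometric assertion becomes a statement about
values of functions. If a local ring `S` gives `u`, `v` the values `a`, `b`, it contains the local
ring of the point `(a, b)` (`pointAt_le`); if `u` is regular and nonconstant along `S` while `v`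
vanishes there, it contains the local ring of the curve `v = 0` (`curveAt_le`). Used in both
directions, these criteria identify points and curves written in different charts. Blowing up is
made explicit by `isPointOver_pointAt`: whatever parameters the definition uses, the new points are
those of the charts `(u, v/u)` and `(v, u/v)` on the exceptional curve.

This turns each stage of the construction into a list (`stage_final`): the affine plane, the
remaining points of the first two exceptional curves and of the line at infinity, and two towers
over `y/x² = 1/2` and `y/x² = -1`. The function `y/x²` has a pole, vanishes, is constant or is
nonconstant on the various curves, and with the further chain coordinates this settles nearly all
incidences. Only the first centres of the two chains matter here; the later ones may be arbitrary,
so the surface has type `E₈⁽¹⁾` for every centre datum.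

For self-intersections the curve is moved by `h = 1/x` (by `h = x/y` for the first exceptional
curve). At a general point `h` is a local equation of the curve; at finitely many corners it is a
local equation times a uniformizer of the curve. Hence the self-intersection number is minus the
number of these corners: one for the line, three for the second curve before the contraction, and
two for every boundary curve afterwards.

Off the boundary there remain the affine plane and the last exceptional curve of each tower without
its corner. The last coordinates of the towers are exactly `y₁` and `y₂`, which gives the three
charts. The glued space is Hausdorff because `x` is unbounded near `x_j = 0` and because `y/x²`
extends continuously with the values `-1` and `1/2` to the curves added by charts 1 and 2.

In charts 0 and 1 the system is always polynomial. In chart 2 only `y₂'` can have a pole, of order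
at most three in `x₂`, and its polar part vanishes iff `a = 12 q''`, `b = 2 a' - 144 q q'` and `b' =
144 q'² + 12 a q` (`forall_isPolynomialInChart_iff`). In case (i) the first condition is the
equation for `q`, the second is an identity and the third follows from the equation. In case (ii)
the first two are identities and the third reads `q'''' = (6 q²)''`; two integrations over the
connected set `B` produce `C₁` and `C₂`. -/

noncomputable section

/-! ### Values and generic functions on local rings of the function field. -/

namespace InceX

open MvPolynomial

/-! ### Coordinate systems of the function field -/

/-- `u, v` generate the function field, i.e. they are birational coordinates. -/
def IsCoord (u v : K) : Prop := IntermediateField.adjoin ℂ {u, v} = ⊤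

theorem IsCoord.of_mem {u v u' v' : K} (h : IsCoord u v)
    (hu : u ∈ IntermediateField.adjoin ℂ {u', v'}) (hv : v ∈ IntermediateField.adjoin ℂ {u', v'}) :
    IsCoord u' v' := by
  refine top_unique ?_
  rw [← h, IntermediateField.adjoin_le_iff]
  rintro w (rfl | rfl)
  · exact hu
  · exact hv

theorem mem_adjoin_left (u v : K) : u ∈ IntermediateField.adjoin ℂ {u, v} :=
  IntermediateField.subset_adjoin _ _ (by simp)

theorem mem_adjoin_right (u v : K) : v ∈ IntermediateField.adjoin ℂ {u, v} :=
  IntermediateField.subset_adjoin _ _ (by simp)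

theorem isCoord_xy : IsCoord xK yK := by
  refine top_unique fun w _ => ?_
  have key : ∀ p : MvPolynomial (Fin 2) ℂ,
      algebraMap _ K p ∈ IntermediateField.adjoin ℂ {xK, yK} := by
    intro p
    induction p using MvPolynomial.induction_on with
    | C c =>
      have : algebraMap (MvPolynomial (Fin 2) ℂ) K (C c) = algebraMap ℂ K c := by
        rw [IsScalarTower.algebraMap_apply ℂ (MvPolynomial (Fin 2) ℂ) K]; rfl
      rw [this]; exact IntermediateField.algebraMap_mem _ _
    | add p q hp hq => rw [map_add]; exact add_mem hp hq
    | mul_X p i hp =>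
      rw [map_mul]
      refine mul_mem hp ?_
      fin_cases i
      · exact mem_adjoin_left xK yK
      · exact mem_adjoin_right xK yK
  obtain ⟨p, r, _, rfl⟩ := IsFractionRing.div_surjective (A := MvPolynomial (Fin 2) ℂ) w
  exact div_mem (key p) (key r)

/-- The field `K` is algebraic over `ℂ[u, v]`, since each of its elements is a quotient of elements
of that ring, while its transcendence degree is at least two. Two elements over which it is
algebraic must therefore be independent. -/
theorem IsCoord.algebraicIndependent {u v : K} (h : IsCoord u v) :
    AlgebraicIndependent ℂ ![u, v] := by
  have hr : Set.range ![u, v] = {u, v} := by simp [Set.pair_comm]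
  have alg : Algebra.IsAlgebraic (Algebra.adjoin ℂ (Set.range ![u, v])) K := by
    rw [hr]
    refine ⟨fun w => ?_⟩
    have hw : w ∈ IntermediateField.adjoin ℂ {u, v} := h ▸ IntermediateField.mem_top
    obtain ⟨a, ha, b, hb, rfl⟩ := IntermediateField.mem_adjoin_iff_div.1 hw
    have ha' := isAlgebraic_algebraMap (A := K) (⟨a, ha⟩ : Algebra.adjoin ℂ {u, v})
    have hb' := isAlgebraic_algebraMap (A := K) (⟨b, hb⟩ : Algebra.adjoin ℂ {u, v})
    rw [div_eq_mul_inv]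
    exact ha'.mul hb'.inv
  refine (Algebra.IsAlgebraic.isTranscendenceBasis_of_le_trdeg_of_finite ℂ ![u, v] ?_).1
  have h1 := trdeg_le_of_injective
    (IsScalarTower.toAlgHom ℂ (MvPolynomial (Fin 2) ℂ) K) (IsFractionRing.injective _ _)
  rw [MvPolynomial.trdeg_of_isDomain] at h1
  simpa using h1

theorem IsCoord.injective {u v : K} (h : IsCoord u v) :
    Function.Injective (aeval (R := ℂ) ![u, v]) :=
  h.algebraicIndependent

theorem IsCoord.swap {u v : K} (h : IsCoord u v) : IsCoord v u :=
  h.of_mem (mem_adjoin_right _ _) (mem_adjoin_left _ _)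

theorem IsCoord.ne_const {u v : K} (h : IsCoord u v) (c : ℂ) : u - algebraMap ℂ K c ≠ 0 := by
  intro h0
  have : aeval (R := ℂ) ![u, v] (X 0 - C c) = aeval (R := ℂ) ![u, v] 0 := by simpa using h0
  have := congrArg (eval ![c + 1, 0]) (h.injective this)
  simp at this

theorem IsCoord.left_ne_zero {u v : K} (h : IsCoord u v) : u ≠ 0 := by
  simpa using h.ne_const 0

theorem IsCoord.right_ne_zero {u v : K} (h : IsCoord u v) : v ≠ 0 := h.swap.left_ne_zero

theorem IsCoord.sub_const {u v : K} (h : IsCoord u v) (c : ℂ) :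
    IsCoord (u - algebraMap ℂ K c) v := by
  refine h.of_mem ?_ (mem_adjoin_right _ _)
  have := add_mem (mem_adjoin_left (u - algebraMap ℂ K c) v)
    (IntermediateField.algebraMap_mem (IntermediateField.adjoin ℂ {u - algebraMap ℂ K c, v}) c)
  simpa using this

theorem IsCoord.inv_left {u v : K} (h : IsCoord u v) : IsCoord u⁻¹ v := by
  refine h.of_mem ?_ (mem_adjoin_right _ _)
  simpa using inv_mem (mem_adjoin_left u⁻¹ v)

theorem IsCoord.div_left {u v : K} (h : IsCoord u v) : IsCoord (u / v) v := by
  refine h.of_mem ?_ (mem_adjoin_right _ _)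
  have := mul_mem (mem_adjoin_left (u / v) v) (mem_adjoin_right (u / v) v)
  rwa [div_mul_cancel₀ _ h.right_ne_zero] at this

theorem IsCoord.div_right {u v : K} (h : IsCoord u v) : IsCoord u (v / u) :=
  h.swap.div_left.swap

/-! ### Local rings -/

/-- The non-units of `R` form an ideal. -/
def IsLocalSub (R : Subalgebra ℂ K) : Prop :=
  ∀ w ∈ nonunitSet R, ∀ w' ∈ nonunitSet R, w + w' ∈ nonunitSet R

/-- The function `w`, regular at `R`, has the value `c` at `R`. -/
def Val (R : Subalgebra ℂ K) (w : K) (c : ℂ) : Prop := w - algebraMap ℂ K c ∈ nonunitSet R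

/-- The function `w` is regular along `R`, but it has no constant value there. -/
def IsGeneric (R : Subalgebra ℂ K) (w : K) : Prop := w ∈ R ∧ ∀ c, ¬ Val R w c

variable {R S V : Subalgebra ℂ K}

/-- No locality is needed: an inverse of `r * w` in `R`, multiplied by `r`, is an inverse of `w`. -/
theorem nonunitSet_mul {r w : K} (hr : r ∈ R) (hw : w ∈ nonunitSet R) : r * w ∈ nonunitSet R := by
  refine ⟨mul_mem hr hw.1, ?_⟩
  by_contra! hcon
  obtain ⟨h0, hi⟩ := hcon
  have hw0 : w ≠ 0 := right_ne_zero_of_mul h0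
  have hr0 : r ≠ 0 := left_ne_zero_of_mul h0
  refine (hw.2.resolve_left hw0) ?_
  have := mul_mem hr hi
  rwa [mul_inv, ← mul_assoc, mul_inv_cancel₀ hr0, one_mul] at this

theorem zero_mem_nonunitSet : (0 : K) ∈ nonunitSet R := ⟨zero_mem _, Or.inl rfl⟩

theorem one_notMem_nonunitSet : (1 : K) ∉ nonunitSet R := by
  rintro ⟨h1, h2 | h2⟩
  · exact one_ne_zero h2
  · simp [one_mem] at h2

theorem IsUnitOf.notMem {w : K} (h : IsUnitOf R w) : w ∉ nonunitSet R := by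
  rintro ⟨_, h0 | h0⟩
  · exact h.1 h0
  · exact h0 h.2.2

theorem isUnitOf_of_notMem {w : K} (h : w ∈ R) (h' : w ∉ nonunitSet R) : IsUnitOf R w := by
  by_contra hc
  refine h' ⟨h, ?_⟩
  by_contra! h2
  exact hc ⟨h2.1, h, h2.2⟩

theorem isUnitOf_one : IsUnitOf R 1 := ⟨one_ne_zero, one_mem _, by simp [one_mem]⟩

theorem IsUnitOf.mul {w w' : K} (h : IsUnitOf R w) (h' : IsUnitOf R w') : IsUnitOf R (w * w') :=
  ⟨mul_ne_zero h.1 h'.1, mul_mem h.2.1 h'.2.1, by rw [mul_inv]; exact mul_mem h.2.2 h'.2.2⟩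

theorem IsUnitOf.inv {w : K} (h : IsUnitOf R w) : IsUnitOf R w⁻¹ :=
  ⟨inv_ne_zero h.1, h.2.2, by simpa using h.2.1⟩

theorem IsUnitOf.mono {w : K} (h : IsUnitOf R w) (hRV : R ≤ V) : IsUnitOf V w :=
  ⟨h.1, hRV h.2.1, hRV h.2.2⟩

theorem isUnitOf_algebraMap {c : ℂ} (hc : c ≠ 0) : IsUnitOf R (algebraMap ℂ K c) :=
  ⟨by simpa using hc, R.algebraMap_mem c, by rw [← map_inv₀]; exact R.algebraMap_mem _⟩

theorem val_const (c : ℂ) : Val R (algebraMap ℂ K c) c := by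
  simp [Val, zero_mem_nonunitSet]

theorem val_zero {w : K} : Val R w 0 ↔ w ∈ nonunitSet R := by simp [Val]

theorem val_one : Val R 1 1 := by simpa using val_const (R := R) 1

theorem Val.mem {w : K} {c : ℂ} (h : Val R w c) : w ∈ R := by
  simpa using add_mem h.1 (R.algebraMap_mem c)

theorem IsLocalSub.sub (hR : IsLocalSub R) {w w' : K} (h : w ∈ nonunitSet R)
    (h' : w' ∈ nonunitSet R) : w - w' ∈ nonunitSet R := by
  have := hR w h _ (nonunitSet_mul (neg_mem (one_mem R)) h')
  simpa [sub_eq_add_neg] using this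

theorem IsLocalSub.unit_add (hR : IsLocalSub R) {w w' : K} (h : IsUnitOf R w)
    (h' : w' ∈ nonunitSet R) : IsUnitOf R (w + w') := by
  refine isUnitOf_of_notMem (add_mem h.2.1 h'.1) fun hc => h.notMem ?_
  simpa using hR.sub hc h'

theorem IsLocalSub.val_add (hR : IsLocalSub R) {w w' : K} {c c' : ℂ} (h : Val R w c)
    (h' : Val R w' c') : Val R (w + w') (c + c') := by
  have := hR _ h _ h'
  rw [Val, map_add]
  convert this using 1; ring

theorem IsLocalSub.val_sub (hR : IsLocalSub R) {w w' : K} {c c' : ℂ} (h : Val R w c)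
    (h' : Val R w' c') : Val R (w - w') (c - c') := by
  have := hR.sub h h'
  rw [Val, map_sub]
  convert this using 1; ring

theorem IsLocalSub.val_mul (hR : IsLocalSub R) {w w' : K} {c c' : ℂ} (h : Val R w c)
    (h' : Val R w' c') : Val R (w * w') (c * c') := by
  have := hR _ (nonunitSet_mul h'.mem h) _ (nonunitSet_mul (R.algebraMap_mem c) h')
  rw [Val, map_mul]
  convert this using 1; ring

theorem IsLocalSub.val_pow (hR : IsLocalSub R) {w : K} {c : ℂ} (h : Val R w c) (n : ℕ) :
    Val R (w ^ n) (c ^ n) := by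
  induction n with
  | zero => simpa using val_one
  | succ n ih => simpa [pow_succ] using hR.val_mul ih h

theorem IsLocalSub.val_unit (hR : IsLocalSub R) {w : K} {c : ℂ} (h : Val R w c) (hc : c ≠ 0) :
    IsUnitOf R w := by
  have := hR.unit_add (isUnitOf_algebraMap hc) h
  simpa using this

theorem IsLocalSub.val_inv (hR : IsLocalSub R) {w : K} {c : ℂ} (h : Val R w c) (hc : c ≠ 0) :
    Val R w⁻¹ c⁻¹ := by
  have hu := hR.val_unit h hc
  have := nonunitSet_mul (mul_mem hu.2.2 (neg_mem (R.algebraMap_mem c⁻¹))) h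
  rw [Val]
  convert this using 1
  have h1 := hu.1
  have h2 : algebraMap ℂ K c ≠ 0 := by simpa using hc
  rw [map_inv₀]
  field_simp
  ring

theorem IsLocalSub.val_div (hR : IsLocalSub R) {w w' : K} {c c' : ℂ} (h : Val R w c)
    (h' : Val R w' c') (hc : c' ≠ 0) : Val R (w / w') (c / c') := by
  rw [div_eq_mul_inv, div_eq_mul_inv]; exact hR.val_mul h (hR.val_inv h' hc)

theorem IsLocalSub.val_unique (hR : IsLocalSub R) {w : K} {c c' : ℂ} (h : Val R w c)
    (h' : Val R w c') : c = c' := by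
  by_contra hne
  have := hR.val_sub h h'
  rw [sub_self] at this
  exact (hR.val_unit this (sub_ne_zero.2 hne)).1 rfl

/-- The step down a chain of blow-ups: `w - c` is the regular quotient times the vanishing function
`s`. -/
theorem val_zero_of_div {w s : K} {c : ℂ} (hs0 : s ≠ 0) (hs : Val R s 0)
    (hw : (w - algebraMap ℂ K c) / s ∈ R) : Val R w c := by
  have := nonunitSet_mul hw (val_zero.1 hs)
  rwa [div_mul_cancel₀ _ hs0] at this

theorem Val.not_inv_mem {w : K} (h : Val R w 0) (h0 : w ≠ 0) : w⁻¹ ∉ R :=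
  (val_zero.1 h).2.resolve_left h0

/-! ### Generic functions along a curve -/

theorem IsLocalSub.generic_unit (_hR : IsLocalSub R) {w : K} (h : IsGeneric R w) (c : ℂ) :
    IsUnitOf R (w - algebraMap ℂ K c) :=
  isUnitOf_of_notMem (sub_mem h.1 (R.algebraMap_mem c)) (h.2 c)

theorem IsLocalSub.generic_sub_const (hR : IsLocalSub R) {w : K} (h : IsGeneric R w) (c : ℂ) :
    IsGeneric R (w - algebraMap ℂ K c) := by
  refine ⟨sub_mem h.1 (R.algebraMap_mem c), fun d hd => h.2 (d + c) ?_⟩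
  simpa using hR.val_add hd (val_const c)

theorem IsLocalSub.generic_inv (hR : IsLocalSub R) {w : K} (h : IsGeneric R w) :
    IsGeneric R w⁻¹ := by
  have hu : IsUnitOf R w := by simpa using hR.generic_unit h 0
  refine ⟨hu.2.2, fun d hd => ?_⟩
  by_cases hd0 : d = 0
  · subst hd0
    exact hu.inv.notMem (val_zero.1 hd)
  · exact h.2 d⁻¹ (by simpa using hR.val_inv hd hd0)

/-- Over `ℂ` the polynomial splits, and each linear factor `w - a` is a unit because `w` does not
take the constant value `a`. -/
theorem IsLocalSub.generic_poly_unit (hR : IsLocalSub R) {w : K} (h : IsGeneric R w)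
    (r : Polynomial ℂ) (hr : r ≠ 0) : IsUnitOf R (Polynomial.aeval w r) := by
  rw [(IsAlgClosed.splits r).eq_prod_roots]
  rw [map_mul, Polynomial.aeval_C]
  refine (isUnitOf_algebraMap (by simpa using hr)).mul ?_
  induction r.roots using Multiset.induction_on with
  | empty => simpa using isUnitOf_one
  | cons a s ih =>
    rw [Multiset.map_cons, Multiset.prod_cons, map_mul]
    refine IsUnitOf.mul ?_ ih
    simpa using hR.generic_unit h a

/-! ### Local rings of points and curves, as localizations of polynomial rings -/

/-- The ring of `p(u,v) / r(u,v)` with `φ r ≠ 0`. -/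
def IsLocAt {A : Type} [CommRing A] [IsDomain A] [Algebra ℂ A] (R : Subalgebra ℂ K) (u v : K)
    (φ : MvPolynomial (Fin 2) ℂ →ₐ[ℂ] A) : Prop :=
  ∀ w, w ∈ R ↔ ∃ p r : MvPolynomial (Fin 2) ℂ, φ r ≠ 0 ∧ aeval ![u, v] r ≠ 0 ∧
    w * aeval ![u, v] r = aeval ![u, v] p

section Localization

variable {A : Type} [CommRing A] [IsDomain A] [Algebra ℂ A] {u v : K}
  {φ : MvPolynomial (Fin 2) ℂ →ₐ[ℂ] A}

theorem IsLocAt.mem_of (h : IsLocAt R u v φ) (hc : IsCoord u v) {w : K}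
    {p r : MvPolynomial (Fin 2) ℂ} (hr : φ r ≠ 0)
    (e : w * aeval ![u, v] r = aeval ![u, v] p) : w ∈ R := by
  refine (h w).2 ⟨p, r, hr, fun h0 => hr ?_, e⟩
  rw [hc.injective (h0.trans (map_zero _).symm), map_zero]

/-- The kernel of `φ` is prime because `A` is a domain. If `p / r` with `φ p = 0` had an inverse `p'
/ r'`, then `p p' = r r'` as polynomials by algebraic independence, and `φ` would send this to `0 =
φ r * φ r' ≠ 0`. Points use this with `A = ℂ`, curves with `A = ℂ[X]`. -/
theorem IsLocAt.mem_nonunitSet (h : IsLocAt R u v φ) (hc : IsCoord u v) (w : K) :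
    w ∈ nonunitSet R ↔ ∃ p r : MvPolynomial (Fin 2) ℂ, φ r ≠ 0 ∧ φ p = 0 ∧
      w * aeval ![u, v] r = aeval ![u, v] p := by
  have ne0 : ∀ r, φ r ≠ 0 → aeval ![u, v] r ≠ 0 := fun r hr h0 => hr (by
    rw [hc.injective (h0.trans (map_zero _).symm), map_zero])
  constructor
  · rintro ⟨hw, hw'⟩
    obtain ⟨p, r, hr, hr0, e⟩ := (h w).1 hw
    refine ⟨p, r, hr, ?_, e⟩
    by_contra hp
    have hp0 := ne0 p hp
    have hw0 : w ≠ 0 := by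
      rintro rfl
      rw [zero_mul] at e
      exact hp0 e.symm
    refine hw'.resolve_left hw0 (h.mem_of hc (p := r) (r := p) hp ?_)
    rw [← e]
    field_simp
  · rintro ⟨p, r, hr, hp, e⟩
    refine ⟨h.mem_of hc hr e, ?_⟩
    by_contra! hcon
    obtain ⟨p', r', hr', hr0', e'⟩ := (h _).1 hcon.2
    have key : aeval (R := ℂ) ![u, v] (p * p') = aeval (R := ℂ) ![u, v] (r * r') := by
      rw [map_mul, map_mul, ← e, ← e']
      have := hcon.1
      field_simp
    have := congrArg φ (hc.injective key)
    rw [map_mul, map_mul, hp, zero_mul] at this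
    exact mul_ne_zero hr hr' this.symm

theorem IsLocAt.isLocalSub (h : IsLocAt R u v φ) (hc : IsCoord u v) : IsLocalSub R := by
  intro w hw w' hw'
  obtain ⟨p, r, hr, hp, e⟩ := (h.mem_nonunitSet hc w).1 hw
  obtain ⟨p', r', hr', hp', e'⟩ := (h.mem_nonunitSet hc w').1 hw'
  refine (h.mem_nonunitSet hc _).2 ⟨p * r' + p' * r, r * r', ?_, ?_, ?_⟩
  · rw [map_mul]; exact mul_ne_zero hr hr'
  · rw [map_add, map_mul, map_mul, hp, hp']; simp
  · rw [map_mul, map_add, map_mul, map_mul, ← e, ← e']; ring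

theorem IsLocAt.aeval_mem (h : IsLocAt R u v φ) (hc : IsCoord u v) (p : MvPolynomial (Fin 2) ℂ) :
    aeval ![u, v] p ∈ R :=
  h.mem_of hc (p := p) (r := 1) (by simp) (by simp)

theorem IsLocAt.aeval_mem_nonunitSet (h : IsLocAt R u v φ) (hc : IsCoord u v)
    {p : MvPolynomial (Fin 2) ℂ} (hp : φ p = 0) : aeval ![u, v] p ∈ nonunitSet R :=
  (h.mem_nonunitSet hc _).2 ⟨p, 1, by simp, hp, by simp⟩

end Localization

theorem pointAt_isLocAt (u v : K) (a b : ℂ) :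
    IsLocAt (pointAt u v a b) u v (aeval (R := ℂ) ![a, b]) := by
  intro w
  have h : ∀ r : MvPolynomial (Fin 2) ℂ, aeval (R := ℂ) ![a, b] r = eval ![a, b] r := fun r =>
    RingHom.congr_fun (MvPolynomial.coe_aeval_eq_eval _) r
  simp only [h]
  rfl

theorem curveAt_isLocAt (u v : K) :
    IsLocAt (curveAt u v) u v (aeval (R := ℂ) ![(Polynomial.X : Polynomial ℂ), 0]) :=
  fun _ => Iff.rfl

section

variable {u v : K}

theorem IsCoord.isLocalSub_pointAt (hc : IsCoord u v) (a b : ℂ) : IsLocalSub (pointAt u v a b) :=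
  (pointAt_isLocAt u v a b).isLocalSub hc

theorem IsCoord.isLocalSub_curveAt (hc : IsCoord u v) : IsLocalSub (curveAt u v) :=
  (curveAt_isLocAt u v).isLocalSub hc

theorem IsCoord.val_left (hc : IsCoord u v) (a b : ℂ) : Val (pointAt u v a b) u a := by
  have := (pointAt_isLocAt u v a b).aeval_mem_nonunitSet hc (p := X 0 - C a) (by simp)
  simpa [Val] using this

theorem IsCoord.val_right (hc : IsCoord u v) (a b : ℂ) : Val (pointAt u v a b) v b := by
  have := (pointAt_isLocAt u v a b).aeval_mem_nonunitSet hc (p := X 1 - C b) (by simp)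
  simpa [Val] using this

theorem val_aeval (hS : IsLocalSub S) {a b : ℂ} (hu : Val S u a) (hv : Val S v b)
    (p : MvPolynomial (Fin 2) ℂ) : Val S (aeval ![u, v] p) (aeval ![a, b] p) := by
  induction p using MvPolynomial.induction_on with
  | C c => simpa using val_const c
  | add p q hp hq => simpa using hS.val_add hp hq
  | mul_X p i hp =>
    rw [map_mul, map_mul]
    refine hS.val_mul hp ?_
    fin_cases i
    · simpa using hu
    · simpa using hv

/-- Evaluating a polynomial in `u`, `v` at `S` is evaluating it at `(a, b)`. Hence a numerator
vanishing at `(a, b)` vanishes at `S`, and a denominator nonzero at `(a, b)` is a unit of `S`. -/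
theorem val_of_val_pointAt (hc : IsCoord u v) (hS : IsLocalSub S) {a b : ℂ} (hu : Val S u a)
    (hv : Val S v b) {w : K} {c : ℂ} (hw : Val (pointAt u v a b) w c) : Val S w c := by
  obtain ⟨p, r, hr, hp, e⟩ := ((pointAt_isLocAt u v a b).mem_nonunitSet hc _).1 hw
  have h1 := hS.val_unit (val_aeval hS hu hv r) hr
  have h2 := val_aeval hS hu hv p
  rw [hp, ← e, val_zero] at h2
  have := nonunitSet_mul h1.2.2 h2
  rw [Val]
  convert this using 1
  have := h1.1
  field_simp

theorem IsCoord.exists_val (hc : IsCoord u v) {a b : ℂ} {w : K} (hw : w ∈ pointAt u v a b) :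
    ∃ c, Val (pointAt u v a b) w c := by
  have hS := hc.isLocalSub_pointAt a b
  obtain ⟨p, r, hr, hr0, e⟩ := (pointAt_isLocAt u v a b w).1 hw
  have h1 := val_aeval hS (hc.val_left a b) (hc.val_right a b) r
  have h2 := val_aeval hS (hc.val_left a b) (hc.val_right a b) p
  rw [← eq_div_iff hr0] at e
  rw [e]
  exact ⟨_, hS.val_div h2 h1 hr⟩

theorem pointAt_le (hc : IsCoord u v) (hS : IsLocalSub S) {a b : ℂ} (hu : Val S u a)
    (hv : Val S v b) : pointAt u v a b ≤ S := by
  intro w hw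
  obtain ⟨c, h⟩ := hc.exists_val hw
  exact (val_of_val_pointAt hc hS hu hv h).mem

/-- The working criterion for recognizing one point in two coordinate systems: a local ring is
pinned down by the values that it gives to a pair of birational coordinates. -/
theorem pointAt_eq {u' v' : K} (hc : IsCoord u v) (hc' : IsCoord u' v') {a b a' b' : ℂ}
    (hu : Val (pointAt u' v' a' b') u a) (hv : Val (pointAt u' v' a' b') v b)
    (hu' : Val (pointAt u v a b) u' a') (hv' : Val (pointAt u v a b) v' b') :
    pointAt u v a b = pointAt u' v' a' b' :=
  le_antisymm (pointAt_le hc (hc'.isLocalSub_pointAt _ _) hu hv)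
    (pointAt_le hc' (hc.isLocalSub_pointAt _ _) hu' hv')

theorem pointAt_swap (hc : IsCoord u v) (a b : ℂ) : pointAt u v a b = pointAt v u b a :=
  pointAt_eq hc hc.swap (hc.swap.val_right _ _) (hc.swap.val_left _ _) (hc.val_right _ _)
    (hc.val_left _ _)

theorem pointAt_sub_const (hc : IsCoord u v) (a b c : ℂ) :
    pointAt (u - algebraMap ℂ K c) v (a - c) b = pointAt u v a b := by
  have hc' := hc.sub_const c
  have := (hc'.isLocalSub_pointAt _ _).val_add (hc'.val_left (a - c) b) (val_const c)
  rw [sub_add_cancel, sub_add_cancel] at this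
  exact pointAt_eq hc' hc ((hc.isLocalSub_pointAt _ _).val_sub (hc.val_left _ _) (val_const c))
    (hc.val_right _ _) this (hc'.val_right _ _)

theorem exists_pointAt_decomp (a b : ℂ) (p : MvPolynomial (Fin 2) ℂ) :
    ∃ P Q : MvPolynomial (Fin 2) ℂ,
      p = C (aeval (R := ℂ) ![a, b] p) + P * (X 0 - C a) + Q * (X 1 - C b) := by
  induction p using MvPolynomial.induction_on with
  | C c => exact ⟨0, 0, by simp⟩
  | add p q hp hq =>
    obtain ⟨P, Q, e⟩ := hp
    obtain ⟨P', Q', e'⟩ := hq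
    refine ⟨P + P', Q + Q', ?_⟩
    rw [map_add, C_add]
    linear_combination e + e'
  | mul_X p i hp =>
    obtain ⟨P, Q, e⟩ := hp
    rw [map_mul, C_mul]
    fin_cases i
    · refine ⟨P * X 0 + C (aeval (R := ℂ) ![a, b] p), Q * X 0, ?_⟩
      simp only [Fin.zero_eta, aeval_X, Matrix.cons_val_zero]
      linear_combination (X 0 : MvPolynomial (Fin 2) ℂ) * e
    · refine ⟨P * X 1, Q * X 1 + C (aeval (R := ℂ) ![a, b] p), ?_⟩
      simp only [Fin.mk_one, aeval_X, Matrix.cons_val_one, Matrix.cons_val_fin_one]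
      linear_combination (X 1 : MvPolynomial (Fin 2) ℂ) * e

theorem IsCoord.isParameters (hc : IsCoord u v) (a b : ℂ) :
    IsParameters (pointAt u v a b) (u - algebraMap ℂ K a) (v - algebraMap ℂ K b) := by
  have hS := hc.isLocalSub_pointAt a b
  ext w
  constructor
  · intro hw
    obtain ⟨p, r, hr, hp, e⟩ := ((pointAt_isLocAt u v a b).mem_nonunitSet hc _).1 hw
    obtain ⟨P, Q, e'⟩ := exists_pointAt_decomp a b p
    have h1 := hS.val_unit (val_aeval hS (hc.val_left a b) (hc.val_right a b) r) hr
    have hP := (pointAt_isLocAt u v a b).aeval_mem hc P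
    have hQ := (pointAt_isLocAt u v a b).aeval_mem hc Q
    refine ⟨_, mul_mem hP h1.2.2, _, mul_mem hQ h1.2.2, ?_⟩
    have e2 := congrArg (aeval (R := ℂ) ![u, v]) e'
    rw [hp] at e2
    simp only [map_add, map_mul, map_sub, map_zero, aeval_X, Matrix.cons_val_zero,
      Matrix.cons_val_one, Matrix.cons_val_fin_one, aeval_C] at e2
    have := h1.1
    field_simp
    rw [e, e2]; ring
  · rintro ⟨r, hr, s, hs, rfl⟩
    exact hS _ (nonunitSet_mul hr (hc.val_left a b)) _ (nonunitSet_mul hs (hc.val_right a b))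

theorem IsParameters.swap (h : IsParameters R u v) : IsParameters R v u := by
  rw [IsParameters] at *
  rw [h]
  ext w
  constructor <;> rintro ⟨r, hr, s, hs, rfl⟩ <;> exact ⟨s, hs, r, hr, by ring⟩

/-! ### Curves -/

theorem exists_curveAt_decomp (p : MvPolynomial (Fin 2) ℂ) :
    ∃ P : MvPolynomial (Fin 2) ℂ,
      p = Polynomial.aeval (X 0) (aeval (R := ℂ) ![(Polynomial.X : Polynomial ℂ), 0] p) +
        P * X 1 := by
  induction p using MvPolynomial.induction_on with
  | C c => exact ⟨0, by simp [MvPolynomial.algebraMap_eq]⟩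
  | add p q hp hq =>
    obtain ⟨P, e⟩ := hp
    obtain ⟨P', e'⟩ := hq
    refine ⟨P + P', ?_⟩
    rw [map_add, map_add]
    linear_combination e + e'
  | mul_X p i hp =>
    obtain ⟨P, e⟩ := hp
    rw [map_mul, map_mul]
    fin_cases i
    · refine ⟨P * X 0, ?_⟩
      simp only [Fin.zero_eta, aeval_X, Matrix.cons_val_zero, Polynomial.aeval_X]
      linear_combination (X 0 : MvPolynomial (Fin 2) ℂ) * e
    · refine ⟨p, by simp⟩

theorem aeval_eq_curve (u v : K) (p : MvPolynomial (Fin 2) ℂ) :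
    ∃ P : MvPolynomial (Fin 2) ℂ, aeval ![u, v] p =
      Polynomial.aeval u (aeval (R := ℂ) ![(Polynomial.X : Polynomial ℂ), 0] p) +
        aeval ![u, v] P * v := by
  obtain ⟨P, e⟩ := exists_curveAt_decomp p
  refine ⟨P, ?_⟩
  conv_lhs => rw [e]
  rw [map_add, map_mul, ← Polynomial.aeval_algHom_apply]
  simp

theorem IsCoord.val_curve (hc : IsCoord u v) : Val (curveAt u v) v 0 := by
  have := (curveAt_isLocAt u v).aeval_mem_nonunitSet hc (p := X 1) (by simp)
  simpa [Val] using this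

theorem IsCoord.generic_curve (hc : IsCoord u v) : IsGeneric (curveAt u v) u := by
  constructor
  · simpa using (curveAt_isLocAt u v).aeval_mem hc (X 0)
  · intro c h
    obtain ⟨p, r, hr, hp, e⟩ := ((curveAt_isLocAt u v).mem_nonunitSet hc _).1 h
    have key : aeval (R := ℂ) ![u, v] ((X 0 - C c) * r) = aeval (R := ℂ) ![u, v] p := by
      rw [← e]; simp
    have := congrArg (aeval (R := ℂ) ![(Polynomial.X : Polynomial ℂ), 0]) (hc.injective key)
    rw [hp, map_mul] at this
    refine mul_ne_zero ?_ hr this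
    simpa using Polynomial.X_sub_C_ne_zero c

/-- A denominator has the form `r(u, 0) + P v` with `r(u, 0) ≠ 0`. The first summand is a unit of
`S` by `generic_poly_unit` and the second is a nonunit, so the sum is invertible in `S`. -/
theorem curveAt_le (hS : IsLocalSub S) (hu : IsGeneric S u) (hv : Val S v 0) :
    curveAt u v ≤ S := by
  have hmem : ∀ p : MvPolynomial (Fin 2) ℂ, aeval ![u, v] p ∈ S := by
    intro p
    induction p using MvPolynomial.induction_on with
    | C c => simp
    | add p q hp hq => simpa using add_mem hp hq
    | mul_X p i hp =>
      rw [map_mul]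
      refine mul_mem hp ?_
      fin_cases i
      · simpa using hu.1
      · simpa using hv.mem
  intro w hw
  obtain ⟨p, r, hr, hr0, e⟩ := (curveAt_isLocAt u v w).1 hw
  obtain ⟨P, eP⟩ := aeval_eq_curve u v r
  have h1 : IsUnitOf S (aeval ![u, v] r) := by
    rw [eP]
    exact hS.unit_add (hS.generic_poly_unit hu _ hr) (nonunitSet_mul (hmem P) (val_zero.1 hv))
  rw [← eq_div_iff hr0] at e
  rw [e, div_eq_mul_inv]
  exact mul_mem (hmem p) h1.2.2

theorem curveAt_eq {u' v' : K} (hc : IsCoord u v) (hc' : IsCoord u' v')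
    (hu : IsGeneric (curveAt u' v') u) (hv : Val (curveAt u' v') v 0)
    (hu' : IsGeneric (curveAt u v) u') (hv' : Val (curveAt u v) v' 0) :
    curveAt u v = curveAt u' v' :=
  le_antisymm (curveAt_le hc'.isLocalSub_curveAt hu hv)
    (curveAt_le hc.isLocalSub_curveAt hu' hv')

theorem curveAt_sub_const (hc : IsCoord u v) (c : ℂ) :
    curveAt (u - algebraMap ℂ K c) v = curveAt u v := by
  refine curveAt_eq (hc.sub_const c) hc (hc.isLocalSub_curveAt.generic_sub_const hc.generic_curve c)
    hc.val_curve ?_ (hc.sub_const c).val_curve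
  have := (hc.sub_const c).isLocalSub_curveAt.generic_sub_const (hc.sub_const c).generic_curve (-c)
  simpa using this

theorem curveAt_inv (hc : IsCoord u v) : curveAt u⁻¹ v = curveAt u v := by
  refine curveAt_eq hc.inv_left hc (hc.isLocalSub_curveAt.generic_inv hc.generic_curve)
    hc.val_curve ?_ hc.inv_left.val_curve
  simpa using hc.inv_left.isLocalSub_curveAt.generic_inv hc.inv_left.generic_curve

/-- Invariance of strict transforms: `u` is generic, hence a unit, along `v = 0`, so the blow-up
chart `(u, v/u)` sees the same curve. -/
theorem curveAt_div (hc : IsCoord u v) : curveAt u (v / u) = curveAt u v := by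
  have hc' : IsCoord u (v / u) := hc.div_right
  refine curveAt_eq hc' hc hc.generic_curve ?_ hc'.generic_curve ?_
  · have h := hc.isLocalSub_curveAt.generic_inv hc.generic_curve
    rw [val_zero, div_eq_inv_mul]
    exact nonunitSet_mul h.1 (val_zero.1 hc.val_curve)
  · have := nonunitSet_mul hc'.generic_curve.1 (val_zero.1 hc'.val_curve)
    rwa [mul_div_cancel₀ _ hc.left_ne_zero, ← val_zero] at this

theorem pointAt_le_curveAt (u v : K) (a : ℂ) : pointAt u v a 0 ≤ curveAt u v := by
  intro w hw
  obtain ⟨p, r, hr, hr0, e⟩ := (pointAt_isLocAt u v a 0 w).1 hw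
  refine (curveAt_isLocAt u v w).2 ⟨p, r, fun h0 => hr ?_, hr0, e⟩
  have := congrArg (Polynomial.aeval a) h0
  rw [← AlgHom.comp_apply, map_zero] at this
  convert this using 2
  ext i
  fin_cases i <;> simp

/-- If `p / r` is regular at the point and vanishes along the curve, then `p(u, 0) = 0`, since
otherwise `p` would be a unit along the curve. So `v` divides `p`. -/
theorem isLocalEquation_coord (hc : IsCoord u v) (a : ℂ) :
    IsLocalEquation (pointAt u v a 0) (curveAt u v) v := by
  refine Or.inl ⟨pointAt_le_curveAt u v a, ?_⟩
  ext w
  constructor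
  · rintro ⟨hw, hw'⟩
    obtain ⟨p, r, hr, hr0, e⟩ := (pointAt_isLocAt u v a 0 w).1 hw
    have hS := hc.isLocalSub_pointAt a 0
    have hru := hS.val_unit (val_aeval hS (hc.val_left a 0) (hc.val_right a 0) r) hr
    have hp : aeval ![u, v] p ∈ nonunitSet (curveAt u v) := by
      rw [← e, mul_comm]
      exact nonunitSet_mul (pointAt_le_curveAt u v a hru.2.1) hw'
    have hp0 : aeval (R := ℂ) ![(Polynomial.X : Polynomial ℂ), 0] p = 0 := by
      by_contra h0
      obtain ⟨P, eP⟩ := aeval_eq_curve u v p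
      have hV := hc.isLocalSub_curveAt
      have h1 := hV.unit_add (hV.generic_poly_unit hc.generic_curve _ h0)
        (nonunitSet_mul ((curveAt_isLocAt u v).aeval_mem hc P) (val_zero.1 hc.val_curve))
      rw [← eP] at h1
      exact h1.notMem hp
    obtain ⟨P, eP⟩ := aeval_eq_curve u v p
    rw [hp0, map_zero, zero_add] at eP
    refine ⟨_, mul_mem ((pointAt_isLocAt u v a 0).aeval_mem hc P) hru.2.2, ?_⟩
    rw [eP] at e
    field_simp
    exact e
  · rintro ⟨r, hr, rfl⟩
    have := nonunitSet_mul hr (val_zero.1 (hc.val_right a 0))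
    exact ⟨this.1, nonunitSet_mul (pointAt_le_curveAt u v a hr) (val_zero.1 hc.val_curve)⟩

/-- Modulo `v`, the fraction `p(u, v) / r(u, v)` becomes `p(u, 0) / r(u, 0)`, so `u` generates the
residue field. -/
theorem IsCoord.curve_residue (hc : IsCoord u v) :
    ∃ u' ∈ curveAt u v, (∀ r : Polynomial ℂ, r ≠ 0 →
        IsUnitOf (curveAt u v) (Polynomial.aeval u' r)) ∧
      ∀ w ∈ curveAt u v, ∃ p r : Polynomial ℂ, r ≠ 0 ∧
        w - Polynomial.aeval u' p / Polynomial.aeval u' r ∈ nonunitSet (curveAt u v) := by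
  have hV := hc.isLocalSub_curveAt
  have hu := hV.generic_poly_unit hc.generic_curve
  refine ⟨u, hc.generic_curve.1, hu, fun w hw => ?_⟩
  obtain ⟨p, r, hr, hr0, e⟩ := (curveAt_isLocAt u v w).1 hw
  obtain ⟨P, eP⟩ := aeval_eq_curve u v p
  obtain ⟨Q, eQ⟩ := aeval_eq_curve u v r
  refine ⟨aeval (R := ℂ) ![(Polynomial.X : Polynomial ℂ), 0] p, _, hr, ?_⟩
  have hmem := (curveAt_isLocAt u v).aeval_mem hc
  have hv := val_zero.1 hc.val_curve
  set p₀ := Polynomial.aeval u (aeval (R := ℂ) ![(Polynomial.X : Polynomial ℂ), 0] p)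
  set r₀ := Polynomial.aeval u (aeval (R := ℂ) ![(Polynomial.X : Polynomial ℂ), 0] r)
  have h1 := hu _ hr
  -- With `p = p₀ + P v` and `r = r₀ + Q v`, the relation `w r = p` gives `w - p₀ / r₀ = (P - w Q) v
  -- / r₀`.
  have := hV.sub (nonunitSet_mul (mul_mem (hmem P) h1.2.2) hv)
    (nonunitSet_mul (mul_mem (mul_mem hw (hmem Q)) h1.2.2) hv)
  convert this using 1
  have h10 := h1.1
  have e3 : aeval ![u, v] p = p₀ + aeval ![u, v] P * v := eP
  have e4 : aeval ![u, v] r = r₀ + aeval ![u, v] Q * v := eQ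
  rw [e3, e4] at e
  change w - p₀ / r₀ = _ * r₀⁻¹ * v - _ * r₀⁻¹ * v
  have h10' : r₀ ≠ 0 := h10
  field_simp
  linear_combination e

end

end InceX

end

/-! ### The blow-up of a point, independently of the chosen parameters. -/

noncomputable section

namespace InceX

open MvPolynomial

/-! ### Points and curves over a blown-up point -/

section BlowUp

variable {R S : Subalgebra ℂ K} {u v f g : K}

theorem le_blowUpChart (R : Subalgebra ℂ K) (u v : K) : R ≤ blowUpChart R u v := le_sup_left

theorem div_mem_blowUpChart (R : Subalgebra ℂ K) (u v : K) : v / u ∈ blowUpChart R u v :=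
  (le_sup_right : _ ≤ blowUpChart R u v) (Algebra.subset_adjoin rfl)

theorem blowUpChart_le (hR : R ≤ S) (hv : v / u ∈ S) : blowUpChart R u v ≤ S :=
  sup_le hR (Algebra.adjoin_le (by simpa using hv))

theorem IsParameters.left_mem (h : IsParameters R u v) : u ∈ nonunitSet R := by
  rw [h]; exact ⟨1, one_mem _, 0, zero_mem _, by ring⟩

theorem IsParameters.right_mem (h : IsParameters R u v) : v ∈ nonunitSet R := h.swap.left_mem

theorem IsParameters.isLocalSub (h : IsParameters R u v) : IsLocalSub R := by
  intro w hw w' hw'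
  rw [h] at hw hw' ⊢
  obtain ⟨r, hr, s, hs, rfl⟩ := hw
  obtain ⟨r', hr', s', hs', rfl⟩ := hw'
  exact ⟨r + r', add_mem hr hr', s + s', add_mem hs hs', by ring⟩

/-- Modulo `u`, an element of `R` reduces to its value: the maximal ideal is generated by `u` and `v
= (v/u) u`, both multiples of `u` in the chart. So only polynomials in `v/u` survive modulo `u`. -/
theorem blowUpChart_decomp (h : IsParameters R u v) (hu : u ≠ 0)
    (hres : ∀ w ∈ R, ∃ c, Val R w c) {w : K} (hw : w ∈ blowUpChart R u v) :
    ∃ p : Polynomial ℂ, ∃ k ∈ blowUpChart R u v, w = Polynomial.aeval (v / u) p + k * u := by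
  have hθ := div_mem_blowUpChart R u v
  have hmem : ∀ p : Polynomial ℂ, Polynomial.aeval (v / u) p ∈ blowUpChart R u v := fun p =>
    (le_sup_right : _ ≤ blowUpChart R u v)
      (by rw [Algebra.adjoin_singleton_eq_range_aeval]; exact ⟨p, rfl⟩)
  have humem : u ∈ blowUpChart R u v := le_blowUpChart R u v h.left_mem.1
  have hA : blowUpChart R u v = Algebra.adjoin ℂ (R ∪ {v / u}) := by
    rw [blowUpChart, Algebra.adjoin_union, Algebra.adjoin_eq]
  rw [hA] at hw
  induction hw using Algebra.adjoin_induction with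
  | mem w hw =>
    rcases hw with hw | rfl
    · obtain ⟨c, hc⟩ := hres w hw
      rw [Val, h] at hc
      obtain ⟨r, hr, s, hs, e⟩ := hc
      refine ⟨Polynomial.C c, r + s * (v / u), add_mem (le_blowUpChart R u v hr)
        (mul_mem (le_blowUpChart R u v hs) hθ), ?_⟩
      rw [Polynomial.aeval_C, add_mul, mul_assoc, div_mul_cancel₀ _ hu, ← e]; ring
    · exact ⟨Polynomial.X, 0, zero_mem _, by simp⟩
  | algebraMap c => exact ⟨Polynomial.C c, 0, zero_mem _, by simp⟩
  | add w w' hw hw' ih ih' =>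
    obtain ⟨p, k, hk, e⟩ := ih
    obtain ⟨p', k', hk', e'⟩ := ih'
    exact ⟨p + p', k + k', add_mem hk hk', by rw [map_add, e, e']; ring⟩
  | mul w w' hw hw' ih ih' =>
    obtain ⟨p, k, hk, e⟩ := ih
    obtain ⟨p', k', hk', e'⟩ := ih'
    rw [← hA] at hw'
    refine ⟨p * p', k * w' + Polynomial.aeval (v / u) p * k',
      add_mem (mul_mem hk hw') (mul_mem (hmem p) hk'), ?_⟩
    rw [map_mul]
    linear_combination w' * e + Polynomial.aeval (v / u) p * e'

theorem blowUpChart_decomp_point (h : IsParameters R u v) (hu : u ≠ 0)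
    (hres : ∀ w ∈ R, ∃ c, Val R w c) {w : K} (hw : w ∈ blowUpChart R u v) :
    ∃ c : ℂ, ∃ k ∈ blowUpChart R u v, ∃ l ∈ blowUpChart R u v,
      w = algebraMap ℂ K c + (k * u + l * (v / u)) := by
  obtain ⟨p, k, hk, e⟩ := blowUpChart_decomp h hu hres hw
  refine ⟨p.coeff 0, k, hk, Polynomial.aeval (v / u) p.divX,
    (le_sup_right : _ ≤ blowUpChart R u v)
      (by rw [Algebra.adjoin_singleton_eq_range_aeval]; exact ⟨_, rfl⟩), ?_⟩
  conv_lhs => rw [e, ← Polynomial.divX_mul_X_add p]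
  rw [map_add, map_mul, Polynomial.aeval_X, Polynomial.aeval_C]
  ring

theorem pointAt_zero (hc : IsCoord u v) (a b : ℂ) :
    pointAt (u - algebraMap ℂ K a) (v - algebraMap ℂ K b) 0 0 = pointAt u v a b := by
  have h1 := pointAt_sub_const hc a b a
  have h2 := pointAt_sub_const (hc.sub_const a).swap b 0 b
  rw [sub_self] at h1 h2
  rw [pointAt_swap (hc.sub_const a), h2.symm, pointAt_swap ((hc.sub_const a).swap.sub_const b)] at h1
  rw [h1]

theorem IsCoord.isParameters_zero (hc : IsCoord u v) : IsParameters (pointAt u v 0 0) u v := by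
  simpa using hc.isParameters 0 0

/-- A chart element `q(v/u) + k u` with `q ≠ 0` is a unit along the curve, because `v/u` is generic
there. Therefore the nonunits among the chart elements are exactly the multiples of `u`, and
localizing at `(u)` gives the ring of the curve. -/
theorem isExceptionalCurve_pointAt_zero (hc : IsCoord u v) :
    IsExceptionalCurve (pointAt u v 0 0) (curveAt (v / u) u) := by
  have hu := hc.left_ne_zero
  have hc' : IsCoord (v / u) u := hc.swap.div_left
  have hV := hc'.isLocalSub_curveAt
  refine ⟨u, v, hc.isParameters_zero, ?_⟩
  have hvV : Val (curveAt (v / u) u) v 0 := by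
    have := nonunitSet_mul hc'.generic_curve.1 (val_zero.1 hc'.val_curve)
    rwa [div_mul_cancel₀ _ hu, ← val_zero] at this
  have hle : blowUpChart (pointAt u v 0 0) u v ≤ curveAt (v / u) u :=
    blowUpChart_le (pointAt_le hc hV hc'.val_curve hvV) hc'.generic_curve.1
  have hu_mem : u ∈ blowUpChart (pointAt u v 0 0) u v :=
    le_blowUpChart _ _ _ hc.isParameters_zero.left_mem.1
  ext w
  constructor
  · intro hw
    obtain ⟨p, r, hr, hr0, e⟩ := (curveAt_isLocAt _ _ w).1 hw
    have hmem : ∀ p : MvPolynomial (Fin 2) ℂ,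
        aeval ![v / u, u] p ∈ blowUpChart (pointAt u v 0 0) u v := by
      intro p
      induction p using MvPolynomial.induction_on with
      | C c => simp
      | add p q hp hq => simpa using add_mem hp hq
      | mul_X p i hp =>
        rw [map_mul]
        refine mul_mem hp ?_
        fin_cases i
        · simpa using div_mem_blowUpChart (pointAt u v 0 0) u v
        · simpa using hu_mem
    refine ⟨_, hmem p, _, hmem r, ?_, (eq_div_iff hr0).2 e⟩
    rintro ⟨k, hk, e'⟩
    have h1 : aeval ![v / u, u] r ∈ nonunitSet (curveAt (v / u) u) := by
      rw [e']; exact nonunitSet_mul (hle hk) (val_zero.1 hc'.val_curve)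
    obtain ⟨P, eP⟩ := aeval_eq_curve (v / u) u r
    have h2 := hV.unit_add (hV.generic_poly_unit hc'.generic_curve _ hr)
      (nonunitSet_mul ((curveAt_isLocAt _ _).aeval_mem hc' P) (val_zero.1 hc'.val_curve))
    rw [← eP] at h2
    exact h2.notMem h1
  · rintro ⟨p, hp, r, hr, hr', rfl⟩
    have hru : IsUnitOf (curveAt (v / u) u) r := by
      refine isUnitOf_of_notMem (hle hr) fun hcon => hr' ?_
      obtain ⟨q, k, hk, e⟩ := blowUpChart_decomp hc.isParameters_zero hu
        (fun w hw => hc.exists_val hw) hr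
      by_cases hq : q = 0
      · exact ⟨k, hk, by rw [e, hq]; simp⟩
      · have := hV.unit_add (hV.generic_poly_unit hc'.generic_curve _ hq)
          (nonunitSet_mul (hle hk) (val_zero.1 hc'.val_curve))
        rw [← e] at this
        exact absurd hcon this.notMem
    rw [div_eq_mul_inv]
    exact mul_mem (hle hp) hru.2.2

theorem isExceptionalCurve_pointAt (hc : IsCoord u v) (a b : ℂ) :
    IsExceptionalCurve (pointAt u v a b)
      (curveAt ((v - algebraMap ℂ K b) / (u - algebraMap ℂ K a)) (u - algebraMap ℂ K a)) := by
  rw [← pointAt_zero hc]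
  exact isExceptionalCurve_pointAt_zero ((hc.sub_const a).swap.sub_const b).swap

/-- The maximal ideal of the local ring of a point of a surface is not principal. -/
theorem not_principal (hc : IsCoord u v) {h : K} (hh : h ∈ nonunitSet (pointAt u v 0 0))
    (hu : ∃ a ∈ pointAt u v 0 0, u = a * h) (hv : ∃ b ∈ pointAt u v 0 0, v = b * h) : False := by
  -- Along the curve `u = 0`, which passes through the point, `u / v` vanishes; so its inverse is
  -- not regular along the curve, hence not at the point.
  have key : ∀ {u v : K}, IsCoord u v → v / u ∉ pointAt u v 0 0 := by
    intro u v hc hmem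
    rw [pointAt_swap hc] at hmem
    have hV := hc.swap.isLocalSub_curveAt
    have hg := hV.generic_inv hc.swap.generic_curve
    have h1 : Val (curveAt v u) (v⁻¹ * u) 0 := by
      rw [val_zero]; exact nonunitSet_mul hg.1 (val_zero.1 hc.swap.val_curve)
    refine h1.not_inv_mem (mul_ne_zero (inv_ne_zero hc.right_ne_zero) hc.left_ne_zero) ?_
    have := pointAt_le_curveAt v u 0 hmem
    rwa [mul_inv, inv_inv, ← div_eq_mul_inv]
  obtain ⟨a, ha, ea⟩ := hu
  obtain ⟨b, hb, eb⟩ := hv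
  have hu0 := hc.left_ne_zero
  have hv0 := hc.right_ne_zero
  have hh0 : h ≠ 0 := by rintro rfl; simp at ea; exact hu0 ea
  -- Write `h = r u + s v` and cancel `h`: this leaves `1 = r a + s b`, which is impossible if `a`
  -- and `b` are both nonunits. If one of them is a unit, then `u / v` or `v / u` is regular,
  -- against `key`.
  by_cases ha' : a ∈ nonunitSet (pointAt u v 0 0)
  · by_cases hb' : b ∈ nonunitSet (pointAt u v 0 0)
    · have hp := hc.isParameters_zero
      rw [hp] at hh ha' hb'
      obtain ⟨r, hr, s, hs, e⟩ := hh
      obtain ⟨r₁, hr₁, s₁, hs₁, e₁⟩ := ha'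
      obtain ⟨r₂, hr₂, s₂, hs₂, e₂⟩ := hb'
      have h1 : (1 : K) = r * r₁ * u + r * s₁ * v + (s * r₂ * u + s * s₂ * v) := by
        have : h * 1 = h * (r * r₁ * u + r * s₁ * v + (s * r₂ * u + s * s₂ * v)) := by
          rw [ea, eb] at e
          linear_combination e + r * h * e₁ + s * h * e₂
        exact mul_left_cancel₀ hh0 this
      refine one_notMem_nonunitSet (R := pointAt u v 0 0) ?_
      rw [hp]
      exact ⟨r * r₁ + s * r₂, add_mem (mul_mem hr hr₁) (mul_mem hs hr₂), r * s₁ + s * s₂,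
        add_mem (mul_mem hr hs₁) (mul_mem hs hs₂), by linear_combination h1⟩
    · have hbu := isUnitOf_of_notMem hb hb'
      refine key hc.swap ?_
      rw [← pointAt_swap hc]
      have : u / v = a * b⁻¹ := by
        have := hbu.1
        rw [div_eq_iff hv0, ea, eb]; field_simp
      rw [this]
      exact mul_mem ha hbu.2.2
  · have hau := isUnitOf_of_notMem ha ha'
    refine key hc ?_
    have : v / u = b * a⁻¹ := by
      have := hau.1
      rw [div_eq_iff hu0, ea, eb]; field_simp
    rw [this]
    exact mul_mem hb hau.2.2

/-- The localization defining the point over `R` in the direction `v = 0`. -/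
theorem pointOver_coord (hc : IsCoord u v) :
    (pointAt u (v / u) 0 0 : Set K) = {w | ∃ p ∈ blowUpChart (pointAt u v 0 0) u v,
      ∃ r ∈ blowUpChart (pointAt u v 0 0) u v,
      (¬ ∃ k ∈ blowUpChart (pointAt u v 0 0) u v, ∃ l ∈ blowUpChart (pointAt u v 0 0) u v,
        r = k * u + l * (v / u)) ∧ w = p / r} := by
  have hu := hc.left_ne_zero
  have hc' : IsCoord u (v / u) := hc.div_right
  have hT := hc'.isLocalSub_pointAt 0 0
  have hu0 := hc'.val_left 0 0
  have hθ := hc'.val_right 0 0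
  have hv0 : Val (pointAt u (v / u) 0 0) v 0 := by
    have := nonunitSet_mul hθ.mem (val_zero.1 hu0)
    rwa [div_mul_cancel₀ _ hu, ← val_zero] at this
  have hle : blowUpChart (pointAt u v 0 0) u v ≤ pointAt u (v / u) 0 0 :=
    blowUpChart_le (pointAt_le hc hT hu0 hv0) hθ.mem
  have hI : ∀ k ∈ blowUpChart (pointAt u v 0 0) u v, ∀ l ∈ blowUpChart (pointAt u v 0 0) u v,
      k * u + l * (v / u) ∈ nonunitSet (pointAt u (v / u) 0 0) := fun k hk l hl =>
    hT _ (nonunitSet_mul (hle hk) (val_zero.1 hu0)) _ (nonunitSet_mul (hle hl) (val_zero.1 hθ))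
  ext w
  constructor
  · intro hw
    obtain ⟨p, r, hr, hr0, e⟩ := (pointAt_isLocAt _ _ _ _ w).1 hw
    have hmem : ∀ p : MvPolynomial (Fin 2) ℂ,
        aeval ![u, v / u] p ∈ blowUpChart (pointAt u v 0 0) u v := by
      intro p
      induction p using MvPolynomial.induction_on with
      | C c => simp
      | add p q hp hq => simpa using add_mem hp hq
      | mul_X p i hp =>
        rw [map_mul]
        refine mul_mem hp ?_
        fin_cases i
        · simpa using le_blowUpChart _ _ _ hc.isParameters_zero.left_mem.1
        · simpa using div_mem_blowUpChart (pointAt u v 0 0) u v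
    refine ⟨_, hmem p, _, hmem r, ?_, (eq_div_iff hr0).2 e⟩
    rintro ⟨k, hk, l, hl, e'⟩
    have h1 := hT.val_unit (val_aeval hT hu0 hθ r) hr
    rw [e'] at h1
    exact h1.notMem (hI k hk l hl)
  · rintro ⟨p, hp, r, hr, hr', rfl⟩
    obtain ⟨c, k, hk, l, hl, e⟩ := blowUpChart_decomp_point hc.isParameters_zero hu
      (fun w hw => hc.exists_val hw) hr
    have hc0 : c ≠ 0 := by
      rintro rfl
      exact hr' ⟨k, hk, l, hl, by rw [e]; simp⟩
    have hru := hT.unit_add (isUnitOf_algebraMap hc0) (hI k hk l hl)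
    rw [← e] at hru
    rw [div_eq_mul_inv]
    exact mul_mem (hle hp) hru.2.2

/-- The conditions on `α` and `γ` say that `g = 0` and `v = 0` have the same tangent direction. The
slopes are related by `v/u = (γ + δ g/f) / (α + β g/f)` and by an inverse formula of the same shape,
so each slope vanishes at the point defined by the other. -/
theorem pointOver_unique (hc : IsCoord u v) (hfg : IsParameters (pointAt u v 0 0) f g)
    (hS : (S : Set K) = {w | ∃ p ∈ blowUpChart (pointAt u v 0 0) f g,
      ∃ r ∈ blowUpChart (pointAt u v 0 0) f g,
      (¬ ∃ k ∈ blowUpChart (pointAt u v 0 0) f g, ∃ l ∈ blowUpChart (pointAt u v 0 0) f g,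
        r = k * f + l * (g / f)) ∧ w = p / r})
    {α β γ δ : K} (hα : IsUnitOf (pointAt u v 0 0) α) (hβ : β ∈ pointAt u v 0 0)
    (hγ : γ ∈ nonunitSet (pointAt u v 0 0)) (hδ : δ ∈ pointAt u v 0 0)
    (eu : u = α * f + β * g) (ev : v = γ * f + δ * g) :
    S = pointAt u (v / u) 0 0 := by
  have hu := hc.left_ne_zero
  have hp := hc.isParameters_zero
  have hR := hp.isLocalSub
  have hfm := hfg.left_mem
  have hgm := hfg.right_mem
  have hf_notMem : ∀ r ∈ pointAt u v 0 0, f ≠ r * g := fun r hr e =>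
    not_principal hc hgm ⟨α * r + β, add_mem (mul_mem hα.2.1 hr) hβ, by rw [eu, e]; ring⟩
      ⟨γ * r + δ, add_mem (mul_mem hγ.1 hr) hδ, by rw [ev, e]; ring⟩
  have hf : f ≠ 0 := fun h0 => hf_notMem 0 (zero_mem _) (by rw [h0]; ring)
  obtain ⟨α', hα', β', hβ', ef⟩ : f ∈ {w | ∃ r ∈ pointAt u v 0 0, ∃ s ∈ pointAt u v 0 0,
    w = r * u + s * v} := hp ▸ hfm
  obtain ⟨γ', hγ', δ', hδ', eg⟩ : g ∈ {w | ∃ r ∈ pointAt u v 0 0, ∃ s ∈ pointAt u v 0 0,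
    w = r * u + s * v} := hp ▸ hgm
  -- Substitution gives `(γ' α + δ' γ) f = (1 - γ' β - δ' δ) g`. For a unit `γ'` the left
  -- coefficient is a unit and `f` is a multiple of `g`, contrary to `hf_notMem`.
  have hγ'm : γ' ∈ nonunitSet (pointAt u v 0 0) := by
    by_contra hcon
    have hγu := isUnitOf_of_notMem hγ' hcon
    have h1 := hR.unit_add (hγu.mul hα) (nonunitSet_mul hδ' hγ)
    refine hf_notMem (((1 - γ' * β - δ' * δ)) * (γ' * α + δ' * γ)⁻¹)
      (mul_mem (sub_mem (sub_mem (one_mem _) (mul_mem hγ' hβ)) (mul_mem hδ' hδ)) h1.2.2) ?_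
    have := h1.1
    field_simp
    linear_combination (-1) * eg - γ' * eu - δ' * ev
  -- If `α'` were a nonunit, `u = (α α' + β γ') u + (α β' + β δ') v` could be solved for `u` as a
  -- multiple of `v`, and the maximal ideal would be principal.
  have hα'u : IsUnitOf (pointAt u v 0 0) α' := by
    refine isUnitOf_of_notMem hα' fun hcon => ?_
    have h1 := hR.unit_add isUnitOf_one (nonunitSet_mul (neg_mem (one_mem _))
      (hR _ (nonunitSet_mul hα.2.1 hcon) _ (nonunitSet_mul hβ hγ'm)))
    refine not_principal hc hp.right_mem
      ⟨(α * β' + β * δ') * (1 + -1 * (α * α' + β * γ'))⁻¹,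
        mul_mem (add_mem (mul_mem hα.2.1 hβ') (mul_mem hβ hδ')) h1.2.2, ?_⟩
      ⟨1, one_mem _, by ring⟩
    have := h1.1
    rw [mul_assoc, mul_comm _ v, ← mul_assoc, eq_mul_inv_iff_mul_eq₀ this]
    linear_combination eu + α * ef + β * eg
  have hc' : IsCoord u (v / u) := hc.div_right
  have hT := hc'.isLocalSub_pointAt 0 0
  have hu0 := hc'.val_left 0 0
  have hθ := hc'.val_right 0 0
  have hv0 : Val (pointAt u (v / u) 0 0) v 0 := by
    have := nonunitSet_mul hθ.mem (val_zero.1 hu0)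
    rwa [div_mul_cancel₀ _ hu, ← val_zero] at this
  have hRT : pointAt u v 0 0 ≤ pointAt u (v / u) 0 0 := pointAt_le hc hT hu0 hv0
  have hmT : ∀ w ∈ nonunitSet (pointAt u v 0 0), w ∈ nonunitSet (pointAt u (v / u) 0 0) :=
    fun w hw => val_zero.1 (val_of_val_pointAt hc hT hu0 hv0 (val_zero.2 hw))
  have hden := hT.unit_add (hα'u.mono hRT) (nonunitSet_mul (hRT hβ') (val_zero.1 hθ))
  have hgf : g / f = (α' + β' * (v / u))⁻¹ * (γ' + δ' * (v / u)) := by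
    have := hden.1
    rw [div_eq_iff hf, eq_comm, mul_assoc, inv_mul_eq_iff_eq_mul₀ this]
    rw [ef, eg]; field_simp
  have hθfg : g / f ∈ nonunitSet (pointAt u (v / u) 0 0) := by
    rw [hgf]
    exact nonunitSet_mul hden.2.2 (hT _ (hmT _ hγ'm) _ (nonunitSet_mul (hRT hδ') (val_zero.1 hθ)))
  have hle : blowUpChart (pointAt u v 0 0) f g ≤ pointAt u (v / u) 0 0 :=
    blowUpChart_le hRT hθfg.1
  have hmS : ∀ w, w ∈ S ↔ ∃ p ∈ blowUpChart (pointAt u v 0 0) f g,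
      ∃ r ∈ blowUpChart (pointAt u v 0 0) f g,
      (¬ ∃ k ∈ blowUpChart (pointAt u v 0 0) f g, ∃ l ∈ blowUpChart (pointAt u v 0 0) f g,
        r = k * f + l * (g / f)) ∧ w = p / r := fun w => Set.ext_iff.1 hS w
  set Ch := blowUpChart (pointAt u v 0 0) f g with hCh
  have hRC : pointAt u v 0 0 ≤ Ch := le_blowUpChart _ _ _
  have hθC : g / f ∈ Ch := div_mem_blowUpChart _ _ _
  have hgθ : g = g / f * f := by field_simp
  -- `S` is given only as a set of fractions. To see that it is local, the ideal `(f, g/f)` of the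
  -- chart is shown to be proper, with constants as a complement, hence prime.
  let I : Set K := {w | ∃ k ∈ Ch, ∃ l ∈ Ch, w = k * f + l * (g / f)}
  have hIadd : ∀ w ∈ I, ∀ w' ∈ I, w + w' ∈ I := by
    rintro _ ⟨k, hk, l, hl, rfl⟩ _ ⟨k', hk', l', hl', rfl⟩
    exact ⟨k + k', add_mem hk hk', l + l', add_mem hl hl', by ring⟩
  have hImul : ∀ r ∈ Ch, ∀ w ∈ I, r * w ∈ I := by
    rintro r hr _ ⟨k, hk, l, hl, rfl⟩
    exact ⟨r * k, mul_mem hr hk, r * l, mul_mem hr hl, by ring⟩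
  have hIC : ∀ w ∈ I, w ∈ Ch := by
    rintro _ ⟨k, hk, l, hl, rfl⟩
    exact add_mem (mul_mem hk (hRC hfm.1)) (mul_mem hl hθC)
  have hI1 : (1 : K) ∉ I := by
    intro h1
    -- Since `0` belongs to `S`, it is a fraction whose denominator lies outside `I`; thus `I` is
    -- not the whole chart.
    obtain ⟨p, hp, r, hr, hr', e⟩ := (hmS 0).1 (zero_mem S)
    refine hr' (?_ : r ∈ I)
    have := hImul r hr 1 h1
    rwa [mul_one] at this
  have hdec : ∀ w ∈ Ch, ∃ c : ℂ, ∃ i ∈ I, w = algebraMap ℂ K c + i := by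
    intro w hw
    obtain ⟨c, k, hk, l, hl, e⟩ := blowUpChart_decomp_point hfg hf
      (fun w hw => hc.exists_val hw) hw
    exact ⟨c, _, ⟨k, hk, l, hl, rfl⟩, e⟩
  have hconst : ∀ c : ℂ, c ≠ 0 → ∀ i ∈ I, algebraMap ℂ K c + i ∉ I := by
    intro c hc0 i hi hcon
    have h1 := hIadd _ hcon _ (hImul _ (neg_mem (one_mem Ch)) _ hi)
    have h2 := hImul _ (Ch.algebraMap_mem c⁻¹) _ h1
    refine hI1 ?_
    convert h2 using 1
    have : algebraMap ℂ K c ≠ 0 := by simpa using hc0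
    rw [map_inv₀]
    field_simp
    ring
  have hprime : ∀ r ∈ Ch, r ∉ I → ∀ r' ∈ Ch, r' ∉ I → r * r' ∉ I := by
    intro r hr hrI r' hr' hrI'
    obtain ⟨c, i, hi, rfl⟩ := hdec r hr
    obtain ⟨c', i', hi', rfl⟩ := hdec r' hr'
    have hc0 : c ≠ 0 := by rintro rfl; exact hrI (by simpa using hi)
    have hc0' : c' ≠ 0 := by rintro rfl; exact hrI' (by simpa using hi')
    have := hconst (c * c') (mul_ne_zero hc0 hc0') _
      (hIadd _ (hImul _ hr _ hi') _ (hImul _ (Ch.algebraMap_mem c') _ hi))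
    rw [map_mul] at this
    convert this using 1
    ring_nf
  have hnon : ∀ w, w ∈ nonunitSet S ↔ ∃ i ∈ I, ∃ r ∈ Ch, r ∉ I ∧ w = i / r := by
    intro w
    constructor
    · rintro ⟨hw, hw'⟩
      obtain ⟨p, hp, r, hr, hrI, rfl⟩ := (hmS w).1 hw
      by_cases hpI : p ∈ I
      · exact ⟨p, hpI, r, hr, hrI, rfl⟩
      · have : (p / r)⁻¹ ∈ S := (hmS _).2 ⟨r, hr, p, hp, hpI, by rw [inv_div]⟩
        rw [hw'.resolve_right (not_not_intro this)]
        exact ⟨0, ⟨0, zero_mem _, 0, zero_mem _, by ring⟩, 1, one_mem _, hI1, by simp⟩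
    · rintro ⟨i, hi, r, hr, hrI, rfl⟩
      refine ⟨(hmS _).2 ⟨i, hIC i hi, r, hr, hrI, rfl⟩, ?_⟩
      by_contra! hcon
      obtain ⟨h0, hinv⟩ := hcon
      obtain ⟨p', hp', r', hr', hrI', e⟩ := (hmS _).1 hinv
      have hi0 : i ≠ 0 := by rintro rfl; simp at h0
      have hr'0 : r' ≠ 0 := by
        rintro rfl; exact hrI' ⟨0, zero_mem _, 0, zero_mem _, by ring⟩
      refine hprime r hr hrI r' hr' hrI' ?_
      have : r * r' = p' * i := by
        rw [inv_div, div_eq_div_iff hi0 hr'0] at e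
        exact e
      rw [this]
      exact hImul p' hp' i hi
  have hSloc : IsLocalSub S := by
    intro w hw w' hw'
    obtain ⟨i, hi, r, hr, hrI, rfl⟩ := (hnon w).1 hw
    obtain ⟨i', hi', r', hr', hrI', rfl⟩ := (hnon w').1 hw'
    refine (hnon _).2 ⟨r' * i + r * i', hIadd _ (hImul _ hr' _ hi) _ (hImul _ hr _ hi'), r * r',
      mul_mem hr hr', hprime r hr hrI r' hr' hrI', ?_⟩
    have h0 : r ≠ 0 := by
      rintro rfl; exact hrI ⟨0, zero_mem _, 0, zero_mem _, by ring⟩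
    have h0' : r' ≠ 0 := by
      rintro rfl; exact hrI' ⟨0, zero_mem _, 0, zero_mem _, by ring⟩
    field_simp
  have hmI : ∀ w ∈ nonunitSet (pointAt u v 0 0), w ∈ I := by
    intro w hw
    rw [hfg] at hw
    obtain ⟨r, hr, s, hs, rfl⟩ := hw
    refine ⟨r + s * (g / f), add_mem (hRC hr) (mul_mem (hRC hs) hθC), 0, zero_mem _, ?_⟩
    field_simp; ring
  have hθI : ∀ r ∈ Ch, r * (g / f) ∈ I := fun r hr => ⟨0, zero_mem _, r, hr, by ring⟩
  have hαI : α + β * (g / f) ∉ I := by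
    obtain ⟨c, hcα⟩ := hc.exists_val hα.2.1
    have hc0 : c ≠ 0 := by rintro rfl; exact hα.notMem (val_zero.1 hcα)
    have := hconst c hc0 _ (hIadd _ (hmI _ hcα) _ (hθI β (hRC hβ)))
    convert this using 1
    ring_nf
  refine le_antisymm ?_ (pointAt_le hc' hSloc ?_ ?_)
  · intro w hw
    obtain ⟨p, hp, r, hr, hr', rfl⟩ := (hmS w).1 hw
    obtain ⟨c, i, ⟨k, hk, l, hl, rfl⟩, e⟩ := hdec r hr
    have hc0 : c ≠ 0 := by
      rintro rfl
      exact hr' ⟨k, hk, l, hl, by rw [e]; simp⟩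
    have hru := hT.unit_add (isUnitOf_algebraMap hc0)
      (hT _ (nonunitSet_mul (hle hk) (hmT _ hfm)) _ (nonunitSet_mul (hle hl) hθfg))
    rw [← e] at hru
    rw [div_eq_mul_inv]
    exact mul_mem (hle hp) hru.2.2
  · rw [val_zero, hnon]
    exact ⟨u, hmI u hp.left_mem, 1, one_mem _, hI1, by simp⟩
  · rw [val_zero, hnon]
    refine ⟨γ + δ * (g / f), hIadd _ (hmI _ hγ) _ (hθI δ (hRC hδ)), α + β * (g / f),
      add_mem (hRC hα.2.1) (mul_mem (hRC hβ) hθC), hαI, ?_⟩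
    have h0 : α + β * (g / f) ≠ 0 := by
      intro h0; exact hαI (h0 ▸ ⟨0, zero_mem _, 0, zero_mem _, by ring⟩)
    rw [div_eq_div_iff hu h0]
    have e1 : u = (α + β * (g / f)) * f := by rw [eu]; field_simp
    have e2 : v = (γ + δ * (g / f)) * f := by rw [ev]; field_simp
    rw [mul_comm v]
    conv_lhs => rw [e2]
    conv_rhs => rw [e1]
    ring

/-- The shear turns the tangent direction `v = c u` into `v = 0`, the only direction that
`pointOver_unique` treats. -/
theorem pointAt_shift_right (hc : IsCoord u v) (c : ℂ) :
    IsCoord u (v - algebraMap ℂ K c * u) := by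
  refine hc.of_mem (mem_adjoin_left _ _) ?_
  have := add_mem (mem_adjoin_right u (v - algebraMap ℂ K c * u))
    (mul_mem (IntermediateField.algebraMap_mem
      (IntermediateField.adjoin ℂ {u, v - algebraMap ℂ K c * u}) c)
      (mem_adjoin_left u (v - algebraMap ℂ K c * u)))
  simpa using this

theorem pointAt_shift_eq (hc : IsCoord u v) (c : ℂ) :
    pointAt u (v - algebraMap ℂ K c * u) 0 0 = pointAt u v 0 0 := by
  have hc' := pointAt_shift_right hc c
  have h1 := hc.isLocalSub_pointAt 0 0
  have h2 := hc'.isLocalSub_pointAt 0 0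
  refine pointAt_eq hc' hc (hc.val_left _ _) ?_ (hc'.val_left _ _) ?_
  · simpa using h1.val_sub (hc.val_right 0 0) (h1.val_mul (val_const c) (hc.val_left 0 0))
  · have := h2.val_add (hc'.val_right 0 0) (h2.val_mul (val_const c) (hc'.val_left 0 0))
    simpa using this

theorem pointAt_shift_div (hc : IsCoord u v) (c : ℂ) :
    pointAt u ((v - algebraMap ℂ K c * u) / u) 0 0 = pointAt u (v / u) 0 c := by
  have hu := hc.left_ne_zero
  have h : (v - algebraMap ℂ K c * u) / u = v / u - algebraMap ℂ K c := by field_simp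
  have hc' := hc.div_right
  have := pointAt_zero hc' 0 c
  rw [h, ← this, map_zero, sub_zero]

/-- The new points form the projective line of tangent directions. With `u = α f + β g` and `v = γ f
+ δ g`, the direction `g = 0` is the ratio of the values of `α` and `γ`: it has a finite slope if
`α` is a unit, and otherwise it is the direction `u = 0`. -/
theorem isPointOver_pointAt_zero (hc : IsCoord u v) :
    IsPointOver (pointAt u v 0 0) S ↔
      (∃ c : ℂ, S = pointAt u (v / u) 0 c) ∨ S = pointAt v (u / v) 0 0 := by
  constructor
  · rintro ⟨f, g, hfg, hS⟩
    have hp := hc.isParameters_zero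
    have hR := hp.isLocalSub
    obtain ⟨α, hα, β, hβ, eu⟩ : u ∈ {w | ∃ r ∈ pointAt u v 0 0, ∃ s ∈ pointAt u v 0 0,
      w = r * f + s * g} := hfg ▸ hp.left_mem
    obtain ⟨γ, hγ, δ, hδ, ev⟩ : v ∈ {w | ∃ r ∈ pointAt u v 0 0, ∃ s ∈ pointAt u v 0 0,
      w = r * f + s * g} := hfg ▸ hp.right_mem
    by_cases hαm : α ∈ nonunitSet (pointAt u v 0 0)
    · right
      have hγu : IsUnitOf (pointAt u v 0 0) γ := by
        -- If `α` and `γ` were both nonunits, expanding `f` in `u`, `v` and then in `f`, `g` would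
        -- make `f` a multiple of `g`, so that `u` and `v` would be multiples of `g`.
        refine isUnitOf_of_notMem hγ fun hγm => ?_
        obtain ⟨α', hα', β', hβ', ef⟩ : f ∈ {w | ∃ r ∈ pointAt u v 0 0, ∃ s ∈ pointAt u v 0 0,
          w = r * u + s * v} := hp ▸ hfg.left_mem
        have h1 := hR.unit_add isUnitOf_one (nonunitSet_mul (neg_mem (one_mem _))
          (hR _ (nonunitSet_mul hα' hαm) _ (nonunitSet_mul hβ' hγm)))
        have hr : (α' * β + β' * δ) * (1 + -1 * (α' * α + β' * γ))⁻¹ ∈ pointAt u v 0 0 :=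
          mul_mem (add_mem (mul_mem hα' hβ) (mul_mem hβ' hδ)) h1.2.2
        have e : f = (α' * β + β' * δ) * (1 + -1 * (α' * α + β' * γ))⁻¹ * g := by
          have := h1.1
          rw [mul_assoc, mul_comm _ g, ← mul_assoc, eq_mul_inv_iff_mul_eq₀ this]
          linear_combination ef + α' * eu + β' * ev
        generalize (α' * β + β' * δ) * (1 + -1 * (α' * α + β' * γ))⁻¹ = r at hr e
        exact not_principal hc hfg.right_mem
          ⟨α * r + β, add_mem (mul_mem hα hr) hβ, by rw [eu, e]; ring⟩
          ⟨γ * r + δ, add_mem (mul_mem hγ hr) hδ, by rw [ev, e]; ring⟩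
      rw [pointAt_swap hc] at hS hfg hγu hδ hαm hβ
      exact pointOver_unique hc.swap hfg hS hγu hδ hαm hβ ev eu
    · left
      have hαu := isUnitOf_of_notMem hα hαm
      obtain ⟨a, ha⟩ := hc.exists_val hα
      obtain ⟨d, hd⟩ := hc.exists_val hγ
      have ha0 : a ≠ 0 := by rintro rfl; exact hαm (val_zero.1 ha)
      -- The slope is the quotient of the values of `γ` and `α`; after the shear by it the
      -- coefficient of `f` in the second parameter vanishes at the point.
      refine ⟨d / a, ?_⟩
      have hγ' : γ - algebraMap ℂ K (d / a) * α ∈ nonunitSet (pointAt u v 0 0) := by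
        have := hR.val_sub hd (hR.val_mul (val_const (d / a)) ha)
        rwa [div_mul_cancel₀ _ ha0, sub_self, val_zero] at this
      have hδ' : δ - algebraMap ℂ K (d / a) * β ∈ pointAt u v 0 0 :=
        sub_mem hδ (mul_mem (Subalgebra.algebraMap_mem _ _) hβ)
      rw [← pointAt_shift_div hc]
      rw [← pointAt_shift_eq hc (d / a)] at hS hfg hαu hβ hγ' hδ'
      refine pointOver_unique (pointAt_shift_right hc _) hfg hS hαu hβ hγ' hδ' eu ?_
      linear_combination ev - algebraMap ℂ K (d / a) * eu
  · rintro (⟨c, rfl⟩ | rfl)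
    · refine ⟨u, v - algebraMap ℂ K c * u, ?_, ?_⟩
      · rw [← pointAt_shift_eq hc c]
        exact (pointAt_shift_right hc c).isParameters_zero
      · rw [← pointAt_shift_div hc, ← pointAt_shift_eq hc c]
        exact pointOver_coord (pointAt_shift_right hc c)
    · refine ⟨v, u, hc.isParameters_zero.swap, ?_⟩
      rw [pointAt_swap hc]
      exact pointOver_coord hc.swap

theorem isPointOver_pointAt (hc : IsCoord u v) (a b : ℂ) :
    IsPointOver (pointAt u v a b) S ↔
      (∃ c : ℂ, S = pointAt (u - algebraMap ℂ K a)
        ((v - algebraMap ℂ K b) / (u - algebraMap ℂ K a)) 0 c) ∨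
      S = pointAt (v - algebraMap ℂ K b)
        ((u - algebraMap ℂ K a) / (v - algebraMap ℂ K b)) 0 0 := by
  rw [← pointAt_zero hc]
  exact isPointOver_pointAt_zero ((hc.sub_const a).swap.sub_const b).swap

end BlowUp

end InceX

end

/-! ### The points of the surfaces produced by the eleven blow-ups. -/

noncomputable section

namespace InceX

open MvPolynomial

/-! ### The coordinate systems of the construction -/

theorem xK_ne_zero : xK ≠ 0 := isCoord_xy.left_ne_zero

theorem yK_ne_zero : yK ≠ 0 := isCoord_xy.right_ne_zero

theorem isCoord_line : IsCoord (1 / xK) (yK / xK) := by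
  have hx := xK_ne_zero
  have h1 := mem_adjoin_left (1 / xK) (yK / xK)
  have h2 := mem_adjoin_right (1 / xK) (yK / xK)
  refine isCoord_xy.of_mem (by simpa using inv_mem h1) ?_
  have := div_mem h2 h1
  rwa [div_div_div_cancel_right₀ hx, div_one] at this

theorem isCoord_infinity : IsCoord (xK / yK) (1 / yK) := by
  have hy := yK_ne_zero
  have h1 := mem_adjoin_left (xK / yK) (1 / yK)
  have h2 := mem_adjoin_right (xK / yK) (1 / yK)
  refine isCoord_xy.of_mem ?_ (by simpa using inv_mem h2)
  have := div_mem h1 h2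
  rwa [div_div_div_cancel_right₀ hy, div_one] at this

theorem isCoord_first : IsCoord (xK / yK) (1 / xK) := by
  have hx := xK_ne_zero
  have h := isCoord_line.inv_left.swap.inv_left.swap.inv_left
  simpa using h.swap

theorem isCoord_vertical : IsCoord (1 / yK) xK := by
  simpa using isCoord_xy.swap.inv_left

theorem isCoord_second : IsCoord (1 / xK) (xK ^ 2 / yK) := by
  have hx := xK_ne_zero
  have h := isCoord_first.swap.div_right
  convert h using 1
  field_simp

theorem isCoord_chain (z : ℕ → ℂ) (n : ℕ) : IsCoord (chain z n) (1 / xK) := by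
  induction n with
  | zero =>
    have h := isCoord_second.swap.inv_left
    simpa [chain] using h
  | succ n ih => exact (ih.sub_const (z n)).div_left

theorem isCoord_origin : IsCoord (xK / yK) (yK / xK ^ 2) := by
  have hx := xK_ne_zero
  have h := isCoord_first.div_right
  convert h using 1
  field_simp

theorem one_div_xK_ne_zero : (1 / xK : K) ≠ 0 := one_div_ne_zero xK_ne_zero

theorem chain_sub_ne_zero (z : ℕ → ℂ) (n : ℕ) (c : ℂ) : chain z n - algebraMap ℂ K c ≠ 0 :=
  (isCoord_chain z n).ne_const c

theorem chain_ne_zero (z : ℕ → ℂ) (n : ℕ) : chain z n ≠ 0 := (isCoord_chain z n).left_ne_zero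

theorem isCoord_corner (z : ℕ → ℂ) (n : ℕ) :
    IsCoord (chain z n - algebraMap ℂ K (z n)) (1 / xK / (chain z n - algebraMap ℂ K (z n))) :=
  ((isCoord_chain z n).sub_const (z n)).div_right

theorem chain_zero (z : ℕ → ℂ) : chain z 0 = yK / xK ^ 2 := rfl

/-! ### Points and curves over a chain of blow-ups -/

/-- The point `(c, 0)` of the chart with coordinates `(chain z n, 1/x)`. -/
def chainPoint (z : ℕ → ℂ) (n : ℕ) (c : ℂ) : Subalgebra ℂ K := pointAt (chain z n) (1 / xK) c 0

/-- The curve `1/x = 0` of the chart with coordinates `(chain z n, 1/x)`. -/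
def chainCurve (z : ℕ → ℂ) (n : ℕ) : Subalgebra ℂ K := curveAt (chain z n) (1 / xK)

/-- The intersection point of the curves `chainCurve z n` and `chainCurve z (n + 1)`. -/
def chainCorner (z : ℕ → ℂ) (n : ℕ) : Subalgebra ℂ K :=
  pointAt (chain z n - algebraMap ℂ K (z n)) (1 / xK / (chain z n - algebraMap ℂ K (z n))) 0 0

/-- The exceptional curve of the first blow-up. -/
def firstCurve : Subalgebra ℂ K := curveAt (1 / xK) (xK / yK)

/-- The intersection point of the first and the second exceptional curve. -/
def firstCorner : Subalgebra ℂ K := pointAt (1 / xK) (xK ^ 2 / yK) 0 0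

/-- The point of the first exceptional curve with `x = 0`. -/
def verticalPoint : Subalgebra ℂ K := pointAt (1 / yK) xK 0 0

/-- The intersection point of the line at infinity and the second exceptional curve. -/
def lineCorner : Subalgebra ℂ K := pointAt (xK / yK) (yK / xK ^ 2) 0 0

section Values

variable {R V : Subalgebra ℂ K} {z z' : ℕ → ℂ} {n m k : ℕ} {c c' : ℂ} {w : K}

theorem Val.inv_notMem (h : Val R w⁻¹ 0) (h0 : w ≠ 0) : w ∉ R := by
  simpa using h.not_inv_mem (inv_ne_zero h0)

/-- If the values differed, `w - c'` would be a unit at the point and hence along the curve, where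
it vanishes. -/
theorem val_eq_of_le (hR : IsLocalSub R) (hle : R ≤ V) (h : Val R w c) (h' : Val V w c') :
    c = c' := by
  by_contra hne
  have h1 := hR.val_unit (hR.val_sub h (val_const c')) (sub_ne_zero.2 hne)
  exact (h1.mono hle).notMem h'

/-- A function with a pole at a point is not constant along a curve through it: `1 - c w⁻¹` is a
unit at the point but equals `w⁻¹ (w - c)`, which vanishes along the curve. -/
theorem not_le_of_val_inv (hR : IsLocalSub R) (h0 : w ≠ 0) (h : Val R w⁻¹ 0) (h' : Val V w c) :
    ¬ R ≤ V := by
  intro hle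
  have h1 : IsUnitOf R (1 - algebraMap ℂ K c * w⁻¹) := by
    have := hR.val_sub val_one (hR.val_mul (val_const c) h)
    exact hR.val_unit this (by simp)
  refine (h1.mono hle).notMem ?_
  have := nonunitSet_mul (hle h.mem) h'
  convert this using 1
  field_simp

/-- Each chain coordinate minus its centre is `1/x` times the next coordinate. Regularity at level
`n` thus forces every lower coordinate to take the value of its centre, and this tells the levels of
a tower apart. -/
theorem val_chain_of_mem (hs : Val R (1 / xK) 0) (hn : chain z n ∈ R) (hk : k < n) :
    Val R (chain z k) (z k) := by
  induction n with
  | zero => omega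
  | succ n ih =>
    have h := val_zero_of_div one_div_xK_ne_zero hs hn
    rcases Nat.lt_succ_iff_lt_or_eq.1 hk with hk | rfl
    · exact ih h.mem hk
    · exact h

theorem isLocalSub_chainPoint (z : ℕ → ℂ) (n : ℕ) (c : ℂ) : IsLocalSub (chainPoint z n c) :=
  (isCoord_chain z n).isLocalSub_pointAt _ _

theorem isLocalSub_chainCurve (z : ℕ → ℂ) (n : ℕ) : IsLocalSub (chainCurve z n) :=
  (isCoord_chain z n).isLocalSub_curveAt

theorem isLocalSub_chainCorner (z : ℕ → ℂ) (n : ℕ) : IsLocalSub (chainCorner z n) :=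
  (isCoord_corner z n).isLocalSub_pointAt _ _

theorem val_chainPoint (z : ℕ → ℂ) (n : ℕ) (c : ℂ) : Val (chainPoint z n c) (chain z n) c :=
  (isCoord_chain z n).val_left _ _

theorem val_s_chainPoint (z : ℕ → ℂ) (n : ℕ) (c : ℂ) : Val (chainPoint z n c) (1 / xK) 0 :=
  (isCoord_chain z n).val_right _ _

theorem val_s_chainCurve (z : ℕ → ℂ) (n : ℕ) : Val (chainCurve z n) (1 / xK) 0 :=
  (isCoord_chain z n).val_curve

theorem generic_chainCurve (z : ℕ → ℂ) (n : ℕ) : IsGeneric (chainCurve z n) (chain z n) :=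
  (isCoord_chain z n).generic_curve

theorem val_chainCorner (z : ℕ → ℂ) (n : ℕ) : Val (chainCorner z n) (chain z n) (z n) := by
  have := (isLocalSub_chainCorner z n).val_add ((isCoord_corner z n).val_left 0 0)
    (val_const (z n))
  simpa using this

theorem val_s_chainCorner (z : ℕ → ℂ) (n : ℕ) : Val (chainCorner z n) (1 / xK) 0 := by
  have := (isLocalSub_chainCorner z n).val_mul ((isCoord_corner z n).val_right 0 0)
    ((isCoord_corner z n).val_left 0 0)
  rwa [div_mul_cancel₀ _ (chain_sub_ne_zero z n _), zero_mul] at this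

theorem val_inv_chainCorner (z : ℕ → ℂ) (n : ℕ) :
    Val (chainCorner z n) (chain z (n + 1))⁻¹ 0 := by
  have := (isCoord_corner z n).val_right 0 0
  rwa [chain, inv_div]

/-- On a lower curve `chain z n` is nonconstant, whereas regularity of `chain z m` there would make
it constant. On a higher curve `chain z m` is constantly `z m`, which is not its value at this
point. -/
theorem eq_of_chainPoint_le (h : chainPoint z m c ≤ chainCurve z n) (hc : c ≠ z m) : n = m := by
  rcases lt_trichotomy n m with hlt | rfl | hlt
  · exact absurd (val_chain_of_mem (val_s_chainCurve z n) (h (val_chainPoint z m c).mem) hlt)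
      ((generic_chainCurve z n).2 _)
  · rfl
  · exact absurd (val_eq_of_le (isLocalSub_chainPoint z m c) h (val_chainPoint z m c)
      (val_chain_of_mem (val_s_chainCurve z n) (generic_chainCurve z n).1 hlt)) hc

theorem eq_of_chainCorner_le (h : chainCorner z m ≤ chainCurve z n) : n = m ∨ n = m + 1 := by
  rcases lt_trichotomy n m with hlt | rfl | hlt
  · exact absurd (val_chain_of_mem (val_s_chainCurve z n) (h (val_chainCorner z m).mem) hlt)
      ((generic_chainCurve z n).2 _)
  · exact Or.inl rfl
  · rcases Nat.lt_or_ge (m + 1) n with h1 | h1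
    · exact absurd h (not_le_of_val_inv (isLocalSub_chainCorner z m) (chain_ne_zero z _)
        (val_inv_chainCorner z m)
        (val_chain_of_mem (val_s_chainCurve z n) (generic_chainCurve z n).1 h1))
    · omega

theorem val_zero_chainCurve (hn : 1 ≤ n) : Val (chainCurve z n) (chain z 0) (z 0) :=
  val_chain_of_mem (val_s_chainCurve z n) (generic_chainCurve z n).1 hn

theorem val_zero_chainPoint (hn : 1 ≤ n) : Val (chainPoint z n c) (chain z 0) (z 0) :=
  val_chain_of_mem (val_s_chainPoint z n c) (val_chainPoint z n c).mem hn

theorem val_zero_chainCorner : Val (chainCorner z n) (chain z 0) (z 0) := by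
  rcases Nat.eq_zero_or_pos n with rfl | hn
  · exact val_chainCorner z 0
  · exact val_chain_of_mem (val_s_chainCorner z n) (val_chainCorner z n).mem hn

theorem chainPoint_not_le (hz : z 0 ≠ z' 0) (hm : 1 ≤ m) (hn : 1 ≤ n) :
    ¬ chainPoint z m c ≤ chainCurve z' n := fun h =>
  hz (val_eq_of_le (isLocalSub_chainPoint z m c) h (val_zero_chainPoint hm)
    (val_zero_chainCurve hn))

theorem chainCorner_not_le (hz : z 0 ≠ z' 0) (hn : 1 ≤ n) :
    ¬ chainCorner z m ≤ chainCurve z' n := fun h =>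
  hz (val_eq_of_le (isLocalSub_chainCorner z m) h val_zero_chainCorner (val_zero_chainCurve hn))

theorem not_le_chainCurve (hx : xK ∈ R) : ¬ R ≤ chainCurve z n := fun h => by
  have := (val_s_chainCurve z n).not_inv_mem one_div_xK_ne_zero
  rw [one_div, inv_inv] at this
  exact this (h hx)

theorem chainPoint_injective : Function.Injective (chainPoint z n) := fun a b h =>
  (isLocalSub_chainPoint z n b).val_unique (h ▸ val_chainPoint z n a) (val_chainPoint z n b)

/-! ### The first exceptional curve and the line at infinity -/

/-- The function `y/x²` sorts the curves: it has a pole along the first exceptional curve, vanishes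
along the line at infinity, is nonconstant along the second exceptional curve, and is constantly `z
0` along the later curves of a chain. -/
theorem val_inv_chain_firstCurve (z : ℕ → ℂ) : Val firstCurve (chain z 0)⁻¹ 0 := by
  have h := isCoord_first.swap
  have := nonunitSet_mul (h.isLocalSub_curveAt.generic_inv h.generic_curve).1
    (val_zero.1 h.val_curve)
  have hx := xK_ne_zero
  have e : (chain z 0)⁻¹ = (1 / xK)⁻¹ * (xK / yK) := by
    have hy := yK_ne_zero
    rw [chain_zero]
    field_simp
  rw [val_zero, e]
  exact this

theorem not_le_firstCurve_of_chain (h : chain z 0 ∈ R) : ¬ R ≤ firstCurve := fun hle =>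
  (val_inv_chain_firstCurve z).inv_notMem (chain_ne_zero z 0) (hle h)

theorem not_le_firstCurve_of_y (h : yK ∈ R) : ¬ R ≤ firstCurve := fun hle => by
  have hc := isCoord_first.swap
  have := nonunitSet_mul hc.generic_curve.1 (val_zero.1 hc.val_curve)
  have h1 : 1 / xK * (xK / yK) = yK⁻¹ := by
    have hx := xK_ne_zero
    field_simp
  rw [h1] at this
  exact (val_zero.2 this).inv_notMem yK_ne_zero (hle h)

theorem isLocalSub_lineAtInfinity : IsLocalSub lineAtInfinity :=
  isCoord_line.swap.isLocalSub_curveAt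

theorem val_chain_lineAtInfinity (z : ℕ → ℂ) : Val lineAtInfinity (chain z 0) 0 := by
  have h := isCoord_line.swap
  have := nonunitSet_mul h.generic_curve.1 (val_zero.1 h.val_curve)
  have e : chain z 0 = yK / xK * (1 / xK) := by
    have hx := xK_ne_zero
    rw [chain_zero]
    field_simp
  rw [val_zero, e]
  exact this

theorem not_le_lineAtInfinity_of_x (hx : xK ∈ R) : ¬ R ≤ lineAtInfinity := fun h => by
  have h0 : Val lineAtInfinity (1 / xK) 0 := isCoord_line.swap.val_curve
  have := h0.not_inv_mem one_div_xK_ne_zero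
  rw [one_div, inv_inv] at this
  exact this (h hx)

theorem not_le_lineAtInfinity_of_val (hR : IsLocalSub R) (h : Val R (chain z 0) c) (hc : c ≠ 0) :
    ¬ R ≤ lineAtInfinity := fun hle =>
  hc (val_eq_of_le hR hle h (val_chain_lineAtInfinity z))

/-! ### Values at the remaining points -/

theorem isLocalSub_firstCorner : IsLocalSub firstCorner := isCoord_second.isLocalSub_pointAt _ _

theorem val_inv_firstCorner (z : ℕ → ℂ) : Val firstCorner (chain z 0)⁻¹ 0 := by
  have := isCoord_second.val_right 0 0
  rwa [chain, inv_div]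

theorem chain_notMem_firstCorner (z : ℕ → ℂ) : chain z 0 ∉ firstCorner :=
  (val_inv_firstCorner z).inv_notMem (chain_ne_zero z 0)

theorem isLocalSub_lineCorner : IsLocalSub lineCorner := isCoord_origin.isLocalSub_pointAt _ _

theorem val_chain_lineCorner (z : ℕ → ℂ) : Val lineCorner (chain z 0) 0 :=
  isCoord_origin.val_right _ _

theorem x_mem_verticalPoint : xK ∈ verticalPoint := (isCoord_vertical.val_right 0 0).mem

theorem x_mem_pointAt_xy (a b : ℂ) : xK ∈ pointAt xK yK a b := (isCoord_xy.val_left a b).mem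

theorem y_mem_pointAt_xy (a b : ℂ) : yK ∈ pointAt xK yK a b := (isCoord_xy.val_right a b).mem

theorem x_mem_pointAt_first (hc : c ≠ 0) : xK ∈ pointAt (xK / yK) (1 / xK) 0 c := by
  have := ((isCoord_first.isLocalSub_pointAt 0 c).val_inv (isCoord_first.val_right 0 c) hc).mem
  simpa using this

theorem val_chain_line (z : ℕ → ℂ) (b : ℂ) :
    Val (pointAt (1 / xK) (yK / xK) 0 b) (chain z 0) 0 := by
  have := (isCoord_line.isLocalSub_pointAt 0 b).val_mul (isCoord_line.val_left 0 b)
    (isCoord_line.val_right 0 b)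
  have hx := xK_ne_zero
  rw [zero_mul] at this
  convert this using 1
  rw [chain_zero]
  field_simp

theorem ydivx_mem_line (b : ℂ) : yK / xK ∈ pointAt (1 / xK) (yK / xK) 0 b :=
  (isCoord_line.val_right 0 b).mem

end Values

/-! ### The surfaces reached by the blow-ups -/

/-- The points of the affine plane with coordinates `x, y`. -/
def affinePart : Set (Subalgebra ℂ K) := {R | ∃ a b : ℂ, R = pointAt xK yK a b}

/-- The points of the first exceptional curve. -/
def firstPart : Set (Subalgebra ℂ K) :=
  {R | ∃ c : ℂ, c ≠ 0 ∧ R = pointAt (xK / yK) (1 / xK) 0 c} ∪ {verticalPoint, firstCorner}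

/-- The points of the line at infinity after two blow-ups. -/
def linePart : Set (Subalgebra ℂ K) :=
  {R | ∃ b : ℂ, R = pointAt (1 / xK) (yK / xK) 0 b} ∪ {lineCorner}

/-- The points of the second exceptional curve with `y/x²` in `A`. -/
def secondPart (A : Set ℂ) : Set (Subalgebra ℂ K) :=
  {R | ∃ c ∈ A, R = pointAt (yK / xK ^ 2) (1 / xK) c 0}

/-- The points lying over `(z 0, 0)` after the first `k` blow-ups of a chain. -/
def tower (z : ℕ → ℂ) (k : ℕ) : Set (Subalgebra ℂ K) :=
  {R | (∃ n < k, R = chainCorner z n) ∨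
    (∃ n, 1 ≤ n ∧ n < k ∧ ∃ c, c ≠ z n ∧ R = chainPoint z n c) ∨ ∃ c, R = chainPoint z k c}

theorem isPointOver_chainPoint (z : ℕ → ℂ) (n : ℕ) (S : Subalgebra ℂ K) :
    IsPointOver (chainPoint z n (z n)) S ↔
      (∃ c, S = chainPoint z (n + 1) c) ∨ S = chainCorner z n := by
  have hc := isCoord_chain z n
  rw [chainPoint, pointAt_swap hc, isPointOver_pointAt hc.swap]
  simp only [map_zero, sub_zero]
  have : ∀ c, pointAt (1 / xK) ((chain z n - algebraMap ℂ K (z n)) / (1 / xK)) 0 c =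
      chainPoint z (n + 1) c := fun c => pointAt_swap (isCoord_chain z (n + 1)).swap 0 c
  simp only [this]
  rfl

/-- The overlaps of the three affine planes are removed, so that the first centre `[0 : 0 : 1]`
stands alone. -/
theorem projPlane_eq : projPlane = affinePart ∪ {R | ∃ b : ℂ, R = pointAt (1 / xK) (yK / xK) 0 b} ∪
    {pointAt (xK / yK) (1 / yK) 0 0} := by
  have hx := xK_ne_zero
  have hy := yK_ne_zero
  ext R
  constructor
  · rintro ((⟨a, b, rfl⟩ | ⟨a, b, rfl⟩) | ⟨a, b, rfl⟩)
    · exact Or.inl (Or.inl ⟨a, b, rfl⟩)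
    · by_cases ha : a = 0
      · subst ha
        exact Or.inl (Or.inr ⟨b, rfl⟩)
      · refine Or.inl (Or.inl ⟨1 / a, b / a, ?_⟩)
        have h1 := isCoord_line.isLocalSub_pointAt a b
        have h2 := isCoord_xy.isLocalSub_pointAt (1 / a) (b / a)
        refine pointAt_eq isCoord_line isCoord_xy ?_ ?_ ?_ ?_
        · simpa using h2.val_inv (isCoord_xy.val_left _ _) (one_div_ne_zero ha)
        · have := h2.val_div (isCoord_xy.val_right _ _) (isCoord_xy.val_left _ _)
            (one_div_ne_zero ha)
          convert this using 1
          field_simp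
        · simpa using h1.val_inv (isCoord_line.val_left _ _) ha
        · have := h1.val_div (isCoord_line.val_right _ _) (isCoord_line.val_left _ _) ha
          convert this using 1
          field_simp
    · by_cases hb : b = 0
      · subst hb
        by_cases ha : a = 0
        · subst ha
          exact Or.inr rfl
        · refine Or.inl (Or.inr ⟨1 / a, ?_⟩)
          have h1 := isCoord_infinity.isLocalSub_pointAt a 0
          have h2 := isCoord_line.isLocalSub_pointAt 0 (1 / a)
          refine pointAt_eq isCoord_infinity isCoord_line ?_ ?_ ?_ ?_
          · simpa using h2.val_inv (isCoord_line.val_right _ _) (one_div_ne_zero ha)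
          · have := h2.val_div (isCoord_line.val_left _ _) (isCoord_line.val_right _ _)
              (one_div_ne_zero ha)
            convert this using 1
            · field_simp
            · simp
          · have := h1.val_div (isCoord_infinity.val_right _ _) (isCoord_infinity.val_left _ _) ha
            convert this using 1
            · field_simp
            · simp
          · simpa using h1.val_inv (isCoord_infinity.val_left _ _) ha
      · refine Or.inl (Or.inl ⟨a / b, 1 / b, ?_⟩)
        have h1 := isCoord_infinity.isLocalSub_pointAt a b
        have h2 := isCoord_xy.isLocalSub_pointAt (a / b) (1 / b)
        refine pointAt_eq isCoord_infinity isCoord_xy ?_ ?_ ?_ ?_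
        · have := h2.val_div (isCoord_xy.val_left _ _) (isCoord_xy.val_right _ _)
            (one_div_ne_zero hb)
          convert this using 1
          field_simp
        · simpa using h2.val_inv (isCoord_xy.val_right _ _) (one_div_ne_zero hb)
        · have := h1.val_div (isCoord_infinity.val_left _ _) (isCoord_infinity.val_right _ _) hb
          convert this using 1
          field_simp
        · simpa using h1.val_inv (isCoord_infinity.val_right _ _) hb
  · rintro ((⟨a, b, rfl⟩ | ⟨b, rfl⟩) | rfl)
    · exact Or.inl (Or.inl ⟨a, b, rfl⟩)
    · exact Or.inl (Or.inr ⟨0, b, rfl⟩)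
    · exact Or.inr ⟨0, 0, rfl⟩

variable (c : CenterData ℂ)

theorem stage_zero : stage c 0 =
    affinePart ∪ {R | ∃ b : ℂ, R = pointAt (1 / xK) (yK / xK) 0 b} ∪
      {pointAt (xK / yK) (1 / yK) 0 0} :=
  projPlane_eq

/-- The old points differ from the centre because `y`, respectively `y/x`, is regular at them but
has a pole at the centre. -/
theorem stage_one : stage c 1 =
    affinePart ∪ {R | ∃ b : ℂ, R = pointAt (1 / xK) (yK / xK) 0 b} ∪
      {R | ∃ b : ℂ, R = pointAt (xK / yK) (1 / xK) 0 b} ∪ {verticalPoint} := by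
  have hx := xK_ne_zero
  have hy := yK_ne_zero
  have hy0 : yK ∉ pointAt (xK / yK) (1 / yK) 0 0 :=
    Val.inv_notMem (by simpa using isCoord_infinity.val_right 0 0) hy
  have hyx0 : yK / xK ∉ pointAt (xK / yK) (1 / yK) 0 0 :=
    Val.inv_notMem (by simpa using isCoord_infinity.val_left 0 0) (div_ne_zero hy hx)
  have hover : ∀ S, IsPointOver (pointAt (xK / yK) (1 / yK) 0 0) S ↔
      (∃ b : ℂ, S = pointAt (xK / yK) (1 / xK) 0 b) ∨ S = verticalPoint := by
    intro S
    rw [isPointOver_pointAt_zero isCoord_infinity]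
    have e1 : 1 / yK / (xK / yK) = 1 / xK := by field_simp
    have e2 : xK / yK / (1 / yK) = xK := by field_simp
    rw [e1, e2]; rfl
  have hst : stage c 1 = blowUp (stage c 0) (pointAt (xK / yK) (1 / yK) 0 0) := rfl
  rw [hst, stage_zero]
  ext S
  simp only [blowUp, Set.mem_union, Set.mem_sdiff, Set.mem_singleton_iff, Set.mem_ofPred_eq, hover]
  constructor
  · rintro (⟨(h | h) | h, h'⟩ | h | h)
    · exact Or.inl (Or.inl (Or.inl h))
    · exact Or.inl (Or.inl (Or.inr h))
    · exact absurd h h'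
    · exact Or.inl (Or.inr h)
    · exact Or.inr h
  · rintro (((h | h) | h) | h)
    · refine Or.inl ⟨Or.inl (Or.inl h), ?_⟩
      obtain ⟨a, b, rfl⟩ := h
      exact fun h => hy0 (h ▸ y_mem_pointAt_xy a b)
    · refine Or.inl ⟨Or.inl (Or.inr h), ?_⟩
      obtain ⟨b, rfl⟩ := h
      exact fun h => hyx0 (h ▸ ydivx_mem_line b)
    · exact Or.inr (Or.inl h)
    · exact Or.inr (Or.inr h)

theorem pointAt_second_eq {b : ℂ} (hb : b ≠ 0) :
    pointAt (1 / xK) (xK ^ 2 / yK) 0 b = pointAt (yK / xK ^ 2) (1 / xK) b⁻¹ 0 := by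
  have hc : IsCoord (yK / xK ^ 2) (1 / xK) := isCoord_chain 0 0
  have h1 := isCoord_second.isLocalSub_pointAt 0 b
  have h2 := hc.isLocalSub_pointAt b⁻¹ 0
  refine pointAt_eq isCoord_second hc (hc.val_right _ _) ?_ ?_ (isCoord_second.val_left _ _)
  · simpa using h2.val_inv (hc.val_left _ _) (inv_ne_zero hb)
  · simpa using h1.val_inv (isCoord_second.val_right _ _) hb

/-- The new curve has the coordinate `x²/y`. Its zero is the corner with the first exceptional
curve, its pole the corner with the line at infinity, and the other points have finite nonzero
`y/x²`. -/
theorem stage_two : stage c 2 = affinePart ∪ firstPart ∪ linePart ∪ secondPart {0}ᶜ := by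
  have hx := xK_ne_zero
  have hy := yK_ne_zero
  have hx0 : xK ∉ pointAt (xK / yK) (1 / xK) 0 0 :=
    Val.inv_notMem (by simpa using isCoord_first.val_right 0 0) hx
  have hyx0 : yK / xK ∉ pointAt (xK / yK) (1 / xK) 0 0 :=
    Val.inv_notMem (by simpa using isCoord_first.val_left 0 0) (div_ne_zero hy hx)
  have hover : ∀ S, IsPointOver (pointAt (xK / yK) (1 / xK) 0 0) S ↔
      S ∈ secondPart {0}ᶜ ∨ S = firstCorner ∨ S = lineCorner := by
    intro S
    rw [pointAt_swap isCoord_first, isPointOver_pointAt_zero isCoord_first.swap]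
    have e1 : xK / yK / (1 / xK) = xK ^ 2 / yK := by field_simp
    have e2 : 1 / xK / (xK / yK) = yK / xK ^ 2 := by field_simp
    rw [e1, e2]
    constructor
    · rintro (⟨b, rfl⟩ | h)
      · by_cases hb : b = 0
        · subst hb; exact Or.inr (Or.inl rfl)
        · exact Or.inl ⟨b⁻¹, by simpa using hb, pointAt_second_eq hb⟩
      · exact Or.inr (Or.inr h)
    · rintro (⟨b, hb, rfl⟩ | rfl | rfl)
      · refine Or.inl ⟨b⁻¹, ?_⟩
        rw [pointAt_second_eq (inv_ne_zero hb), inv_inv]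
      · exact Or.inl ⟨0, rfl⟩
      · exact Or.inr rfl
  have hst : stage c 2 = blowUp (stage c 1) (pointAt (xK / yK) (1 / xK) 0 0) := rfl
  rw [hst, stage_one]
  ext S
  simp only [blowUp, Set.mem_union, Set.mem_sdiff, Set.mem_singleton_iff, Set.mem_ofPred_eq, hover,
    firstPart, linePart, Set.mem_insert_iff]
  constructor
  · rintro (⟨((h | h) | ⟨b, rfl⟩) | h, h'⟩ | h | h | h)
    · exact Or.inl (Or.inl (Or.inl h))
    · exact Or.inl (Or.inr (Or.inl h))
    · have hb : b ≠ 0 := by rintro rfl; exact h' rfl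
      exact Or.inl (Or.inl (Or.inr (Or.inl ⟨b, hb, rfl⟩)))
    · exact Or.inl (Or.inl (Or.inr (Or.inr (Or.inl h))))
    · exact Or.inr h
    · exact Or.inl (Or.inl (Or.inr (Or.inr (Or.inr h))))
    · exact Or.inl (Or.inr (Or.inr h))
  · rintro (((h | ⟨b, hb, rfl⟩ | rfl | h) | (h | h)) | h)
    · refine Or.inl ⟨Or.inl (Or.inl (Or.inl h)), ?_⟩
      obtain ⟨a, b, rfl⟩ := h
      exact fun h => hx0 (h ▸ x_mem_pointAt_xy a b)
    · exact Or.inl ⟨Or.inl (Or.inr ⟨b, rfl⟩), fun h => hx0 (h ▸ x_mem_pointAt_first hb)⟩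
    · exact Or.inl ⟨Or.inr rfl, fun h => hx0 (h ▸ x_mem_verticalPoint)⟩
    · exact Or.inr (Or.inr (Or.inl h))
    · refine Or.inl ⟨Or.inl (Or.inl (Or.inr h)), ?_⟩
      obtain ⟨b, rfl⟩ := h
      exact fun h => hyx0 (h ▸ ydivx_mem_line b)
    · exact Or.inr (Or.inr (Or.inr h))
    · exact Or.inr (Or.inl h)

section Chain

variable {z : ℕ → ℂ} {N : Set (Subalgebra ℂ K)}

theorem chainPoint_notMem (hN : ∀ R ∈ N, Val R (1 / xK) 0 → ¬ Val R (chain z 0) (z 0)) (n : ℕ) :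
    chainPoint z n (z n) ∉ N := fun h => by
  refine hN _ h (val_s_chainPoint z n _) ?_
  rcases Nat.eq_zero_or_pos n with rfl | hn
  · exact val_chainPoint z 0 _
  · exact val_zero_chainPoint hn

theorem blowUp_secondPart (hN : ∀ R ∈ N, Val R (1 / xK) 0 → ¬ Val R (chain z 0) (z 0))
    (A : Set ℂ) : blowUp (N ∪ secondPart A) (chainPoint z 0 (z 0)) =
      N ∪ secondPart (A \ {z 0}) ∪ tower z 1 := by
  have h0 := chainPoint_notMem hN 0
  ext S
  simp only [blowUp, Set.mem_union, Set.mem_sdiff, Set.mem_singleton_iff, Set.mem_ofPred_eq,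
    isPointOver_chainPoint, tower]
  constructor
  · rintro (⟨h | ⟨d, hd, rfl⟩, h'⟩ | h | h)
    · exact Or.inl (Or.inl h)
    · exact Or.inl (Or.inr ⟨d, ⟨hd, by rintro rfl; exact h' rfl⟩, rfl⟩)
    · exact Or.inr (Or.inr (Or.inr h))
    · exact Or.inr (Or.inl ⟨0, one_pos, h⟩)
  · rintro ((h | ⟨d, hd, rfl⟩) | ⟨n, hn, rfl⟩ | ⟨n, hn, hn', _⟩ | h)
    · exact Or.inl ⟨Or.inl h, by rintro rfl; exact h0 h⟩
    · exact Or.inl ⟨Or.inr ⟨d, hd.1, rfl⟩, fun h => hd.2 (chainPoint_injective (z := z) (n := 0) h)⟩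
    · obtain rfl : n = 0 := by omega
      exact Or.inr (Or.inr rfl)
    · omega
    · exact Or.inr (Or.inl h)

/-- The centre takes the values excluded in `N`, so `N` is untouched. On the top level of the tower
the centre is replaced by a corner and the points of the next level. -/
theorem blowUp_tower (hN : ∀ R ∈ N, Val R (1 / xK) 0 → ¬ Val R (chain z 0) (z 0)) {k : ℕ}
    (hk : 1 ≤ k) : blowUp (N ∪ tower z k) (chainPoint z k (z k)) = N ∪ tower z (k + 1) := by
  have h0 := chainPoint_notMem hN k
  ext S
  simp only [blowUp, Set.mem_union, Set.mem_sdiff, Set.mem_singleton_iff, Set.mem_ofPred_eq,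
    isPointOver_chainPoint, tower]
  constructor
  · rintro (⟨h | ⟨n, hn, rfl⟩ | ⟨n, hn, hn', d, hd, rfl⟩ | ⟨d, rfl⟩, h'⟩ | h | h)
    · exact Or.inl h
    · exact Or.inr (Or.inl ⟨n, by omega, rfl⟩)
    · exact Or.inr (Or.inr (Or.inl ⟨n, hn, by omega, d, hd, rfl⟩))
    · exact Or.inr (Or.inr (Or.inl ⟨k, hk, by omega, d, by rintro rfl; exact h' rfl, rfl⟩))
    · exact Or.inr (Or.inr (Or.inr h))
    · exact Or.inr (Or.inl ⟨k, by omega, h⟩)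
  · rintro (h | ⟨n, hn, rfl⟩ | ⟨n, hn, hn', d, hd, rfl⟩ | h)
    · exact Or.inl ⟨Or.inl h, by rintro rfl; exact h0 h⟩
    · rcases Nat.lt_succ_iff_lt_or_eq.1 hn with hn | rfl
      · refine Or.inl ⟨Or.inr (Or.inl ⟨n, hn, rfl⟩), fun h => ?_⟩
        refine (val_inv_chainCorner z n).inv_notMem (chain_ne_zero z _) ?_
        rw [h]
        rcases Nat.lt_or_ge (n + 1) k with h1 | h1
        · exact (val_chain_of_mem (val_s_chainPoint z k _) (val_chainPoint z k _).mem h1).mem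
        · obtain rfl : k = n + 1 := by omega
          exact (val_chainPoint z _ _).mem
      · exact Or.inr (Or.inr rfl)
    · rcases Nat.lt_succ_iff_lt_or_eq.1 hn' with hn' | rfl
      · refine Or.inl ⟨Or.inr (Or.inr (Or.inl ⟨n, hn, hn', d, hd, rfl⟩)), fun h => ?_⟩
        have := val_chain_of_mem (val_s_chainPoint z k (z k)) (val_chainPoint z k _).mem hn'
        rw [← h] at this
        exact hd ((isLocalSub_chainPoint z n d).val_unique (val_chainPoint z n d) this)
      · exact Or.inl ⟨Or.inr (Or.inr (Or.inr ⟨d, rfl⟩)), fun h => hd (chainPoint_injective h)⟩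
    · exact Or.inr (Or.inl h)

/-- Wherever `1/x` vanishes on these pieces, `y/x²` is either `0` (on the line) or has a pole (at
the first corner). -/
theorem val_of_mem_base {R : Subalgebra ℂ K} (h : R ∈ affinePart ∪ firstPart ∪ linePart)
    (hs : Val R (1 / xK) 0) {d : ℂ} (hd : d ≠ 0) : ¬ Val R (chain z 0) d := by
  intro hv
  have hx : xK ∉ R := by
    have := hs.not_inv_mem one_div_xK_ne_zero
    rwa [one_div, inv_inv] at this
  rcases h with (⟨a, b, rfl⟩ | ⟨b, hb, rfl⟩ | rfl | rfl) | ⟨b, rfl⟩ | rfl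
  · exact hx (x_mem_pointAt_xy a b)
  · exact hx (x_mem_pointAt_first hb)
  · exact hx x_mem_verticalPoint
  · exact chain_notMem_firstCorner z hv.mem
  · exact hd ((isCoord_line.isLocalSub_pointAt 0 b).val_unique hv (val_chain_line z b))
  · exact hd (isLocalSub_lineCorner.val_unique hv (val_chain_lineCorner z))

theorem val_of_mem_secondPart {R : Subalgebra ℂ K} {A : Set ℂ} (h : R ∈ secondPart A) {d : ℂ}
    (hd : d ∉ A) : ¬ Val R (chain z 0) d := by
  obtain ⟨b, hb, rfl⟩ := h
  intro hv
  exact hd ((isLocalSub_chainPoint z 0 b).val_unique hv (val_chainPoint z 0 b) ▸ hb)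

theorem val_of_mem_tower {R : Subalgebra ℂ K} {k : ℕ} (hk : 1 ≤ k) (h : R ∈ tower z k) :
    IsLocalSub R ∧ Val R (chain z 0) (z 0) := by
  rcases h with ⟨n, _, rfl⟩ | ⟨n, hn, _, d, _, rfl⟩ | ⟨d, rfl⟩
  · exact ⟨isLocalSub_chainCorner z n, val_zero_chainCorner⟩
  · exact ⟨isLocalSub_chainPoint z n d, val_zero_chainPoint hn⟩
  · exact ⟨isLocalSub_chainPoint z k d, val_zero_chainPoint hk⟩

end Chain

/-- The points of the surface that do not lie over the base points of the two chains. -/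
def basePart : Set (Subalgebra ℂ K) :=
  affinePart ∪ firstPart ∪ linePart ∪ secondPart (({0}ᶜ \ {1 / 2}) \ {-1})

theorem stage_chainA (k : ℕ) (hk : k < 6) : stage c (2 + (k + 1)) =
    affinePart ∪ firstPart ∪ linePart ∪ secondPart ({0}ᶜ \ {1 / 2}) ∪ tower (zA c) (k + 1) := by
  have hz : zA c 0 = 1 / 2 := rfl
  induction k with
  | zero =>
    have hst : stage c 3 = blowUp (stage c 2) (chainPoint (zA c) 0 (zA c 0)) := rfl
    rw [show 2 + (0 + 1) = 3 from rfl, hst, stage_two, blowUp_secondPart, hz]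
    intro R hR hs
    exact val_of_mem_base hR hs (by rw [hz]; norm_num)
  | succ k ih =>
    have hst : stage c (2 + (k + 1 + 1)) =
        blowUp (stage c (2 + (k + 1))) (chainPoint (zA c) (k + 1) (zA c (k + 1))) := by
      have : k < 5 := by omega
      interval_cases k <;> rfl
    rw [hst, ih (by omega), blowUp_tower _ (by omega)]
    rintro R (hR | hR) hs
    · exact val_of_mem_base hR hs (by rw [hz]; norm_num)
    · exact val_of_mem_secondPart hR (by rw [hz]; simp)

theorem stage_chainB (k : ℕ) (hk : k < 3) : stage c (8 + (k + 1)) =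
    basePart ∪ tower (zA c) 6 ∪ tower (zB c) (k + 1) := by
  have hz : zB c 0 = -1 := rfl
  have hzA : zA c 0 = 1 / 2 := rfl
  have htow : ∀ R ∈ tower (zA c) 6, ¬ Val R (chain (zB c) 0) (-1) := fun R hR hv => by
    obtain ⟨h1, h2⟩ := val_of_mem_tower (by norm_num) hR
    have := h1.val_unique h2 hv
    rw [hzA] at this
    norm_num at this
  induction k with
  | zero =>
    have hst : stage c 9 = blowUp (stage c (2 + (5 + 1))) (chainPoint (zB c) 0 (zB c 0)) := rfl
    rw [show 8 + (0 + 1) = 9 from rfl, hst, stage_chainA c 5 (by norm_num), Set.union_right_comm,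
      blowUp_secondPart, hz, Set.union_right_comm (affinePart ∪ firstPart ∪ linePart)]
    · rfl
    rintro R (hR | hR) hs
    · exact val_of_mem_base hR hs (by rw [hz]; norm_num)
    · exact htow R hR
  | succ k ih =>
    have hst : stage c (8 + (k + 1 + 1)) =
        blowUp (stage c (8 + (k + 1))) (chainPoint (zB c) (k + 1) (zB c (k + 1))) := by
      have : k < 2 := by omega
      interval_cases k <;> rfl
    rw [hst, ih (by omega), blowUp_tower _ (by omega)]
    rintro R ((hR | hR) | hR) hs
    · exact val_of_mem_base hR hs (by rw [hz]; norm_num)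
    · exact val_of_mem_secondPart hR (by rw [hz]; simp)
    · exact htow R hR

theorem stage_final : stage c 11 = basePart ∪ tower (zA c) 6 ∪ tower (zB c) 3 :=
  stage_chainB c 2 (by norm_num)

theorem center_mem_stage (i : Fin 11) : center c i ∈ stage c i := by
  have hA : ∀ k (hk : k < 6), center c ⟨k + 2, by omega⟩ = chainPoint (zA c) k (zA c k) := by
    intro k hk
    interval_cases k <;> rfl
  have hB : ∀ k (hk : k < 3), center c ⟨k + 8, by omega⟩ = chainPoint (zB c) k (zB c k) := by
    intro k hk
    interval_cases k <;> rfl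
  obtain ⟨i, hi⟩ := i
  rcases Nat.lt_or_ge i 8 with h8 | h8
  · rcases Nat.lt_or_ge i 2 with h2 | h2
    · interval_cases i
      · rw [stage_zero]; exact Or.inr rfl
      · rw [stage_one]; exact Or.inl (Or.inr ⟨0, rfl⟩)
    · obtain ⟨k, rfl⟩ : ∃ k, i = k + 2 := ⟨i - 2, by omega⟩
      rw [hA k (by omega)]
      rcases k with _ | k
      · change _ ∈ stage c 2
        rw [stage_two]
        refine Or.inr ⟨1 / 2, by simp, rfl⟩
      · change _ ∈ stage c (k + 1 + 2)
        rw [add_comm, stage_chainA c k (by omega)]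
        exact Or.inr (Or.inr (Or.inr ⟨_, rfl⟩))
  · obtain ⟨k, rfl⟩ : ∃ k, i = k + 8 := ⟨i - 8, by omega⟩
    rw [hB k (by omega)]
    rcases k with _ | k
    · change _ ∈ stage c (2 + (5 + 1))
      rw [stage_chainA c 5 (by omega)]
      refine Or.inl (Or.inr ⟨-1, ?_, rfl⟩)
      simp only [Set.mem_sdiff, Set.mem_compl_iff, Set.mem_singleton_iff]
      norm_num
    · change _ ∈ stage c (k + 1 + 8)
      rw [add_comm, stage_chainB c k (by omega)]
      exact Or.inr (Or.inr (Or.inr ⟨_, rfl⟩))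

theorem exceptional_excCurve (i : Fin 11) : IsExceptionalCurve (center c i) (excCurve c i) := by
  have hx := xK_ne_zero
  have hy := yK_ne_zero
  have hch : ∀ z k, IsExceptionalCurve (chainPoint z k (z k)) (chainCurve z (k + 1)) := by
    intro z k
    have hc := isCoord_chain z k
    have := isExceptionalCurve_pointAt hc.swap 0 (z k)
    rw [map_zero, sub_zero, ← pointAt_swap hc] at this
    exact this
  fin_cases i
  · have := isExceptionalCurve_pointAt_zero isCoord_infinity
    rwa [show 1 / yK / (xK / yK) = 1 / xK by field_simp] at this
  · have := isExceptionalCurve_pointAt_zero isCoord_first.swap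
    rw [← pointAt_swap isCoord_first, show xK / yK / (1 / xK) = (yK / xK ^ 2)⁻¹ by field_simp,
      ← chain_zero 0, curveAt_inv (isCoord_chain 0 0)] at this
    exact this
  · exact hch (zA c) 0
  · exact hch (zA c) 1
  · exact hch (zA c) 2
  · exact hch (zA c) 3
  · exact hch (zA c) 4
  · exact hch (zA c) 5
  · exact hch (zB c) 0
  · exact hch (zB c) 1
  · exact hch (zB c) 2

end InceX

end

/-! ### Incidence, intersection numbers and the contraction of the line. -/

noncomputable section

namespace InceX

open MvPolynomial

/-! ### Local coordinates adapted to a curve -/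

/-- `f, g` are local coordinates at the point `R` of the curve `V`, with local equation `f`. -/
def IsAdapted (R V : Subalgebra ℂ K) (f g : K) : Prop :=
  R ≤ V ∧ IsParameters R f g ∧ IsLocalEquation R V f

section Adapted

variable {R V W : Subalgebra ℂ K} {M : Set (Subalgebra ℂ K)} {u v f g h : K}

theorem isAdapted_coord (hc : IsCoord u v) (a : ℂ) :
    IsAdapted (pointAt u v a 0) (curveAt u v) v (u - algebraMap ℂ K a) := by
  refine ⟨pointAt_le_curveAt u v a, ?_, isLocalEquation_coord hc a⟩
  simpa using (hc.isParameters a 0).swap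

theorem isAdapted_coord_zero (hc : IsCoord u v) :
    IsAdapted (pointAt u v 0 0) (curveAt u v) v u := by
  simpa using isAdapted_coord hc 0

theorem IsAdapted.hasOrder (hA : IsAdapted R V f g) (k : ℤ) : HasOrderAlong R V (g ^ k) k :=
  ⟨f, g, 1, hA.2.1, hA.2.2, isUnitOf_one, by simp [zero_mem_nonunitSet]⟩

theorem hasIntersectionNumber_of_finset (hh : h ≠ 0) (T : Finset (Subalgebra ℂ K)) (k : ℤ)
    (hT : ∀ R ∈ T, R ∈ M ∧ R ≤ V ∧ ∃ w, IsLocalEquation R W w ∧ HasOrderAlong R V (w / h) k)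
    (h0 : ∀ R ∈ M, R ≤ V → R ∉ T → ∃ w, IsLocalEquation R W w ∧ HasOrderAlong R V (w / h) 0) :
    HasIntersectionNumber M V W (T.card * k) := by
  classical
  refine ⟨h, hh, Finsupp.onFinset T (fun R => if R ∈ T then k else 0) (by simp_all), ?_, ?_, ?_⟩
  · intro R hR
    have := hT R (Finsupp.support_onFinset_subset hR)
    exact ⟨this.1, this.2.1⟩
  · intro R hR hRV
    by_cases hRT : R ∈ T
    · simpa [hRT] using (hT R hRT).2.2
    · simpa [hRT] using h0 R hR hRV hRT
  · rw [Finsupp.onFinset_sum _ (fun _ => rfl), Finset.sum_congr rfl (fun R hR => if_pos hR)]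
    simp

/-- The function `h` is a local equation of `V` itself away from `T`, while at a point of `T` the
quotient `f / h` restricts to a simple pole on `V`. The normal bundle therefore has degree minus the
number of these points. -/
theorem smooth_and_self (hc : IsCoord u v) (hV : V = curveAt u v) (hh : h ≠ 0)
    (T : Finset (Subalgebra ℂ K)) (hT0 : T.Nonempty)
    (hT : ∀ R ∈ T, R ∈ M ∧ ∃ f g, IsAdapted R V f g ∧ f / h = g⁻¹)
    (h0 : ∀ R ∈ M, R ≤ V → R ∉ T → ∃ f g, IsAdapted R V f g ∧ f / h = 1) :
    IsSmoothRationalCurve M V ∧ HasIntersectionNumber M V V (-T.card) := by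
  refine ⟨⟨?_, ?_, ?_⟩, ?_⟩
  · obtain ⟨R, hR⟩ := hT0
    obtain ⟨hM, f, g, hA, _⟩ := hT R hR
    exact ⟨R, hM, hA.1⟩
  · intro R hR hRV
    by_cases hRT : R ∈ T
    · obtain ⟨_, f, g, hA, _⟩ := hT R hRT
      exact ⟨f, g, hA.2⟩
    · obtain ⟨f, g, hA, _⟩ := h0 R hR hRV hRT
      exact ⟨f, g, hA.2⟩
  · rw [hV]; exact hc.curve_residue
  · have := hasIntersectionNumber_of_finset (M := M) (V := V) (W := V) hh T (-1) ?_ ?_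
    · simpa using this
    · intro R hR
      obtain ⟨hM, f, g, hA, e⟩ := hT R hR
      refine ⟨hM, hA.1, f, hA.2.2, ?_⟩
      rw [e, ← zpow_neg_one]
      exact hA.hasOrder _
    · intro R hR hRV hRT
      obtain ⟨f, g, hA, e⟩ := h0 R hR hRV hRT
      refine ⟨f, hA.2.2, ?_⟩
      rw [e, ← zpow_zero g]
      exact hA.hasOrder _

theorem hasIntersectionNumber_zero (hV : IsSmoothRationalCurve M V)
    (hd : ∀ R ∈ M, R ≤ V → ¬ R ≤ W) : HasIntersectionNumber M V W 0 := by
  have := hasIntersectionNumber_of_finset (M := M) (V := V) (W := W) one_ne_zero ∅ 0 (by simp) ?_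
  · simpa using this
  · intro R hR hRV _
    obtain ⟨f, g, hp, hf⟩ := hV.2.1 R hR hRV
    refine ⟨1, Or.inr ⟨hd R hR hRV, isUnitOf_one⟩, ?_⟩
    rw [div_one, ← zpow_zero g]
    exact IsAdapted.hasOrder ⟨hRV, hp, hf⟩ 0

/-- The two local equations form a system of parameters, so the curves cross transversally: the
equation of `W` restricts to a uniformizer of `V`. No moving is needed for different curves, hence
`h = 1`. -/
theorem hasIntersectionNumber_one (hV : IsSmoothRationalCurve M V) (hR : R ∈ M)
    (hRV : IsAdapted R V f g) (hRW : IsAdapted R W g f)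
    (hd : ∀ R' ∈ M, R' ≤ V → R' ≠ R → ¬ R' ≤ W) : HasIntersectionNumber M V W 1 := by
  have := hasIntersectionNumber_of_finset (M := M) (V := V) (W := W) one_ne_zero {R} 1 ?_ ?_
  · simpa using this
  · intro R' hR'
    obtain rfl := Finset.mem_singleton.1 hR'
    refine ⟨hR, hRV.1, g, hRW.2.2, ?_⟩
    simpa using hRV.hasOrder 1
  · intro R' hR' hRV' hne
    obtain ⟨f', g', hp, hf⟩ := hV.2.1 R' hR' hRV'
    refine ⟨1, Or.inr ⟨hd R' hR' hRV' (by simpa using hne), isUnitOf_one⟩, ?_⟩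
    rw [div_one, ← zpow_zero g']
    exact IsAdapted.hasOrder ⟨hRV', hp, hf⟩ 0

end Adapted

theorem isAdapted_chainPoint (z : ℕ → ℂ) (n : ℕ) (c : ℂ) :
    IsAdapted (chainPoint z n c) (chainCurve z n) (1 / xK) (chain z n - algebraMap ℂ K c) :=
  isAdapted_coord (isCoord_chain z n) c

theorem isAdapted_chainCorner (z : ℕ → ℂ) (n : ℕ) :
    IsAdapted (chainCorner z n) (chainCurve z n)
      (1 / xK / (chain z n - algebraMap ℂ K (z n))) (chain z n - algebraMap ℂ K (z n)) := by
  have := isAdapted_coord_zero (isCoord_corner z n)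
  rwa [curveAt_div ((isCoord_chain z n).sub_const (z n)), curveAt_sub_const (isCoord_chain z n)]
    at this

/-- The corner is the point at infinity of the next curve: the inverse of `chain z (n + 1)` is the
coordinate along that curve. -/
theorem isAdapted_chainCorner_succ (z : ℕ → ℂ) (n : ℕ) :
    IsAdapted (chainCorner z n) (chainCurve z (n + 1))
      (chain z n - algebraMap ℂ K (z n)) (1 / xK / (chain z n - algebraMap ℂ K (z n))) := by
  have hc := isCoord_corner z n
  have h := isAdapted_coord_zero hc.swap
  have hc' := (isCoord_chain z (n + 1)).inv_left
  have e1 : (chain z (n + 1))⁻¹ = 1 / xK / (chain z n - algebraMap ℂ K (z n)) := by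
    rw [chain, inv_div]
  have h1 := curveAt_div hc'
  rw [curveAt_inv (isCoord_chain z (n + 1)), e1] at h1
  have e2 : 1 / xK / (1 / xK / (chain z n - algebraMap ℂ K (z n))) =
      chain z n - algebraMap ℂ K (z n) := div_div_cancel₀ one_div_xK_ne_zero
  rw [e2] at h1
  rw [h1, ← pointAt_swap hc] at h
  exact h

theorem isAdapted_first (c : ℂ) : IsAdapted (pointAt (xK / yK) (1 / xK) 0 c) firstCurve (xK / yK)
    (1 / xK - algebraMap ℂ K c) := by
  rw [pointAt_swap isCoord_first]
  exact isAdapted_coord isCoord_first.swap c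

theorem isAdapted_verticalPoint : IsAdapted verticalPoint firstCurve (1 / yK) xK := by
  have h := isAdapted_coord_zero isCoord_vertical.swap
  have h1 := curveAt_inv isCoord_first.swap
  have hc : IsCoord xK (xK / yK) := by simpa using isCoord_first.swap.inv_left
  have h2 := curveAt_div hc
  have hx := xK_ne_zero
  rw [one_div, inv_inv] at h1
  rw [show xK / yK / xK = 1 / yK by field_simp, h1] at h2
  rw [h2, ← pointAt_swap isCoord_vertical] at h
  rw [firstCurve, one_div xK]
  exact h

theorem isAdapted_firstCorner : IsAdapted firstCorner firstCurve (xK ^ 2 / yK) (1 / xK) := by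
  have h := isAdapted_coord_zero isCoord_second
  have h2 := curveAt_div isCoord_first.swap
  have hx := xK_ne_zero
  rw [show xK / yK / (1 / xK) = xK ^ 2 / yK by field_simp] at h2
  rw [h2] at h
  exact h

theorem isAdapted_firstCorner_chain (z : ℕ → ℂ) :
    IsAdapted firstCorner (chainCurve z 0) (1 / xK) (xK ^ 2 / yK) := by
  have h := isAdapted_coord_zero isCoord_second.swap
  have h2 := curveAt_inv (isCoord_chain z 0)
  rw [chain_zero, inv_div] at h2
  rw [h2, ← pointAt_swap isCoord_second] at h
  exact h

theorem isAdapted_line (b : ℂ) : IsAdapted (pointAt (1 / xK) (yK / xK) 0 b) lineAtInfinity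
    (1 / xK) (yK / xK - algebraMap ℂ K b) := by
  rw [pointAt_swap isCoord_line]
  exact isAdapted_coord isCoord_line.swap b

theorem isAdapted_lineCorner : IsAdapted lineCorner lineAtInfinity (yK / xK ^ 2) (xK / yK) := by
  have h := isAdapted_coord_zero isCoord_origin
  have h1 := curveAt_inv isCoord_line.swap
  have h2 := curveAt_div isCoord_first
  have hx := xK_ne_zero
  rw [show 1 / xK / (xK / yK) = yK / xK ^ 2 by field_simp] at h2
  rw [inv_div] at h1
  rw [h2, h1] at h
  exact h

theorem isAdapted_lineCorner_chain (z : ℕ → ℂ) :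
    IsAdapted lineCorner (chainCurve z 0) (xK / yK) (yK / xK ^ 2) := by
  have h := isAdapted_coord_zero isCoord_origin.swap
  have h2 := curveAt_div (isCoord_chain z 0)
  have hx := xK_ne_zero
  have hy := yK_ne_zero
  rw [chain_zero, show 1 / xK / (yK / xK ^ 2) = xK / yK by field_simp] at h2
  rw [h2, ← pointAt_swap isCoord_origin] at h
  exact h

/-! ### The points on the curves -/

section Incidence

variable {R : Subalgebra ℂ K} {z z' : ℕ → ℂ} {n m k : ℕ} {A : Set ℂ} {d : ℂ}

theorem le_of_chainPoint_le (h : chainPoint z m d ≤ chainCurve z n) : m ≤ n := by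
  by_contra! hlt
  exact (generic_chainCurve z n).2 _
    (val_chain_of_mem (val_s_chainCurve z n) (h (val_chainPoint z m d).mem) hlt)

theorem affinePart_not_le_chainCurve (h : R ∈ affinePart) : ¬ R ≤ chainCurve z n := by
  obtain ⟨a, b, rfl⟩ := h
  exact not_le_chainCurve (x_mem_pointAt_xy a b)

theorem affinePart_not_le_firstCurve (h : R ∈ affinePart) : ¬ R ≤ firstCurve := by
  obtain ⟨a, b, rfl⟩ := h
  exact not_le_firstCurve_of_y (y_mem_pointAt_xy a b)

theorem affinePart_not_le_line (h : R ∈ affinePart) : ¬ R ≤ lineAtInfinity := by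
  obtain ⟨a, b, rfl⟩ := h
  exact not_le_lineAtInfinity_of_x (x_mem_pointAt_xy a b)

theorem firstPart_le_chainCurve (h : R ∈ firstPart) (hle : R ≤ chainCurve z n) :
    R = firstCorner ∧ n = 0 := by
  rcases h with ⟨b, hb, rfl⟩ | rfl | rfl
  · exact absurd hle (not_le_chainCurve (x_mem_pointAt_first hb))
  · exact absurd hle (not_le_chainCurve x_mem_verticalPoint)
  · refine ⟨rfl, ?_⟩
    by_contra hn
    exact not_le_of_val_inv isLocalSub_firstCorner (chain_ne_zero z 0) (val_inv_firstCorner z)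
      (val_zero_chainCurve (by omega)) hle

theorem firstPart_not_le_line (h : R ∈ firstPart) : ¬ R ≤ lineAtInfinity := by
  rcases h with ⟨b, hb, rfl⟩ | rfl | rfl
  · exact not_le_lineAtInfinity_of_x (x_mem_pointAt_first hb)
  · exact not_le_lineAtInfinity_of_x x_mem_verticalPoint
  · exact not_le_of_val_inv isLocalSub_firstCorner (chain_ne_zero 0 0) (val_inv_firstCorner 0)
      (val_chain_lineAtInfinity 0)

theorem secondPart_le_chainCurve (h : R ∈ secondPart A) (hz : z 0 ∉ A)
    (hle : R ≤ chainCurve z n) : n = 0 := by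
  obtain ⟨b, hb, rfl⟩ := h
  exact eq_of_chainPoint_le (m := 0) hle (by rintro rfl; exact hz hb)

theorem secondPart_not_le_firstCurve (h : R ∈ secondPart A) : ¬ R ≤ firstCurve := by
  obtain ⟨b, hb, rfl⟩ := h
  exact not_le_firstCurve_of_chain (z := 0) (val_chainPoint 0 0 b).mem

theorem secondPart_not_le_line (h : R ∈ secondPart A) (hA : (0 : ℂ) ∉ A) :
    ¬ R ≤ lineAtInfinity := by
  obtain ⟨b, hb, rfl⟩ := h
  exact not_le_lineAtInfinity_of_val (isLocalSub_chainPoint 0 0 b) (val_chainPoint 0 0 b)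
    (by rintro rfl; exact hA hb)

theorem linePart_le_line (h : R ∈ linePart) : R ≤ lineAtInfinity := by
  rcases h with ⟨b, rfl⟩ | rfl
  · exact (isAdapted_line b).1
  · exact isAdapted_lineCorner.1

/-- The function `y/x` is regular at the point, but it has a pole along the second exceptional
curve, being `y/x²` divided by `1/x`. -/
theorem line_not_le_second (b : ℂ) :
    ¬ pointAt (1 / xK) (yK / xK) 0 b ≤ chainCurve z 0 := by
  intro h
  have h1 := h (ydivx_mem_line b)
  have h2 : Val (chainCurve z 0) (yK / xK)⁻¹ 0 := by
    have := nonunitSet_mul ((isLocalSub_chainCurve z 0).generic_inv (generic_chainCurve z 0)).1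
      (val_zero.1 (val_s_chainCurve z 0))
    have hx := xK_ne_zero
    have hy := yK_ne_zero
    have e : (yK / xK)⁻¹ = (chain z 0)⁻¹ * (1 / xK) := by rw [chain_zero]; field_simp
    rw [val_zero, e]
    exact this
  exact h2.inv_notMem (div_ne_zero yK_ne_zero xK_ne_zero) h1

theorem tower_le_chainCurve (h : R ∈ tower z k) (hn : 1 ≤ n) (hk : n < k)
    (hle : R ≤ chainCurve z n) :
    R = chainCorner z n ∨ R = chainCorner z (n - 1) ∨ ∃ d, R = chainPoint z n d := by
  rcases h with ⟨m, _, rfl⟩ | ⟨m, hm, _, d, hd, rfl⟩ | ⟨d, rfl⟩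
  · rcases eq_of_chainCorner_le hle with rfl | rfl
    · exact Or.inl rfl
    · exact Or.inr (Or.inl rfl)
  · obtain rfl := eq_of_chainPoint_le hle hd
    exact Or.inr (Or.inr ⟨d, rfl⟩)
  · exact absurd (le_of_chainPoint_le hle) (by omega)

theorem tower_le_second (h : R ∈ tower z k) (hk : 1 ≤ k) (hle : R ≤ chainCurve z 0) :
    R = chainCorner z 0 := by
  rcases h with ⟨m, _, rfl⟩ | ⟨m, hm, _, d, hd, rfl⟩ | ⟨d, rfl⟩
  · rcases eq_of_chainCorner_le hle with rfl | h
    · rfl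
    · omega
  · exact absurd (le_of_chainPoint_le hle) (by omega)
  · exact absurd (le_of_chainPoint_le hle) (by omega)

theorem tower_not_le_chainCurve (hz : z 0 ≠ z' 0) (h : R ∈ tower z k) (hk : 1 ≤ k) (hn : 1 ≤ n) :
    ¬ R ≤ chainCurve z' n := fun hle =>
  hz (val_eq_of_le (val_of_mem_tower hk h).1 hle (val_of_mem_tower hk h).2
    (val_zero_chainCurve hn))

theorem tower_not_le_firstCurve (h : R ∈ tower z k) (hk : 1 ≤ k) : ¬ R ≤ firstCurve :=
  not_le_firstCurve_of_chain (val_of_mem_tower hk h).2.mem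

theorem tower_not_le_line (h : R ∈ tower z k) (hk : 1 ≤ k) (hz : z 0 ≠ 0) :
    ¬ R ≤ lineAtInfinity :=
  not_le_lineAtInfinity_of_val (val_of_mem_tower hk h).1 (val_of_mem_tower hk h).2 hz

theorem chainCorner_mem_tower (hn : n < k) : chainCorner z n ∈ tower z k := Or.inl ⟨n, hn, rfl⟩

theorem chainCorner_ne (z : ℕ → ℂ) {m n : ℕ} (h : m < n) : chainCorner z n ≠ chainCorner z m := by
  intro e
  have h1 := (isAdapted_chainCorner z m).1
  rw [← e] at h1
  rcases eq_of_chainCorner_le h1 with h2 | h2 <;> omega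

theorem chainCorner_ne_of_ne (hz : z 0 ≠ z' 0) : chainCorner z n ≠ chainCorner z' m := by
  intro e
  have h1 : Val (chainCorner z n) (chain z 0) (z' 0) := e ▸ val_zero_chainCorner
  exact hz ((isLocalSub_chainCorner z n).val_unique val_zero_chainCorner h1)

theorem lineCorner_ne_chainCorner (hz : z 0 ≠ 0) : lineCorner ≠ chainCorner z n := by
  intro e
  have h1 : Val lineCorner (chain z 0) (z 0) := e ▸ val_zero_chainCorner
  exact hz (isLocalSub_lineCorner.val_unique h1 (val_chain_lineCorner z))

end Incidence

/-! ### The surface -/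

variable (c : CenterData ℂ)

theorem zA_zero : zA c 0 = 1 / 2 := rfl

theorem zB_zero : zB c 0 = -1 := rfl

theorem zA_zero_ne : zA c 0 ≠ zB c 0 := by rw [zA_zero, zB_zero]; norm_num

theorem line_iff_of_mem_stage {R : Subalgebra ℂ K} (h : R ∈ stage c 11) :
    R ≤ lineAtInfinity ↔ R ∈ linePart := by
  refine ⟨fun hle => ?_, linePart_le_line⟩
  rw [stage_final] at h
  rcases h with ((((h | h) | h) | h) | h) | h
  · exact absurd hle (affinePart_not_le_line h)
  · exact absurd hle (firstPart_not_le_line h)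
  · exact h
  · exact absurd hle (secondPart_not_le_line h (by simp))
  · exact absurd hle (tower_not_le_line h (by norm_num) (by rw [zA_zero]; norm_num))
  · exact absurd hle (tower_not_le_line h (by norm_num) (by rw [zB_zero]; norm_num))

/-- The line contracts to the point `y/x² = 0` of the second curve, so that `0` is no longer an
excluded value. -/
theorem surface_eq : surface c = affinePart ∪ firstPart ∪ secondPart {1 / 2, -1}ᶜ ∪
    tower (zA c) 6 ∪ tower (zB c) 3 := by
  have hA : zA c 0 ≠ 0 := by rw [zA_zero]; norm_num
  have hB : zB c 0 ≠ 0 := by rw [zB_zero]; norm_num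
  ext R
  constructor
  · rintro (⟨h, hle⟩ | rfl)
    · rw [line_iff_of_mem_stage c h] at hle
      rw [stage_final] at h
      rcases h with ((((h | h) | h) | ⟨b, hb, rfl⟩) | h) | h
      · exact Or.inl (Or.inl (Or.inl (Or.inl h)))
      · exact Or.inl (Or.inl (Or.inl (Or.inr h)))
      · exact absurd h hle
      · refine Or.inl (Or.inl (Or.inr ⟨b, ?_, rfl⟩))
        rintro (h | h)
        · exact hb.1.2 h
        · exact hb.2 h
      · exact Or.inl (Or.inr h)
      · exact Or.inr h
    · refine Or.inl (Or.inl (Or.inr ⟨0, ?_, rfl⟩))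
      simp
  · have hst : ∀ S, S ∈ stage c 11 ↔ S ∈ basePart ∪ tower (zA c) 6 ∪ tower (zB c) 3 := fun S => by
      rw [stage_final]
    rintro ((((h | h) | ⟨b, hb, rfl⟩) | h) | h)
    · refine Or.inl ⟨(hst R).2 ?_, affinePart_not_le_line h⟩
      exact Or.inl (Or.inl (Or.inl (Or.inl (Or.inl h))))
    · refine Or.inl ⟨(hst R).2 ?_, firstPart_not_le_line h⟩
      exact Or.inl (Or.inl (Or.inl (Or.inl (Or.inr h))))
    · by_cases hb0 : b = 0
      · subst hb0; exact Or.inr rfl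
      · have hmem : pointAt (yK / xK ^ 2) (1 / xK) b 0 ∈
            secondPart (({0}ᶜ \ {1 / 2}) \ {-1}) :=
          ⟨b, ⟨⟨hb0, fun h => hb (Or.inl h)⟩, fun h => hb (Or.inr h)⟩, rfl⟩
        exact Or.inl ⟨(hst _).2 (Or.inl (Or.inl (Or.inr hmem))),
          secondPart_not_le_line hmem (by simp)⟩
    · exact Or.inl ⟨(hst R).2 (Or.inl (Or.inr h)), tower_not_le_line h (by norm_num) hA⟩
    · exact Or.inl ⟨(hst R).2 (Or.inr h), tower_not_le_line h (by norm_num) hB⟩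

/-- Both charts of this blow-up reproduce known coordinates: `(1/x, y/x)` gives the finite points of
the line at infinity, and `(y/x², x/y)` its remaining corner. -/
theorem isPointOver_contractedPoint (S : Subalgebra ℂ K) :
    IsPointOver contractedPoint S ↔ S ∈ linePart := by
  have hx := xK_ne_zero
  have hy := yK_ne_zero
  have hc : IsCoord (yK / xK ^ 2) (1 / xK) := isCoord_chain 0 0
  rw [contractedPoint, isPointOver_pointAt_zero hc]
  have e1 : 1 / xK / (yK / xK ^ 2) = xK / yK := by field_simp
  have e2 : yK / xK ^ 2 / (1 / xK) = yK / xK := by field_simp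
  rw [e1, e2]
  have key : ∀ b : ℂ, b ≠ 0 →
      pointAt (yK / xK ^ 2) (xK / yK) 0 b = pointAt (1 / xK) (yK / xK) 0 b⁻¹ := by
    intro b hb
    have hc' := isCoord_origin.swap
    have h1 := hc'.isLocalSub_pointAt 0 b
    have h2 := isCoord_line.isLocalSub_pointAt 0 b⁻¹
    refine pointAt_eq hc' isCoord_line (val_chain_line 0 b⁻¹) ?_ ?_ ?_
    · simpa using h2.val_inv (isCoord_line.val_right 0 b⁻¹) (inv_ne_zero hb)
    · have := h1.val_mul (hc'.val_left 0 b) (hc'.val_right 0 b)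
      rw [zero_mul] at this
      rwa [show yK / xK ^ 2 * (xK / yK) = 1 / xK by field_simp] at this
    · simpa using h1.val_inv (hc'.val_right 0 b) hb
  constructor
  · rintro (⟨b, rfl⟩ | rfl)
    · by_cases hb : b = 0
      · subst hb
        rw [pointAt_swap isCoord_origin.swap]
        exact Or.inr rfl
      · exact Or.inl ⟨b⁻¹, key b hb⟩
    · exact Or.inl ⟨0, rfl⟩
  · rintro (⟨b, rfl⟩ | rfl)
    · by_cases hb : b = 0
      · subst hb; exact Or.inr rfl
      · refine Or.inl ⟨b⁻¹, ?_⟩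
        rw [key _ (inv_ne_zero hb), inv_inv]
    · exact Or.inl ⟨0, pointAt_swap isCoord_origin 0 0⟩

theorem contractedPoint_le_line : contractedPoint ≤ lineAtInfinity :=
  pointAt_le (isCoord_chain 0 0) isLocalSub_lineAtInfinity (val_chain_lineAtInfinity 0)
    isCoord_line.swap.val_curve

theorem linePart_ne_contractedPoint {R : Subalgebra ℂ K} (h : R ∈ linePart) :
    R ≠ contractedPoint := by
  rintro rfl
  rcases h with ⟨b, hb⟩ | hb
  · refine line_not_le_second (z := 0) b ?_
    rw [← hb]
    exact (isAdapted_chainPoint 0 0 0).1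
  -- The closure of the `x`-axis, with the equation `y/x² = 0`, passes through the contracted point.
  -- Along it `x/y` has a pole, although `x/y` is regular at `lineCorner`.
  · have hc : IsCoord (1 / xK) (yK / xK ^ 2) := (isCoord_chain 0 0).swap
    have hx := xK_ne_zero
    have hy := yK_ne_zero
    have h1 : contractedPoint ≤ curveAt (1 / xK) (yK / xK ^ 2) := by
      rw [contractedPoint, pointAt_swap hc.swap]
      exact pointAt_le_curveAt _ _ _
    have h2 : Val (curveAt (1 / xK) (yK / xK ^ 2)) (xK / yK)⁻¹ 0 := by
      have := nonunitSet_mul (hc.isLocalSub_curveAt.generic_inv hc.generic_curve).1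
        (val_zero.1 hc.val_curve)
      rw [val_zero, show (xK / yK)⁻¹ = (1 / xK)⁻¹ * (yK / xK ^ 2) by field_simp]
      exact this
    refine h2.inv_notMem (div_ne_zero hx hy) (h1 ?_)
    rw [hb]
    exact (isCoord_origin.val_left 0 0).mem

theorem isBlowDown_surface :
    IsBlowDown (stage c 11) lineAtInfinity (surface c) contractedPoint := by
  have hx := xK_ne_zero
  have hy := yK_ne_zero
  refine ⟨Or.inr rfl, ?_, ?_, ?_⟩
  · intro S hS
    rw [isPointOver_contractedPoint] at hS
    rintro (⟨h, hle⟩ | h)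
    · exact hle (linePart_le_line hS)
    · exact linePart_ne_contractedPoint hS h
  · ext S
    simp only [blowUp, Set.mem_union, Set.mem_sdiff, Set.mem_singleton_iff, Set.mem_ofPred_eq,
      isPointOver_contractedPoint, surface]
    constructor
    · rintro (⟨⟨h, _⟩ | h, h'⟩ | h)
      · exact h
      · exact absurd h h'
      · rw [stage_final]
        exact Or.inl (Or.inl (Or.inl (Or.inr h)))
    · intro h
      by_cases hle : S ≤ lineAtInfinity
      · exact Or.inr ((line_iff_of_mem_stage c h).1 hle)
      · refine Or.inl ⟨Or.inl ⟨h, hle⟩, ?_⟩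
        rintro rfl
        exact hle contractedPoint_le_line
  · have hc : IsCoord (1 / xK) (yK / xK ^ 2) := (isCoord_chain 0 0).swap
    have := isExceptionalCurve_pointAt_zero hc
    rw [← pointAt_swap hc.swap, show yK / xK ^ 2 / (1 / xK) = yK / xK by field_simp] at this
    exact this

/-! ### Self-intersection numbers -/

section Self

open Classical in
theorem line_smooth_and_self : IsSmoothRationalCurve (stage c 11) lineAtInfinity ∧
    HasIntersectionNumber (stage c 11) lineAtInfinity lineAtInfinity (-1) := by
  have hx := xK_ne_zero
  have hy := yK_ne_zero
  have := smooth_and_self (M := stage c 11) isCoord_line.swap (rfl : lineAtInfinity = _)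
    one_div_xK_ne_zero {lineCorner} (by simp) ?_ ?_
  · simpa using this
  · intro R hR
    obtain rfl := Finset.mem_singleton.1 hR
    refine ⟨?_, _, _, isAdapted_lineCorner, by field_simp⟩
    rw [stage_final]
    exact Or.inl (Or.inl (Or.inl (Or.inr (Or.inr rfl))))
  · intro R hR hle hRT
    rw [line_iff_of_mem_stage c hR] at hle
    rcases hle with ⟨b, rfl⟩ | rfl
    · exact ⟨_, _, isAdapted_line b, by field_simp⟩
    · simp at hRT

theorem chainCorner_div (z : ℕ → ℂ) (n : ℕ) :
    1 / xK / (chain z n - algebraMap ℂ K (z n)) / (1 / xK) =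
      (chain z n - algebraMap ℂ K (z n))⁻¹ := by
  have hx := xK_ne_zero
  have := chain_sub_ne_zero z n (z n)
  field_simp

theorem chainCorner_div_succ (z : ℕ → ℂ) (n : ℕ) :
    (chain z n - algebraMap ℂ K (z n)) / (1 / xK) =
      (1 / xK / (chain z n - algebraMap ℂ K (z n)))⁻¹ := by
  rw [inv_div]

open Classical in
-- Moving by `1/x` leaves a simple pole at each of the corners with the previous and the next
-- exceptional curve. The latter corner counts even if the next curve is the last one, which is not
-- a boundary curve.
theorem chainCurve_smooth_and_self {M : Set (Subalgebra ℂ K)} {z : ℕ → ℂ} {n : ℕ} (hn : 1 ≤ n)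
    (h1 : chainCorner z n ∈ M) (h2 : chainCorner z (n - 1) ∈ M)
    (hM : ∀ R ∈ M, R ≤ chainCurve z n →
      R = chainCorner z n ∨ R = chainCorner z (n - 1) ∨ ∃ d, R = chainPoint z n d) :
    IsSmoothRationalCurve M (chainCurve z n) ∧
      HasIntersectionNumber M (chainCurve z n) (chainCurve z n) (-2) := by
  have hx := xK_ne_zero
  obtain ⟨m, rfl⟩ : ∃ m, n = m + 1 := ⟨n - 1, by omega⟩
  rw [Nat.add_sub_cancel] at h2 hM
  have := smooth_and_self (M := M) (isCoord_chain z (m + 1)) (rfl : chainCurve z (m + 1) = _)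
    one_div_xK_ne_zero {chainCorner z (m + 1), chainCorner z m} (by simp) ?_ ?_
  · rwa [Finset.card_pair (chainCorner_ne z (by omega))] at this
  · intro R hR
    rcases Finset.mem_insert.1 hR with rfl | hR
    · exact ⟨h1, _, _, isAdapted_chainCorner z (m + 1), chainCorner_div z _⟩
    · obtain rfl := Finset.mem_singleton.1 hR
      exact ⟨h2, _, _, isAdapted_chainCorner_succ z m, chainCorner_div_succ z m⟩
  · intro R hR hle hRT
    rcases hM R hR hle with rfl | rfl | ⟨d, rfl⟩
    · simp at hRT
    · simp at hRT
    · exact ⟨_, _, isAdapted_chainPoint z (m + 1) d, div_self one_div_xK_ne_zero⟩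

open Classical in
-- The three poles are the corners with the line and with the two towers. The corner with the first
-- exceptional curve contributes nothing, since `1/x` is a local equation of the second curve there.
theorem second_smooth_and_self : IsSmoothRationalCurve (stage c 11) (excCurve c 1) ∧
    HasIntersectionNumber (stage c 11) (excCurve c 1) (excCurve c 1) (-3) := by
  have hx := xK_ne_zero
  have hy := yK_ne_zero
  have hV : excCurve c 1 = chainCurve (zA c) 0 := rfl
  have hV' : excCurve c 1 = chainCurve (zB c) 0 := rfl
  have hA : zA c 0 ≠ 0 := by rw [zA_zero]; norm_num
  have hB : zB c 0 ≠ 0 := by rw [zB_zero]; norm_num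
  have := smooth_and_self (M := stage c 11) (isCoord_chain (zA c) 0) hV
    one_div_xK_ne_zero {lineCorner, chainCorner (zA c) 0, chainCorner (zB c) 0} (by simp) ?_ ?_
  · rw [Finset.card_insert_of_notMem, Finset.card_pair (chainCorner_ne_of_ne (zA_zero_ne c))]
      at this
    · exact this
    · simp [lineCorner_ne_chainCorner hA, lineCorner_ne_chainCorner hB]
  · intro R hR
    rw [stage_final]
    simp only [Finset.mem_insert, Finset.mem_singleton] at hR
    rcases hR with rfl | rfl | rfl
    · refine ⟨?_, _, _, isAdapted_lineCorner_chain (zA c), by field_simp⟩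
      exact Or.inl (Or.inl (Or.inl (Or.inr (Or.inr rfl))))
    · exact ⟨Or.inl (Or.inr (chainCorner_mem_tower (by norm_num))), _, _,
        isAdapted_chainCorner (zA c) 0, chainCorner_div _ _⟩
    · exact ⟨Or.inr (chainCorner_mem_tower (by norm_num)), _, _,
        isAdapted_chainCorner (zB c) 0, chainCorner_div _ _⟩
  · intro R hR hle hRT
    rw [stage_final] at hR
    simp only [Finset.mem_insert, Finset.mem_singleton, not_or] at hRT
    rcases hR with ((((h | h) | h) | ⟨b, hb, rfl⟩) | h) | h
    · exact absurd hle (hV ▸ affinePart_not_le_chainCurve h)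
    · obtain rfl := (firstPart_le_chainCurve (z := zA c) (n := 0) h hle).1
      exact ⟨_, _, isAdapted_firstCorner_chain (zA c), div_self one_div_xK_ne_zero⟩
    · rcases h with ⟨b, rfl⟩ | h
      · exact absurd hle (hV ▸ line_not_le_second b)
      · exact absurd h hRT.1
    · exact ⟨_, _, isAdapted_chainPoint (zA c) 0 b, div_self one_div_xK_ne_zero⟩
    · exact absurd (tower_le_second h (by norm_num) hle) hRT.2.1
    · exact absurd (tower_le_second (z := zB c) h (by norm_num) hle) hRT.2.2

open Classical in
-- After the contraction the corner with the line is an ordinary point at which `1/x` is a local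
-- equation, so only two poles remain.
theorem second_smooth_and_self_surface : IsSmoothRationalCurve (surface c) (chainCurve (zA c) 0) ∧
    HasIntersectionNumber (surface c) (chainCurve (zA c) 0) (chainCurve (zA c) 0) (-2) := by
  rw [surface_eq]
  have := smooth_and_self (M := affinePart ∪ firstPart ∪ secondPart {1 / 2, -1}ᶜ ∪
    tower (zA c) 6 ∪ tower (zB c) 3) (isCoord_chain (zA c) 0) (rfl : chainCurve (zA c) 0 = _)
    one_div_xK_ne_zero {chainCorner (zA c) 0, chainCorner (zB c) 0} (by simp) ?_ ?_
  · rwa [Finset.card_pair (chainCorner_ne_of_ne (zA_zero_ne c))] at this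
  · intro R hR
    simp only [Finset.mem_insert, Finset.mem_singleton] at hR
    rcases hR with rfl | rfl
    · exact ⟨Or.inl (Or.inr (chainCorner_mem_tower (by norm_num))), _, _,
        isAdapted_chainCorner (zA c) 0, chainCorner_div _ _⟩
    · exact ⟨Or.inr (chainCorner_mem_tower (by norm_num)), _, _,
        isAdapted_chainCorner (zB c) 0, chainCorner_div _ _⟩
  · intro R hR hle hRT
    simp only [Finset.mem_insert, Finset.mem_singleton, not_or] at hRT
    rcases hR with (((h | h) | ⟨b, hb, rfl⟩) | h) | h
    · exact absurd hle (affinePart_not_le_chainCurve h)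
    · obtain rfl := (firstPart_le_chainCurve (z := zA c) (n := 0) h hle).1
      exact ⟨_, _, isAdapted_firstCorner_chain (zA c), div_self one_div_xK_ne_zero⟩
    · exact ⟨_, _, isAdapted_chainPoint (zA c) 0 b, div_self one_div_xK_ne_zero⟩
    · exact absurd (tower_le_second h (by norm_num) hle) hRT.1
    · exact absurd (tower_le_second (z := zB c) h (by norm_num) hle) hRT.2

theorem verticalPoint_ne_firstCorner : verticalPoint ≠ firstCorner := by
  intro h
  have := x_mem_verticalPoint
  rw [h] at this
  exact not_le_chainCurve this (isAdapted_firstCorner_chain 0).1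

open Classical in
-- Here `1/x` is a coordinate along the curve, and `x/y` is used for moving it. The poles lie at the
-- two ends `x = 0` and `1/x = 0`.
theorem first_smooth_and_self_surface : IsSmoothRationalCurve (surface c) firstCurve ∧
    HasIntersectionNumber (surface c) firstCurve firstCurve (-2) := by
  have hx := xK_ne_zero
  have hy := yK_ne_zero
  have hxy : xK / yK ≠ 0 := div_ne_zero hx hy
  rw [surface_eq]
  have := smooth_and_self (M := affinePart ∪ firstPart ∪ secondPart {1 / 2, -1}ᶜ ∪
    tower (zA c) 6 ∪ tower (zB c) 3) isCoord_first.swap (rfl : firstCurve = _)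
    hxy {verticalPoint, firstCorner} (by simp) ?_ ?_
  · rwa [Finset.card_pair verticalPoint_ne_firstCorner] at this
  · intro R hR
    simp only [Finset.mem_insert, Finset.mem_singleton] at hR
    rcases hR with rfl | rfl
    · exact ⟨Or.inl (Or.inl (Or.inl (Or.inr (Or.inr (Or.inl rfl))))), _, _,
        isAdapted_verticalPoint, by field_simp⟩
    · exact ⟨Or.inl (Or.inl (Or.inl (Or.inr (Or.inr (Or.inr rfl))))), _, _,
        isAdapted_firstCorner, by field_simp⟩
  · intro R hR hle hRT
    simp only [Finset.mem_insert, Finset.mem_singleton, not_or] at hRT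
    rcases hR with (((h | h) | h) | h) | h
    · exact absurd hle (affinePart_not_le_firstCurve h)
    · rcases h with ⟨b, hb, rfl⟩ | h | h
      · exact ⟨_, _, isAdapted_first b, div_self hxy⟩
      · exact absurd h hRT.1
      · exact absurd h hRT.2
    · exact absurd hle (secondPart_not_le_firstCurve h)
    · exact absurd hle (tower_not_le_firstCurve h (by norm_num))
    · exact absurd hle (tower_not_le_firstCurve h (by norm_num))

theorem chainA_smooth_and_self_surface {n : ℕ} (hn : 1 ≤ n) (hn6 : n < 6) :
    IsSmoothRationalCurve (surface c) (chainCurve (zA c) n) ∧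
    HasIntersectionNumber (surface c) (chainCurve (zA c) n) (chainCurve (zA c) n) (-2) := by
  rw [surface_eq]
  refine chainCurve_smooth_and_self hn (Or.inl (Or.inr (chainCorner_mem_tower hn6)))
    (Or.inl (Or.inr (chainCorner_mem_tower (by omega)))) ?_
  rintro R ((((h | h) | h) | h) | h) hle
  · exact absurd hle (affinePart_not_le_chainCurve h)
  · exact absurd (firstPart_le_chainCurve h hle).2 (by omega)
  · exact absurd (secondPart_le_chainCurve h (by rw [zA_zero]; simp) hle) (by omega)
  · exact tower_le_chainCurve h hn hn6 hle
  · exact absurd hle (tower_not_le_chainCurve (zA_zero_ne c).symm h (by norm_num) hn)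

theorem chainB_smooth_and_self_surface {n : ℕ} (hn : 1 ≤ n) (hn3 : n < 3) :
    IsSmoothRationalCurve (surface c) (chainCurve (zB c) n) ∧
    HasIntersectionNumber (surface c) (chainCurve (zB c) n) (chainCurve (zB c) n) (-2) := by
  rw [surface_eq]
  refine chainCurve_smooth_and_self hn (Or.inr (chainCorner_mem_tower hn3))
    (Or.inr (chainCorner_mem_tower (by omega))) ?_
  rintro R ((((h | h) | h) | h) | h) hle
  · exact absurd hle (affinePart_not_le_chainCurve h)
  · exact absurd (firstPart_le_chainCurve h hle).2 (by omega)
  · exact absurd (secondPart_le_chainCurve h (by rw [zB_zero]; simp) hle) (by omega)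
  · exact absurd hle (tower_not_le_chainCurve (zA_zero_ne c) h (by norm_num) hn)
  · exact tower_le_chainCurve h hn hn3 hle

end Self

/-! ### The configuration of the boundary curves -/

/-- This turns incidences into index arithmetic: node `k + 3` carries the `k`-th curve of the long
arm, and node `4 - 2 k` the `k`-th curve of the short one. -/
theorem boundary_cases (i : Fin 9) :
    (i = 1 ∧ boundary c i = firstCurve) ∨
    (∃ k < 6, (i : ℕ) = k + 3 ∧ boundary c i = chainCurve (zA c) k) ∨
    ∃ k, 1 ≤ k ∧ k < 3 ∧ (i : ℕ) + 2 * k = 4 ∧ boundary c i = chainCurve (zB c) k := by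
  fin_cases i
  · exact Or.inr (Or.inr ⟨2, by norm_num, by norm_num, rfl, rfl⟩)
  · exact Or.inl ⟨rfl, rfl⟩
  · exact Or.inr (Or.inr ⟨1, by norm_num, by norm_num, rfl, rfl⟩)
  · exact Or.inr (Or.inl ⟨0, by norm_num, rfl, rfl⟩)
  · exact Or.inr (Or.inl ⟨1, by norm_num, rfl, rfl⟩)
  · exact Or.inr (Or.inl ⟨2, by norm_num, rfl, rfl⟩)
  · exact Or.inr (Or.inl ⟨3, by norm_num, rfl, rfl⟩)
  · exact Or.inr (Or.inl ⟨4, by norm_num, rfl, rfl⟩)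
  · exact Or.inr (Or.inl ⟨5, by norm_num, rfl, rfl⟩)

theorem boundary_smooth_and_self (i : Fin 9) :
    IsSmoothRationalCurve (surface c) (boundary c i) ∧
      HasIntersectionNumber (surface c) (boundary c i) (boundary c i) (-2) := by
  rcases boundary_cases c i with ⟨_, h⟩ | ⟨k, hk, _, h⟩ | ⟨k, hk, hk', _, h⟩
  · rw [h]; exact first_smooth_and_self_surface c
  · rw [h]
    rcases Nat.eq_zero_or_pos k with rfl | hk0
    · exact second_smooth_and_self_surface c
    · exact chainA_smooth_and_self_surface c hk0 hk
  · rw [h]; exact chainB_smooth_and_self_surface c hk hk'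

section Nodes

variable {c} {R : Subalgebra ℂ K} {i : Fin 9} {n : ℕ} {d : ℂ}

theorem affinePart_not_le_boundary (h : R ∈ affinePart) : ¬ R ≤ boundary c i := by
  rcases boundary_cases c i with ⟨_, e⟩ | ⟨k, _, _, e⟩ | ⟨k, _, _, _, e⟩ <;> rw [e]
  · exact affinePart_not_le_firstCurve h
  · exact affinePart_not_le_chainCurve h
  · exact affinePart_not_le_chainCurve h

theorem firstPart_le_boundary (h : R ∈ firstPart) (hle : R ≤ boundary c i) :
    i = 1 ∨ (i = 3 ∧ R = firstCorner) := by
  rcases boundary_cases c i with ⟨hi, _⟩ | ⟨k, _, hi, e⟩ | ⟨k, _, _, _, e⟩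
  · exact Or.inl hi
  · rw [e] at hle
    obtain ⟨h1, rfl⟩ := firstPart_le_chainCurve h hle
    exact Or.inr ⟨Fin.ext hi, h1⟩
  · rw [e] at hle
    have := (firstPart_le_chainCurve h hle).2
    omega

theorem secondPart_le_boundary (h : R ∈ secondPart {1 / 2, -1}ᶜ) (hle : R ≤ boundary c i) :
    i = 3 := by
  rcases boundary_cases c i with ⟨_, e⟩ | ⟨k, _, hi, e⟩ | ⟨k, _, _, _, e⟩ <;> rw [e] at hle
  · exact absurd hle (secondPart_not_le_firstCurve h)
  · obtain rfl := secondPart_le_chainCurve h (by rw [zA_zero]; simp) hle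
    exact Fin.ext hi
  · have := secondPart_le_chainCurve h (by rw [zB_zero]; simp) hle
    omega

theorem chainCornerA_le_boundary (hle : chainCorner (zA c) n ≤ boundary c i) :
    (i : ℕ) = n + 3 ∨ (i : ℕ) = n + 4 := by
  have ht := chainCorner_mem_tower (z := zA c) (n := n) (k := n + 1) (by omega)
  rcases boundary_cases c i with ⟨_, e⟩ | ⟨k, _, hi, e⟩ | ⟨k, hk, _, _, e⟩ <;> rw [e] at hle
  · exact absurd hle (tower_not_le_firstCurve ht (by omega))
  · rcases eq_of_chainCorner_le hle with rfl | rfl <;> omega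
  · exact absurd hle (chainCorner_not_le (zA_zero_ne c) hk)

/-- For `n = 6` the conclusion would be `i = 9`, which no node satisfies: these points of the last
exceptional curve lie off the boundary. -/
theorem chainPointA_le_boundary (hn : 1 ≤ n) (hd : d ≠ zA c n ∨ n = 6)
    (hle : chainPoint (zA c) n d ≤ boundary c i) : (i : ℕ) = n + 3 := by
  rcases boundary_cases c i with ⟨_, e⟩ | ⟨k, hk, hi, e⟩ | ⟨k, hk, _, _, e⟩ <;> rw [e] at hle
  · exact absurd hle (not_le_firstCurve_of_chain (val_zero_chainPoint hn).mem)
  · rcases hd with hd | rfl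
    · obtain rfl := eq_of_chainPoint_le hle hd
      exact hi
    · have := le_of_chainPoint_le hle
      omega
  · exact absurd hle (chainPoint_not_le (zA_zero_ne c) hn hk)

theorem chainCornerB_le_boundary (hle : chainCorner (zB c) n ≤ boundary c i) :
    (n = 0 ∧ i = 3) ∨ (1 ≤ n ∧ (i : ℕ) + 2 * n = 4) ∨ (i : ℕ) + 2 * n = 2 := by
  have ht := chainCorner_mem_tower (z := zB c) (n := n) (k := n + 1) (by omega)
  rcases boundary_cases c i with ⟨_, e⟩ | ⟨k, hk, hi, e⟩ | ⟨k, hk, _, hi, e⟩ <;> rw [e] at hle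
  · exact absurd hle (tower_not_le_firstCurve ht (by omega))
  · rcases Nat.eq_zero_or_pos k with rfl | hk0
    · refine Or.inl ⟨?_, Fin.ext hi⟩
      rcases eq_of_chainCorner_le (z := zB c) (n := 0) hle with h | h <;> omega
    · exact absurd hle (chainCorner_not_le (zA_zero_ne c).symm hk0)
  · rcases eq_of_chainCorner_le hle with rfl | rfl <;> omega

/-- For `n = 3` the conclusion is again unsatisfiable, so these points are off the boundary. -/
theorem chainPointB_le_boundary (hn : 1 ≤ n) (hd : d ≠ zB c n ∨ n = 3)
    (hle : chainPoint (zB c) n d ≤ boundary c i) : (i : ℕ) + 2 * n = 4 := by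
  rcases boundary_cases c i with ⟨_, e⟩ | ⟨k, hk, hi, e⟩ | ⟨k, hk, _, _, e⟩ <;> rw [e] at hle
  · exact absurd hle (not_le_firstCurve_of_chain (val_zero_chainPoint hn).mem)
  · rcases Nat.eq_zero_or_pos k with rfl | hk0
    · have := le_of_chainPoint_le (z := zB c) (n := 0) hle
      omega
    · exact absurd hle (chainPoint_not_le (zA_zero_ne c).symm hn hk0)
  · rcases hd with hd | rfl
    · obtain rfl := eq_of_chainPoint_le hle hd
      assumption
    · have := le_of_chainPoint_le hle
      omega

end Nodes

/-- The edges of the diagram, directed towards the affine node. -/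
def edgeTarget : Fin 9 → Fin 9 := ![2, 3, 3, 4, 5, 6, 7, 8, 8]

/-- The intersection points of the boundary curves. -/
def edgePoint : Fin 9 → Subalgebra ℂ K :=
  ![chainCorner (zB c) 1, firstCorner, chainCorner (zB c) 0, chainCorner (zA c) 0,
    chainCorner (zA c) 1, chainCorner (zA c) 2, chainCorner (zA c) 3, chainCorner (zA c) 4,
    chainCorner (zA c) 5]

theorem edgePoint_mem (i : Fin 9) : edgePoint c i ∈ surface c := by
  rw [surface_eq]
  have hA : ∀ n < 6, chainCorner (zA c) n ∈ affinePart ∪ firstPart ∪ secondPart {1 / 2, -1}ᶜ ∪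
    tower (zA c) 6 ∪ tower (zB c) 3 := fun n hn => Or.inl (Or.inr (chainCorner_mem_tower hn))
  fin_cases i
  · exact Or.inr (chainCorner_mem_tower (by norm_num))
  · exact Or.inl (Or.inl (Or.inl (Or.inr (Or.inr (Or.inr rfl)))))
  · exact Or.inr (chainCorner_mem_tower (by norm_num))
  · exact hA 0 (by norm_num)
  · exact hA 1 (by norm_num)
  · exact hA 2 (by norm_num)
  · exact hA 3 (by norm_num)
  · exact hA 4 (by norm_num)
  · exact hA 5 (by norm_num)

/-- Node `8` ends the long arm and starts no edge. Its entry in `edgeTarget` is a filler, and its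
entry in `edgePoint` is the corner with the last exceptional curve. -/
theorem edgePoint_adapted {i : Fin 9} (hi : i ≠ 8) :
    ∃ f g, IsAdapted (edgePoint c i) (boundary c i) f g ∧
      IsAdapted (edgePoint c i) (boundary c (edgeTarget i)) g f := by
  fin_cases i
  · exact ⟨_, _, isAdapted_chainCorner_succ (zB c) 1, isAdapted_chainCorner (zB c) 1⟩
  · exact ⟨_, _, isAdapted_firstCorner, isAdapted_firstCorner_chain (zA c)⟩
  · exact ⟨_, _, isAdapted_chainCorner_succ (zB c) 0, isAdapted_chainCorner (zB c) 0⟩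
  · exact ⟨_, _, isAdapted_chainCorner (zA c) 0, isAdapted_chainCorner_succ (zA c) 0⟩
  · exact ⟨_, _, isAdapted_chainCorner (zA c) 1, isAdapted_chainCorner_succ (zA c) 1⟩
  · exact ⟨_, _, isAdapted_chainCorner (zA c) 2, isAdapted_chainCorner_succ (zA c) 2⟩
  · exact ⟨_, _, isAdapted_chainCorner (zA c) 3, isAdapted_chainCorner_succ (zA c) 3⟩
  · exact ⟨_, _, isAdapted_chainCorner (zA c) 4, isAdapted_chainCorner_succ (zA c) 4⟩
  · exact absurd rfl hi

theorem chainCornerA_eq_edgePoint {i : Fin 9} {n : ℕ} (h : (i : ℕ) = n + 3) :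
    chainCorner (zA c) n = edgePoint c i := by
  have hn : n < 6 := by omega
  obtain ⟨i, hi⟩ := i
  obtain rfl : i = n + 3 := h
  interval_cases n <;> rfl

/-- Going through the list of points, only corners lie on two boundary curves. This gives both the
vanishing of the other intersection numbers and the uniqueness of each intersection point. -/
theorem edge_of_mem_two {R : Subalgebra ℂ K} (hR : R ∈ surface c) {i j : Fin 9} (hij : i < j)
    (hi : R ≤ boundary c i) (hj : R ≤ boundary c j) :
    i ≠ 8 ∧ j = edgeTarget i ∧ R = edgePoint c i := by
  rw [surface_eq] at hR
  rcases hR with (((h | h) | h) | h) | h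
  · exact absurd hi (affinePart_not_le_boundary h)
  · rcases firstPart_le_boundary h hi with rfl | ⟨rfl, h1⟩
    · rcases firstPart_le_boundary h hj with rfl | ⟨rfl, rfl⟩
      · exact absurd hij (lt_irrefl _)
      · exact ⟨by decide, rfl, rfl⟩
    · rcases firstPart_le_boundary h hj with rfl | ⟨rfl, rfl⟩
      · exact absurd hij (by decide)
      · exact absurd hij (lt_irrefl _)
  · rw [secondPart_le_boundary h hi, secondPart_le_boundary h hj] at hij
    exact absurd hij (lt_irrefl _)
  · rcases h with ⟨n, hn, rfl⟩ | ⟨n, hn, hn', d, hd, rfl⟩ | ⟨d, rfl⟩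
    · have h1 := chainCornerA_le_boundary hi
      have h2 := chainCornerA_le_boundary hj
      rw [Fin.lt_def] at hij
      have h3 : (i : ℕ) = n + 3 := by omega
      have h4 : (j : ℕ) = i + 1 := by omega
      refine ⟨by rintro rfl; omega, ?_, chainCornerA_eq_edgePoint c h3⟩
      have : n < 5 := by omega
      obtain ⟨i, hi'⟩ := i
      obtain ⟨j, hj'⟩ := j
      obtain rfl : i = n + 3 := h3
      obtain rfl : j = n + 3 + 1 := h4
      interval_cases n <;> rfl
    · have h1 := chainPointA_le_boundary hn (Or.inl hd) hi
      have h2 := chainPointA_le_boundary hn (Or.inl hd) hj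
      omega
    · have h1 := chainPointA_le_boundary (by norm_num) (Or.inr rfl) hi
      omega
  · rcases h with ⟨n, hn, rfl⟩ | ⟨n, hn, hn', d, hd, rfl⟩ | ⟨d, rfl⟩
    · have h1 := chainCornerB_le_boundary hi
      have h2 := chainCornerB_le_boundary hj
      rw [Fin.lt_def] at hij
      rw [Fin.ext_iff] at h1 h2
      change (n = 0 ∧ (i : ℕ) = 3) ∨ _ at h1
      change (n = 0 ∧ (j : ℕ) = 3) ∨ _ at h2
      have h3 : (n = 0 ∧ (i : ℕ) = 2 ∧ (j : ℕ) = 3) ∨ (n = 1 ∧ (i : ℕ) = 0 ∧ (j : ℕ) = 2) := by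
        omega
      rcases h3 with ⟨rfl, hi2, hj2⟩ | ⟨rfl, hi2, hj2⟩
      · obtain rfl : i = 2 := Fin.ext hi2
        obtain rfl : j = 3 := Fin.ext hj2
        exact ⟨by decide, rfl, rfl⟩
      · obtain rfl : i = 0 := Fin.ext hi2
        obtain rfl : j = 2 := Fin.ext hj2
        exact ⟨by decide, rfl, rfl⟩
    · have h1 := chainPointB_le_boundary hn (Or.inl hd) hi
      have h2 := chainPointB_le_boundary hn (Or.inl hd) hj
      omega
    · have h1 := chainPointB_le_boundary (by norm_num) (Or.inr rfl) hi
      omega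

/-- A general point of each curve lies on no other boundary curve, which shows that the nine curves
are distinct. -/
theorem exists_only_boundary (i : Fin 9) :
    ∃ R, R ≤ boundary c i ∧ ∀ j, R ≤ boundary c j → j = i := by
  rcases boundary_cases c i with ⟨rfl, e⟩ | ⟨k, hk, hi, e⟩ | ⟨k, hk, hk', hi, e⟩
  · refine ⟨_, e ▸ (isAdapted_first 1).1, fun j hj => ?_⟩
    rcases firstPart_le_boundary (Or.inl ⟨1, one_ne_zero, rfl⟩) hj with h | ⟨_, h⟩
    · exact h
    · have := x_mem_pointAt_first one_ne_zero
      rw [h] at this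
      exact absurd (isAdapted_firstCorner_chain 0).1 (not_le_chainCurve this)
  · rcases Nat.eq_zero_or_pos k with rfl | hk0
    · refine ⟨_, e ▸ (isAdapted_chainPoint (zA c) 0 0).1, fun j hj => ?_⟩
      rw [secondPart_le_boundary ⟨0, by simp, rfl⟩ hj]
      exact (Fin.ext hi).symm
    · refine ⟨_, e ▸ (isAdapted_chainPoint (zA c) k (zA c k + 1)).1, fun j hj => ?_⟩
      have := chainPointA_le_boundary hk0 (Or.inl (by simp)) hj
      exact Fin.ext (by omega)
  · refine ⟨_, e ▸ (isAdapted_chainPoint (zB c) k (zB c k + 1)).1, fun j hj => ?_⟩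
    have := chainPointB_le_boundary hk (Or.inl (by simp)) hj
    exact Fin.ext (by omega)

theorem affineE8_transpose : affineE8.transpose = affineE8 := by decide

theorem affineE8_edge : ∀ p : Fin 9 × Fin 9, p.1 < p.2 →
    affineE8 p.1 p.2 = if p.1 ≠ 8 ∧ p.2 = edgeTarget p.1 then -1 else 0 := by
  decide

theorem isE8Configuration_surface : IsE8Configuration (surface c) (boundary c) := by
  have hdiag : ∀ i, affineE8 i i = 2 := by decide
  have hlt : ∀ i j, i < j →
      HasIntersectionNumber (surface c) (boundary c i) (boundary c j) (-affineE8 i j) ∧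
      HasIntersectionNumber (surface c) (boundary c j) (boundary c i) (-affineE8 j i) := by
    intro i j hij
    have hs : affineE8 i j = affineE8 j i := congrFun (congrFun affineE8_transpose.symm i) j
    have he8 := affineE8_edge (i, j) hij
    simp only at he8
    have hi := (boundary_smooth_and_self c i).1
    have hj := (boundary_smooth_and_self c j).1
    rw [← hs]
    by_cases he : i ≠ 8 ∧ j = edgeTarget i
    · rw [he8, if_pos he]
      obtain ⟨f, g, hf, hg⟩ := edgePoint_adapted c he.1
      rw [← he.2] at hg
      exact ⟨hasIntersectionNumber_one hi (edgePoint_mem c i) hf hg fun R hR hRi hne hRj =>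
          hne (edge_of_mem_two c hR hij hRi hRj).2.2,
        hasIntersectionNumber_one hj (edgePoint_mem c i) hg hf fun R hR hRj hne hRi =>
          hne (edge_of_mem_two c hR hij hRi hRj).2.2⟩
    · rw [he8, if_neg he]
      exact ⟨hasIntersectionNumber_zero hi fun R hR hRi hRj =>
          he ⟨(edge_of_mem_two c hR hij hRi hRj).1, (edge_of_mem_two c hR hij hRi hRj).2.1⟩,
        hasIntersectionNumber_zero hj fun R hR hRj hRi =>
          he ⟨(edge_of_mem_two c hR hij hRi hRj).1, (edge_of_mem_two c hR hij hRi hRj).2.1⟩⟩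
  refine ⟨fun i j h => ?_, fun i => (boundary_smooth_and_self c i).1, fun i j => ?_⟩
  · obtain ⟨R, hR, hR'⟩ := exists_only_boundary c i
    exact (hR' j (h ▸ hR)).symm
  · rcases lt_trichotomy i j with h | rfl | h
    · exact (hlt i j h).1
    · rw [hdiag]; exact (boundary_smooth_and_self c i).2
    · exact (hlt j i h).2

/-! ### The phase space at a fixed time -/

/-- All points of the first two exceptional curves and of the lower levels of the towers lie on the
boundary. Besides the affine plane, only the top levels of the towers are left. -/
theorem phaseFiber_cases : phaseFiber c =
    affinePart ∪ {R | ∃ d, R = chainPoint (zB c) 3 d} ∪ {R | ∃ d, R = chainPoint (zA c) 6 d} := by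
  have hb : ∀ i : Fin 9, edgePoint c i ≤ boundary c i := by
    intro i
    by_cases hi : i = 8
    · subst hi; exact (isAdapted_chainCorner (zA c) 5).1
    · obtain ⟨f, g, h, _⟩ := edgePoint_adapted c hi
      exact h.1
  have hAc : ∀ k (hk : k < 6), boundary c ⟨k + 3, by omega⟩ = chainCurve (zA c) k := by
    intro k hk; interval_cases k <;> rfl
  ext R
  constructor
  · rintro ⟨hR, hno⟩
    rw [surface_eq] at hR
    rcases hR with (((h | h) | h) | h) | h
    · exact Or.inl (Or.inl h)
    · exfalso
      refine hno 1 (?_ : R ≤ firstCurve)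
      rcases h with ⟨b, _, rfl⟩ | rfl | rfl
      · exact (isAdapted_first b).1
      · exact isAdapted_verticalPoint.1
      · exact isAdapted_firstCorner.1
    · exfalso
      obtain ⟨b, _, rfl⟩ := h
      exact hno 3 (isAdapted_chainPoint (zA c) 0 b).1
    · rcases h with ⟨n, hn, rfl⟩ | ⟨n, hn, hn', d, hd, rfl⟩ | h
      · exact absurd (chainCornerA_eq_edgePoint c (i := ⟨n + 3, by omega⟩) rfl ▸ hb _) (hno _)
      · exact absurd (hAc n hn' ▸ (isAdapted_chainPoint (zA c) n d).1) (hno _)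
      · exact Or.inr h
    · rcases h with ⟨n, hn, rfl⟩ | ⟨n, hn, hn', d, hd, rfl⟩ | h
      · exfalso
        interval_cases n
        · exact hno 3 (isAdapted_chainCorner (zB c) 0).1
        · exact hno 2 (isAdapted_chainCorner (zB c) 1).1
        · exact hno 0 (isAdapted_chainCorner (zB c) 2).1
      · exfalso
        interval_cases n
        · exact hno 2 (isAdapted_chainPoint (zB c) 1 d).1
        · exact hno 0 (isAdapted_chainPoint (zB c) 2 d).1
      · exact Or.inl (Or.inr h)
  · intro hR
    have hmem : R ∈ surface c ∧ ∀ i, ¬ R ≤ boundary c i := by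
      rw [surface_eq]
      rcases hR with (h | ⟨d, rfl⟩) | ⟨d, rfl⟩
      · exact ⟨Or.inl (Or.inl (Or.inl (Or.inl h))), fun i => affinePart_not_le_boundary h⟩
      · refine ⟨Or.inr (Or.inr (Or.inr ⟨d, rfl⟩)), fun i hi => ?_⟩
        have := chainPointB_le_boundary (by norm_num) (Or.inr rfl) hi
        omega
      · refine ⟨Or.inl (Or.inr (Or.inr (Or.inr ⟨d, rfl⟩))), fun i hi => ?_⟩
        have := chainPointA_le_boundary (by norm_num) (Or.inr rfl) hi
        omega
    exact hmem

end InceX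

end

/-! ### The three charts, their gluing and the Hausdorff property. -/

noncomputable section

namespace InceX

open MvPolynomial

/-! ### The three charts at a fixed time -/

/-- The inverse of `chartMap`, expressing `(x, y)` through the coordinates `(x_j, y_j)`. -/
def chartInv {F : Type*} [Field F] (c : CenterData F) (u v : F) : Fin 3 → F × F :=
  ![(u, v),
    (1 / u, v * u - (1 / u) ^ 2 + 12 * c.q),
    (1 / u, (1 / u) ^ 2 / 2 - 6 * c.q + 12 * c.dq * u - c.a * u ^ 2 + c.b * u ^ 3 + v * u ^ 4)]

section Field

variable {F : Type*} [Field F] (c : CenterData F)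

theorem chartMap_fst {j : Fin 3} (hj : j ≠ 0) (x y : F) : (chartMap c x y j).1 = 1 / x := by
  fin_cases j
  · exact absurd rfl hj
  · rfl
  · rfl

theorem chartInv_fst {j : Fin 3} (hj : j ≠ 0) (u v : F) : (chartInv c u v j).1 = 1 / u := by
  fin_cases j
  · exact absurd rfl hj
  · rfl
  · rfl

theorem chartInv_chartMap (j : Fin 3) {x : F} (y : F) (hx : x ≠ 0) :
    chartInv c (chartMap c x y j).1 (chartMap c x y j).2 j = (x, y) := by
  fin_cases j
  · rfl
  · simp only [chartInv, chartMap, Fin.mk_one, Matrix.cons_val_one, Matrix.cons_val_zero,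
      Prod.mk.injEq]
    constructor
    · field_simp
    · field_simp
      ring
  · simp only [chartInv, chartMap, Fin.reduceFinMk, Matrix.cons_val, Prod.mk.injEq]
    constructor
    · field_simp
    · field_simp
      ring

theorem chartMap_chartInv (j : Fin 3) {u : F} (v : F) (hu : u ≠ 0) :
    chartMap c (chartInv c u v j).1 (chartInv c u v j).2 j = (u, v) := by
  fin_cases j
  · rfl
  · simp only [chartInv, chartMap, Fin.mk_one, Matrix.cons_val_one, Matrix.cons_val_zero,
      Prod.mk.injEq]
    constructor
    · field_simp
    · field_simp
      ring
  · simp only [chartInv, chartMap, Fin.reduceFinMk, Matrix.cons_val, Prod.mk.injEq]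
    constructor
    · field_simp
    · field_simp
      ring

end Field

section Fiber

variable (c : CenterData ℂ)

/-- Dividing by `1/x` is multiplying by `x`, so unwinding the recursion of the chain yields the
polynomial formula for `y₁`. -/
theorem chartMap_toK_one : chartMap c.toK xK yK 1 = (1 / xK, chain (zB c) 3) := by
  have hx := xK_ne_zero
  simp only [chartMap, chain, zB, CenterData.toK, Matrix.cons_val_one, Matrix.cons_val_zero,
    Prod.mk.injEq, true_and, map_neg, map_one, map_zero, map_mul, map_ofNat]
  field_simp
  ring

theorem chartMap_toK_two : chartMap c.toK xK yK 2 = (1 / xK, chain (zA c) 6) := by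
  have hx := xK_ne_zero
  simp only [chartMap, chain, zA, CenterData.toK, Matrix.cons_val,
    Prod.mk.injEq, true_and, map_neg, map_one, map_zero, map_mul, map_ofNat, map_div₀]
  field_simp
  ring

theorem isCoord_chart (j : Fin 3) :
    IsCoord (chartMap c.toK xK yK j).1 (chartMap c.toK xK yK j).2 := by
  fin_cases j
  · exact isCoord_xy
  · change IsCoord (chartMap c.toK xK yK 1).1 (chartMap c.toK xK yK 1).2
    rw [chartMap_toK_one]
    exact (isCoord_chain _ _).swap
  · change IsCoord (chartMap c.toK xK yK 2).1 (chartMap c.toK xK yK 2).2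
    rw [chartMap_toK_two]
    exact (isCoord_chain _ _).swap

variable {R : Subalgebra ℂ K}

theorem val_ofNat (n : ℕ) [n.AtLeastTwo] : Val R (OfNat.ofNat n : K) (OfNat.ofNat n : ℂ) := by
  have := val_const (R := R) (OfNat.ofNat n : ℂ)
  rwa [map_ofNat] at this

theorem val_chartMap (hR : IsLocalSub R) {x y : K} {a b : ℂ} (hx : Val R x a) (hy : Val R y b)
    (ha : a ≠ 0) (j : Fin 3) : Val R (chartMap c.toK x y j).1 (chartMap c a b j).1 ∧
      Val R (chartMap c.toK x y j).2 (chartMap c a b j).2 := by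
  have h12 := val_ofNat (R := R) 12
  have h6 := val_ofNat (R := R) 6
  fin_cases j
  · exact ⟨hx, hy⟩
  · exact ⟨hR.val_div val_one hx ha, hR.val_mul (hR.val_sub (hR.val_add hy (hR.val_pow hx 2))
      (hR.val_mul h12 (val_const c.q))) hx⟩
  · exact ⟨hR.val_div val_one hx ha, hR.val_mul (hR.val_sub (hR.val_mul (hR.val_add (hR.val_mul
      (hR.val_sub (hR.val_mul (hR.val_add (hR.val_sub hy (hR.val_div (hR.val_pow hx 2)
        (val_ofNat 2) two_ne_zero)) (hR.val_mul h6 (val_const c.q))) hx)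
        (hR.val_mul h12 (val_const c.dq))) hx) (val_const c.a)) hx) (val_const c.b)) hx⟩

theorem val_chartInv (hR : IsLocalSub R) {u v : K} {a b : ℂ} (hu : Val R u a) (hv : Val R v b)
    (ha : a ≠ 0) (j : Fin 3) : Val R (chartInv c.toK u v j).1 (chartInv c a b j).1 ∧
      Val R (chartInv c.toK u v j).2 (chartInv c a b j).2 := by
  have h12 := val_ofNat (R := R) 12
  have h6 := val_ofNat (R := R) 6
  have hi := hR.val_div val_one hu ha
  fin_cases j
  · exact ⟨hu, hv⟩
  · exact ⟨hi, hR.val_add (hR.val_sub (hR.val_mul hv hu) (hR.val_pow hi 2))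
      (hR.val_mul h12 (val_const c.q))⟩
  · exact ⟨hi, hR.val_add (hR.val_add (hR.val_sub (hR.val_add (hR.val_sub (hR.val_div
      (hR.val_pow hi 2) (val_ofNat 2) two_ne_zero) (hR.val_mul h6 (val_const c.q)))
      (hR.val_mul (hR.val_mul h12 (val_const c.dq)) hu))
      (hR.val_mul (val_const c.a) (hR.val_pow hu 2)))
      (hR.val_mul (val_const c.b) (hR.val_pow hu 3))) (hR.val_mul hv (hR.val_pow hu 4))⟩

theorem isLocalSub_chartPoint (j : Fin 3) (a b : ℂ) : IsLocalSub (chartPoint c j a b) :=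
  (isCoord_chart c j).isLocalSub_pointAt a b

theorem val_chartPoint_fst (j : Fin 3) (a b : ℂ) :
    Val (chartPoint c j a b) (chartMap c.toK xK yK j).1 a := (isCoord_chart c j).val_left a b

theorem val_chartPoint_snd (j : Fin 3) (a b : ℂ) :
    Val (chartPoint c j a b) (chartMap c.toK xK yK j).2 b := (isCoord_chart c j).val_right a b

theorem chartPoint_injective {j : Fin 3} {a b a' b' : ℂ}
    (h : chartPoint c j a b = chartPoint c j a' b') : a = a' ∧ b = b' :=
  have hR := isLocalSub_chartPoint c j a' b'
  ⟨hR.val_unique (h ▸ val_chartPoint_fst c j a b) (val_chartPoint_fst c j a' b'),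
    hR.val_unique (h ▸ val_chartPoint_snd c j a b) (val_chartPoint_snd c j a' b')⟩

theorem chartPoint_eq_of_ne_zero (j : Fin 3) {a : ℂ} (b : ℂ) (ha : a ≠ 0) :
    chartPoint c j a b = chartPoint c 0 (chartInv c a b j).1 (chartInv c a b j).2 := by
  have h1 := isLocalSub_chartPoint c j a b
  have ha' : (chartInv c a b j).1 ≠ 0 := by
    by_cases hj : j = 0
    · subst hj; exact ha
    · rw [chartInv_fst c hj]; exact one_div_ne_zero ha
  have h2 := val_chartInv c h1 (val_chartPoint_fst c j a b) (val_chartPoint_snd c j a b) ha j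
  rw [chartInv_chartMap c.toK j yK xK_ne_zero] at h2
  have h3 := val_chartMap c (isLocalSub_chartPoint c 0 (chartInv c a b j).1 (chartInv c a b j).2)
    (val_chartPoint_fst c 0 _ _) (val_chartPoint_snd c 0 _ _) ha' j
  rw [chartMap_chartInv c j b ha] at h3
  exact pointAt_eq (isCoord_chart c j) isCoord_xy h3.1 h3.2 h2.1 h2.2

theorem chartPoint_zero_eq_iff {j : Fin 3} (hj : j ≠ 0) (a b a' b' : ℂ) :
    chartPoint c 0 a b = chartPoint c j a' b' ↔ a ≠ 0 ∧ (a', b') = chartMap c a b j := by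
  constructor
  · intro h
    have hR := isLocalSub_chartPoint c 0 a b
    have h1 := val_chartPoint_fst c j a' b'
    have h2 := val_chartPoint_snd c j a' b'
    rw [← h] at h1 h2
    have hxa : Val (chartPoint c 0 a b) xK a := val_chartPoint_fst c 0 a b
    have ha : a ≠ 0 := by
      rintro rfl
      -- If `x` had the value `0`, then `x * (1/x) = 1` would have the value `0` as well.
      have h3 := hR.val_mul hxa h1
      rw [chartMap_fst _ hj, mul_one_div_cancel xK_ne_zero] at h3
      have := hR.val_unique h3 val_one
      simp at this
    have h3 := val_chartMap c hR hxa (val_chartPoint_snd c 0 a b) ha j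
    exact ⟨ha, Prod.ext (hR.val_unique h1 h3.1) (hR.val_unique h2 h3.2)⟩
  · rintro ⟨ha, h⟩
    obtain ⟨h1, h2⟩ := Prod.ext_iff.1 h
    simp only at h1 h2
    have ha' : a' ≠ 0 := by
      rw [h1, chartMap_fst c hj]; exact one_div_ne_zero ha
    rw [chartPoint_eq_of_ne_zero c j b' ha', h1, h2, chartInv_chartMap c j b ha]

theorem chartPoint_one_zero (b : ℂ) : chartPoint c 1 0 b = chainPoint (zB c) 3 b := by
  rw [chartPoint, chartMap_toK_one, pointAt_swap (isCoord_chain _ _).swap]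
  rfl

theorem chartPoint_two_zero (b : ℂ) : chartPoint c 2 0 b = chainPoint (zA c) 6 b := by
  rw [chartPoint, chartMap_toK_two, pointAt_swap (isCoord_chain _ _).swap]
  rfl

/-- On the curves added by charts 1 and 2 the function `y/x²` has the values `-1` and `1/2`, so
these curves are disjoint. -/
theorem ne_zero_of_chartPoint_eq {a b a' b' : ℂ}
    (h : chartPoint c 1 a b = chartPoint c 2 a' b') : a ≠ 0 ∧ a' = a := by
  have h1 := val_chartPoint_fst c 1 a b
  have h2 := val_chartPoint_fst c 2 a' b'
  rw [← h, chartMap_fst _ (by decide)] at h2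
  rw [chartMap_fst _ (by decide)] at h1
  have e := (isLocalSub_chartPoint c 1 a b).val_unique h2 h1
  refine ⟨?_, e⟩
  rintro rfl
  subst e
  rw [chartPoint_one_zero, chartPoint_two_zero] at h
  have h3 := val_zero_chainPoint (z := zB c) (n := 3) (c := b) (by norm_num)
  have h4 := val_zero_chainPoint (z := zA c) (n := 6) (c := b') (by norm_num)
  rw [← h] at h4
  exact zA_zero_ne c ((isLocalSub_chainPoint _ _ _).val_unique h4 h3)

theorem phaseFiber_eq_charts :
    phaseFiber c = {R | ∃ j, ∃ a b : ℂ, R = chartPoint c j a b} := by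
  rw [phaseFiber_cases]
  ext R
  constructor
  · rintro ((⟨a, b, rfl⟩ | ⟨d, rfl⟩) | ⟨d, rfl⟩)
    · exact ⟨0, a, b, rfl⟩
    · exact ⟨1, 0, d, (chartPoint_one_zero c d).symm⟩
    · exact ⟨2, 0, d, (chartPoint_two_zero c d).symm⟩
  · rintro ⟨j, a, b, rfl⟩
    by_cases ha : a = 0
    · subst ha
      fin_cases j
      · exact Or.inl (Or.inl ⟨0, b, rfl⟩)
      · exact Or.inl (Or.inr ⟨b, chartPoint_one_zero c b⟩)
      · exact Or.inr ⟨b, chartPoint_two_zero c b⟩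
    · rw [chartPoint_eq_of_ne_zero c j b ha]
      exact Or.inl (Or.inl ⟨_, _, rfl⟩)

theorem isResolutionOfTypeE8 : IsResolutionOfTypeE8 c where
  center_mem := center_mem_stage c
  exceptional := exceptional_excCurve c
  line_smooth := (line_smooth_and_self c).1
  line_self := (line_smooth_and_self c).2
  second_smooth := (second_smooth_and_self c).1
  second_self := (second_smooth_and_self c).2
  blowDown := isBlowDown_surface c
  typeE8 := isE8Configuration_surface c
  birational := isCoord_chart c
  phaseFiber_eq := phaseFiber_eq_charts c

end Fiber

/-! ### The total phase space -/

section Gluing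

variable {B : Set ℂ} {c : ℂ → CenterData ℂ}

theorem chartParam_mem (j : Fin 3) (p : ChartSpace B) :
    (chartParam B c j p).1 ∈ B ∧ (chartParam B c j p).2 ∈ phaseFiber (c (chartParam B c j p).1) :=
  ⟨p.2, by rw [phaseFiber_eq_charts]; exact ⟨j, _, _, rfl⟩⟩

variable (B c) in
/-- The charts as maps into the phase space. -/
def chartEmb (j : Fin 3) (p : ChartSpace B) : PhaseSpace B c :=
  ⟨chartParam B c j p, chartParam_mem j p⟩

theorem chartEmb_eq_iff {j k : Fin 3} {p p' : ChartSpace B} :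
    chartEmb B c j p = chartEmb B c k p' ↔ p.1.2.2 = p'.1.2.2 ∧
      chartPoint (c p.1.2.2) j p.1.1 p.1.2.1 = chartPoint (c p.1.2.2) k p'.1.1 p'.1.2.1 := by
  constructor
  · intro h
    obtain ⟨h1, h2⟩ := Prod.ext_iff.1 (congrArg Subtype.val h)
    have h1 : p.1.2.2 = p'.1.2.2 := h1
    refine ⟨h1, ?_⟩
    have h2 : chartPoint (c p.1.2.2) j p.1.1 p.1.2.1 =
      chartPoint (c p'.1.2.2) k p'.1.1 p'.1.2.1 := h2
    rwa [← h1] at h2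
  · rintro ⟨h1, h2⟩
    refine Subtype.ext (Prod.ext h1 ?_)
    rw [h1] at h2
    change chartPoint (c p.1.2.2) j p.1.1 p.1.2.1 = chartPoint (c p'.1.2.2) k p'.1.1 p'.1.2.1
    rw [h1]; exact h2

theorem chartEmb_injective (j : Fin 3) : Function.Injective (chartEmb B c j) := by
  intro p p' h
  obtain ⟨h1, h2⟩ := chartEmb_eq_iff.1 h
  obtain ⟨h3, h4⟩ := chartPoint_injective _ h2
  exact Subtype.ext (Prod.ext h3 (Prod.ext h4 h1))

theorem chartEmb_zero_eq_iff {j : Fin 3} (hj : j ≠ 0) (p p' : ChartSpace B) :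
    chartEmb B c 0 p = chartEmb B c j p' ↔ p.1.1 ≠ 0 ∧ p'.1.2.2 = p.1.2.2 ∧
      (p'.1.1, p'.1.2.1) = chartMap (c p.1.2.2) p.1.1 p.1.2.1 j := by
  rw [chartEmb_eq_iff, chartPoint_zero_eq_iff _ hj, eq_comm]
  tauto

theorem isOpen_phaseSpace_iff {U : Set (PhaseSpace B c)} :
    IsOpen U ↔ ∀ j, IsOpen (chartEmb B c j ⁻¹' U) := by
  have hiff : IsOpen U ↔ ∃ W : Set (ℂ × Subalgebra ℂ K),
      (∀ j, IsOpen (chartParam B c j ⁻¹' W)) ∧ Subtype.val ⁻¹' W = U := by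
    refine (@isOpen_induced_iff _ _ (⨆ j : Fin 3,
      TopologicalSpace.coinduced (chartParam B c j) inferInstance) _ _).trans ?_
    simp only [isOpen_iSup_iff, isOpen_coinduced]
    exact Iff.rfl
  rw [hiff]
  constructor
  · rintro ⟨W, hW, rfl⟩ j
    exact hW j
  · intro h
    -- The charts take values in the phase space, so the image of `U` in the ambient type has the
    -- same preimages under them as `U`.
    refine ⟨Subtype.val '' U, fun j => ?_, Set.preimage_image_eq _ Subtype.val_injective⟩
    convert h j using 1
    ext p
    constructor
    · rintro ⟨P, hP, e⟩
      have : chartEmb B c j p = P := Subtype.ext e.symm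
      rwa [Set.mem_preimage, this]
    · intro hp
      exact ⟨_, hp, rfl⟩

theorem continuous_chartEmb (j : Fin 3) : Continuous (chartEmb B c j) :=
  ⟨fun _ hU => isOpen_phaseSpace_iff.1 hU j⟩

theorem exists_chartEmb (P : PhaseSpace B c) : ∃ j p, chartEmb B c j p = P := by
  obtain ⟨⟨t, R⟩, ht, hR⟩ := P
  rw [phaseFiber_eq_charts] at hR
  obtain ⟨j, a, b, e⟩ := hR
  exact ⟨j, ⟨(a, b, t), ht⟩, Subtype.ext (Prod.ext rfl e.symm)⟩

variable (B c) in
/-- The transition map from the `j`-th to the `0`-th chart. -/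
def toZeroChart (j : Fin 3) (p : ChartSpace B) : ChartSpace B :=
  ⟨((chartInv (c p.1.2.2) p.1.1 p.1.2.1 j).1, (chartInv (c p.1.2.2) p.1.1 p.1.2.1 j).2, p.1.2.2),
    p.2⟩

variable (B c) in
/-- The transition map from the `0`-th to the `j`-th chart. -/
def ofZeroChart (j : Fin 3) (p : ChartSpace B) : ChartSpace B :=
  ⟨((chartMap (c p.1.2.2) p.1.1 p.1.2.1 j).1, (chartMap (c p.1.2.2) p.1.1 p.1.2.1 j).2, p.1.2.2),
    p.2⟩

theorem chartEmb_toZeroChart (j : Fin 3) {p : ChartSpace B} (hp : p.1.1 ≠ 0) :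
    chartEmb B c 0 (toZeroChart B c j p) = chartEmb B c j p :=
  chartEmb_eq_iff.2 ⟨rfl, (chartPoint_eq_of_ne_zero _ j _ hp).symm⟩

theorem chartEmb_ofZeroChart {j : Fin 3} (hj : j ≠ 0) {p : ChartSpace B} (hp : p.1.1 ≠ 0) :
    chartEmb B c j (ofZeroChart B c j p) = chartEmb B c 0 p :=
  ((chartEmb_zero_eq_iff hj p (ofZeroChart B c j p)).2 ⟨hp, rfl, rfl⟩).symm

theorem ne_zero_of_chartEmb_zero_eq {j : Fin 3} (hj : j ≠ 0) {p p' : ChartSpace B}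
    (h : chartEmb B c 0 p = chartEmb B c j p') : p.1.1 ≠ 0 ∧ p'.1.1 = 1 / p.1.1 := by
  obtain ⟨h1, _, h2⟩ := (chartEmb_zero_eq_iff hj _ _).1 h
  refine ⟨h1, ?_⟩
  rw [← chartMap_fst (c p.1.2.2) hj p.1.1 p.1.2.1, ← h2]

theorem ne_zero_of_chartEmb_eq {j k : Fin 3} (hjk : j ≠ k) {p p' : ChartSpace B}
    (h : chartEmb B c j p = chartEmb B c k p') : p.1.1 ≠ 0 := by
  by_cases hj : j = 0
  · subst hj
    exact (ne_zero_of_chartEmb_zero_eq (Ne.symm hjk) h).1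
  by_cases hk : k = 0
  · subst hk
    obtain ⟨h1, h2⟩ := ne_zero_of_chartEmb_zero_eq hj h.symm
    rw [h2]; exact one_div_ne_zero h1
  obtain ⟨ht, h⟩ := chartEmb_eq_iff.1 h
  have h12 : (j = 1 ∧ k = 2) ∨ (j = 2 ∧ k = 1) := by omega
  rcases h12 with ⟨rfl, rfl⟩ | ⟨rfl, rfl⟩
  · exact (ne_zero_of_chartPoint_eq _ h).1
  · obtain ⟨h1, h2⟩ := ne_zero_of_chartPoint_eq _ h.symm
    rwa [h2]

variable (B c) in
/-- The coefficients of the gluing maps depend continuously on the time. -/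
structure HasContinuousCenters : Prop where
  q : ContinuousOn (fun t => (c t).q) B
  dq : ContinuousOn (fun t => (c t).dq) B
  a : ContinuousOn (fun t => (c t).a) B
  b : ContinuousOn (fun t => (c t).b) B

theorem continuous_comp_time {f : ℂ → ℂ} (hf : ContinuousOn f B) :
    Continuous fun p : ChartSpace B => f p.1.2.2 :=
  hf.comp_continuous (by fun_prop) fun p => p.2

theorem continuousOn_toZeroChart (hc : HasContinuousCenters B c) (j : Fin 3) :
    ContinuousOn (toZeroChart B c j) {p | p.1.1 ≠ 0} := by
  have h1 := continuous_comp_time hc.q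
  have h2 := continuous_comp_time hc.dq
  have h3 := continuous_comp_time hc.a
  have h4 := continuous_comp_time hc.b
  have h5 : ContinuousOn (fun p : ChartSpace B => 1 / p.1.1) {p | p.1.1 ≠ 0} :=
    continuousOn_const.div (by fun_prop) fun p hp => hp
  refine Topology.IsInducing.subtypeVal.continuousOn_iff.2 ?_
  fin_cases j
  · exact Continuous.continuousOn (by unfold toZeroChart; exact continuous_subtype_val)
  · have hA : Continuous fun p : ChartSpace B => p.1.2.1 * p.1.1 := by fun_prop
    have hB : Continuous fun p : ChartSpace B => 12 * (c p.1.2.2).q := by fun_prop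
    exact h5.prodMk (((hA.continuousOn.sub (h5.pow 2)).add hB.continuousOn).prodMk (by fun_prop))
  · have hA : Continuous fun p : ChartSpace B => 6 * (c p.1.2.2).q := by fun_prop
    have hB : Continuous fun p : ChartSpace B => 12 * (c p.1.2.2).dq * p.1.1 := by fun_prop
    have hC : Continuous fun p : ChartSpace B => (c p.1.2.2).a * p.1.1 ^ 2 := by fun_prop
    have hD : Continuous fun p : ChartSpace B => (c p.1.2.2).b * p.1.1 ^ 3 := by fun_prop
    have hE : Continuous fun p : ChartSpace B => p.1.2.1 * p.1.1 ^ 4 := by fun_prop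
    exact h5.prodMk ((((((((h5.pow 2).div_const 2).sub hA.continuousOn).add
      hB.continuousOn).sub hC.continuousOn).add hD.continuousOn).add
      hE.continuousOn).prodMk (by fun_prop))

theorem continuousOn_ofZeroChart (hc : HasContinuousCenters B c) (j : Fin 3) :
    ContinuousOn (ofZeroChart B c j) {p | p.1.1 ≠ 0} := by
  have h1 := continuous_comp_time hc.q
  have h2 := continuous_comp_time hc.dq
  have h3 := continuous_comp_time hc.a
  have h4 := continuous_comp_time hc.b
  have h5 : ContinuousOn (fun p : ChartSpace B => 1 / p.1.1) {p | p.1.1 ≠ 0} :=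
    continuousOn_const.div (by fun_prop) fun p hp => hp
  refine Topology.IsInducing.subtypeVal.continuousOn_iff.2 ?_
  fin_cases j
  · exact Continuous.continuousOn (by unfold ofZeroChart; exact continuous_subtype_val)
  · exact h5.prodMk ((by fun_prop :
      ContinuousOn (fun p : ChartSpace B => (p.1.2.1 + p.1.1 ^ 2 - 12 * (c p.1.2.2).q) * p.1.1)
        {p | p.1.1 ≠ 0}).prodMk (by fun_prop))
  · exact h5.prodMk ((by fun_prop :
      ContinuousOn (fun p : ChartSpace B => ((((p.1.2.1 - p.1.1 ^ 2 / 2 + 6 * (c p.1.2.2).q) *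
        p.1.1 - 12 * (c p.1.2.2).dq) * p.1.1 + (c p.1.2.2).a) * p.1.1 - (c p.1.2.2).b) * p.1.1)
        {p | p.1.1 ≠ 0}).prodMk (by fun_prop))

/-- For `k ≠ 0` the overlap with chart 0 is the open set `x_k ≠ 0`, on which the preimage is taken
under the continuous transition map. -/
theorem isOpen_preimage_image_zero (hc : HasContinuousCenters B c) (k : Fin 3) {U : Set (ChartSpace B)} (hU : IsOpen U) :
    IsOpen (chartEmb B c k ⁻¹' (chartEmb B c 0 '' U)) := by
  by_cases hk : k = 0
  · subst hk
    rwa [Set.preimage_image_eq _ (chartEmb_injective 0)]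
  have hne : IsOpen {p : ChartSpace B | p.1.1 ≠ 0} := isOpen_ne_fun (by fun_prop) (by fun_prop)
  convert (continuousOn_toZeroChart hc k).isOpen_inter_preimage hne hU using 1
  ext p
  constructor
  · rintro ⟨p', hp', e⟩
    have hp : p.1.1 ≠ 0 := ne_zero_of_chartEmb_eq hk e.symm
    refine ⟨hp, ?_⟩
    rw [← chartEmb_toZeroChart k hp] at e
    rwa [Set.mem_preimage, ← chartEmb_injective 0 e]
  · rintro ⟨hp, h⟩
    exact ⟨_, h, chartEmb_toZeroChart k hp⟩

theorem isOpen_zero_preimage_image (hc : HasContinuousCenters B c) (k : Fin 3) {U : Set (ChartSpace B)} (hU : IsOpen U) :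
    IsOpen (chartEmb B c 0 ⁻¹' (chartEmb B c k '' U)) := by
  by_cases hk : k = 0
  · subst hk
    rwa [Set.preimage_image_eq _ (chartEmb_injective 0)]
  have hne : IsOpen {p : ChartSpace B | p.1.1 ≠ 0} := isOpen_ne_fun (by fun_prop) (by fun_prop)
  convert (continuousOn_ofZeroChart hc k).isOpen_inter_preimage hne hU using 1
  ext p
  constructor
  · rintro ⟨p', hp', e⟩
    have hp : p.1.1 ≠ 0 := ne_zero_of_chartEmb_eq (Ne.symm hk) e.symm
    refine ⟨hp, ?_⟩
    rw [← chartEmb_ofZeroChart hk hp] at e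
    rwa [Set.mem_preimage, ← chartEmb_injective k e]
  · rintro ⟨hp, h⟩
    exact ⟨_, h, chartEmb_ofZeroChart hk hp⟩

theorem isOpenMap_chartEmb (hc : HasContinuousCenters B c) (j : Fin 3) : IsOpenMap (chartEmb B c j) := by
  intro U hU
  rw [isOpen_phaseSpace_iff]
  intro k
  by_cases hjk : j = k
  · subst hjk
    rwa [Set.preimage_image_eq _ (chartEmb_injective j)]
  -- Any overlap of two different charts is contained in chart 0, so the transition from `j` to `k`
  -- factors through it.
  convert isOpen_preimage_image_zero hc k (isOpen_zero_preimage_image hc j hU) using 1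
  ext p
  constructor
  · rintro ⟨p', hp', e⟩
    have hp : p.1.1 ≠ 0 := ne_zero_of_chartEmb_eq (Ne.symm hjk) e.symm
    refine ⟨toZeroChart B c k p, ⟨p', hp', ?_⟩, chartEmb_toZeroChart k hp⟩
    rw [e, chartEmb_toZeroChart k hp]
  · rintro ⟨p₀, ⟨p', hp', e⟩, e'⟩
    exact ⟨p', hp', e.trans e'⟩

theorem isOpenEmbedding_chartEmb (hc : HasContinuousCenters B c) (j : Fin 3) : Topology.IsOpenEmbedding (chartEmb B c j) :=
  .of_continuous_injective_isOpenMap (continuous_chartEmb j) (chartEmb_injective j)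
    (isOpenMap_chartEmb hc j)

/-- Two points have disjoint open neighbourhoods. -/
def AreSeparated {X : Type*} [TopologicalSpace X] (P Q : X) : Prop :=
  ∃ U V : Set X, IsOpen U ∧ IsOpen V ∧ P ∈ U ∧ Q ∈ V ∧ Disjoint U V

theorem AreSeparated.symm {X : Type*} [TopologicalSpace X] {P Q : X} (h : AreSeparated P Q) :
    AreSeparated Q P := by
  obtain ⟨U, V, hU, hV, hP, hQ, hd⟩ := h
  exact ⟨V, U, hV, hU, hQ, hP, hd.symm⟩

theorem areSeparated_same (hc : HasContinuousCenters B c) (j : Fin 3) {p p' : ChartSpace B} (h : p ≠ p') :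
    AreSeparated (chartEmb B c j p) (chartEmb B c j p') := by
  obtain ⟨U, V, hU, hV, hp, hp', hd⟩ := t2_separation h
  exact ⟨_, _, isOpenMap_chartEmb hc j U hU, isOpenMap_chartEmb hc j V hV, ⟨p, hp, rfl⟩,
    ⟨p', hp', rfl⟩, (Set.disjoint_image_iff (chartEmb_injective j)).2 hd⟩

/-- A point with `x_k = 0` is separated from chart 0 by size: the conditions `|x| < r` and `|x_k| <
1/r` exclude each other because `x_k = 1/x`. Any other point of chart `k` already lies in chart 0.
-/
theorem areSeparated_zero (hc : HasContinuousCenters B c) {k : Fin 3} (hk : k ≠ 0) {p p' : ChartSpace B}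
    (h : chartEmb B c 0 p ≠ chartEmb B c k p') :
    AreSeparated (chartEmb B c 0 p) (chartEmb B c k p') := by
  by_cases hp' : p'.1.1 = 0
  · have hr : 0 < ‖p.1.1‖ + 1 := by positivity
    refine ⟨chartEmb B c 0 '' {a | ‖a.1.1‖ < ‖p.1.1‖ + 1},
      chartEmb B c k '' {a | ‖a.1.1‖ < 1 / (‖p.1.1‖ + 1)}, ?_, ?_, ⟨p, ?_, rfl⟩, ⟨p', ?_, rfl⟩, ?_⟩
    · exact isOpenMap_chartEmb hc 0 _ (isOpen_lt (by fun_prop) (by fun_prop))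
    · exact isOpenMap_chartEmb hc k _ (isOpen_lt (by fun_prop) (by fun_prop))
    · exact lt_add_one ‖p.1.1‖
    · change ‖p'.1.1‖ < _
      rw [hp', norm_zero]; positivity
    · rw [Set.disjoint_left]
      rintro _ ⟨a, ha, rfl⟩ ⟨b, hb, e⟩
      obtain ⟨h1, h2⟩ := ne_zero_of_chartEmb_zero_eq hk e.symm
      have hb : ‖b.1.1‖ < 1 / (‖p.1.1‖ + 1) := hb
      have ha : ‖a.1.1‖ < ‖p.1.1‖ + 1 := ha
      rw [h2, norm_div, norm_one] at hb
      exact absurd (one_div_lt_one_div_of_lt (norm_pos_iff.2 h1) ha) (not_lt.2 hb.le)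
  · rw [← chartEmb_toZeroChart k hp'] at h ⊢
    exact areSeparated_same hc 0 fun e => h (e ▸ rfl)

theorem areSeparated_one_two (hc : HasContinuousCenters B c) {p p' : ChartSpace B}
    (h : chartEmb B c 1 p ≠ chartEmb B c 2 p') :
    AreSeparated (chartEmb B c 1 p) (chartEmb B c 2 p') := by
  by_cases hp : p.1.1 = 0
  · by_cases hp' : p'.1.1 = 0
    · have h1 := continuous_comp_time hc.q
      have h2 := continuous_comp_time hc.dq
      have h3 := continuous_comp_time hc.a
      have h4 := continuous_comp_time hc.b
      -- Both functions express `y/x²` in the respective chart, extended continuously to `x_j = 0`,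
      -- where it is `-1` or `1/2` for all `t`. The bound `-1/4` for the real part is the midpoint
      -- of these values.
      let f₁ : ChartSpace B → ℂ := fun p =>
        -1 + 12 * (c p.1.2.2).q * p.1.1 ^ 2 + p.1.2.1 * p.1.1 ^ 3
      let f₂ : ChartSpace B → ℂ := fun p =>
        1 / 2 - 6 * (c p.1.2.2).q * p.1.1 ^ 2 + 12 * (c p.1.2.2).dq * p.1.1 ^ 3 -
          (c p.1.2.2).a * p.1.1 ^ 4 + (c p.1.2.2).b * p.1.1 ^ 5 + p.1.2.1 * p.1.1 ^ 6
      have hf₁ : Continuous f₁ := by fun_prop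
      have hf₂ : Continuous f₂ := by fun_prop
      have e₁ : ∀ a : ChartSpace B, a.1.1 ≠ 0 →
          f₁ a = (chartInv (c a.1.2.2) a.1.1 a.1.2.1 1).2 * a.1.1 ^ 2 := by
        intro a ha
        simp only [f₁, chartInv, Matrix.cons_val_one, Matrix.cons_val_zero]
        field_simp
        ring
      have e₂ : ∀ a : ChartSpace B, a.1.1 ≠ 0 →
          f₂ a = (chartInv (c a.1.2.2) a.1.1 a.1.2.1 2).2 * a.1.1 ^ 2 := by
        intro a ha
        simp only [f₂, chartInv, Matrix.cons_val]
        field_simp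
      refine ⟨chartEmb B c 1 '' {a | (f₁ a).re < -(1 / 4)},
        chartEmb B c 2 '' {a | -(1 / 4) < (f₂ a).re}, ?_, ?_, ⟨p, ?_, rfl⟩, ⟨p', ?_, rfl⟩, ?_⟩
      · exact isOpenMap_chartEmb hc 1 _ (isOpen_lt (by fun_prop) (by fun_prop))
      · exact isOpenMap_chartEmb hc 2 _ (isOpen_lt (by fun_prop) (by fun_prop))
      · change (f₁ p).re < _
        simp only [f₁, hp]
        norm_num
      · change _ < (f₂ p').re
        simp only [f₂, hp']
        norm_num
      · rw [Set.disjoint_left]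
        rintro _ ⟨a, ha, rfl⟩ ⟨b, hb, e⟩
        have ha0 : a.1.1 ≠ 0 := ne_zero_of_chartEmb_eq (by decide) e.symm
        have hb0 : b.1.1 ≠ 0 := ne_zero_of_chartEmb_eq (by decide) e
        have hab := (ne_zero_of_chartPoint_eq _ (chartEmb_eq_iff.1 e.symm).2).2
        rw [← chartEmb_toZeroChart 1 ha0, ← chartEmb_toZeroChart 2 hb0] at e
        have e3 := chartEmb_injective 0 e
        have e4 : (chartInv (c b.1.2.2) b.1.1 b.1.2.1 2).2 =
          (chartInv (c a.1.2.2) a.1.1 a.1.2.1 1).2 := congrArg (fun q => q.1.2.1) e3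
        have ha : (f₁ a).re < -(1 / 4) := ha
        have hb : -(1 / 4) < (f₂ b).re := hb
        rw [e₂ b hb0, e4, hab, ← e₁ a ha0] at hb
        exact absurd hb (not_lt.2 ha.le)
    · rw [← chartEmb_toZeroChart 2 hp'] at h ⊢
      exact (areSeparated_zero hc (by decide) h.symm).symm
  · rw [← chartEmb_toZeroChart 1 hp] at h ⊢
    exact areSeparated_zero hc (by decide) h

theorem t2Space_phaseSpace (hc : HasContinuousCenters B c) : T2Space (PhaseSpace B c) := by
  refine ⟨fun P Q hPQ => ?_⟩
  change AreSeparated P Q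
  obtain ⟨j, p, rfl⟩ := exists_chartEmb P
  obtain ⟨k, p', rfl⟩ := exists_chartEmb Q
  by_cases hjk : j = k
  · subst hjk
    exact areSeparated_same hc j fun e => hPQ (e ▸ rfl)
  by_cases hj : j = 0
  · subst hj
    exact areSeparated_zero hc (Ne.symm hjk) hPQ
  by_cases hk : k = 0
  · subst hk
    exact (areSeparated_zero hc hj hPQ.symm).symm
  have h12 : (j = 1 ∧ k = 2) ∨ (j = 2 ∧ k = 1) := by omega
  rcases h12 with ⟨rfl, rfl⟩ | ⟨rfl, rfl⟩
  · exact areSeparated_one_two hc hPQ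
  · exact (areSeparated_one_two hc hPQ.symm).symm

theorem isGluedFromCharts (hc : HasContinuousCenters B c) : IsGluedFromCharts B c := by
  refine ⟨chartEmb B c, fun _ _ => rfl, isOpenEmbedding_chartEmb hc, ?_, t2Space_phaseSpace hc,
    fun j hj => chartEmb_zero_eq_iff hj, fun p p' => ?_⟩
  · refine Set.eq_univ_of_forall fun P => ?_
    obtain ⟨j, p, h⟩ := exists_chartEmb P
    exact Set.mem_iUnion.2 ⟨j, p, h⟩
  · constructor
    · intro h
      have hp := ne_zero_of_chartEmb_eq (by decide) h
      exact ⟨toZeroChart B c 1 p, chartEmb_toZeroChart 1 hp,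
        (chartEmb_toZeroChart 1 hp).trans h⟩
    · rintro ⟨p₀, h1, h2⟩
      exact h1.symm.trans h2

end Gluing

end InceX

end

/-! ### The differential system in the charts and the equation for `q`. -/

noncomputable section

namespace InceX

open MvPolynomial

/-! ### Polynomials with holomorphic coefficients -/

/-- All coefficients of `P` are holomorphic on `B`. -/
def HasHolomorphicCoeffs (B : Set ℂ) (P : MvPolynomial (Fin 2) (ℂ → ℂ)) : Prop :=
  ∀ m, DifferentiableOn ℂ (P.coeff m) B

namespace HasHolomorphicCoeffs

variable {B : Set ℂ} {P Q : MvPolynomial (Fin 2) (ℂ → ℂ)}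

theorem C {f : ℂ → ℂ} (hf : DifferentiableOn ℂ f B) : HasHolomorphicCoeffs B (C f) := by
  intro m
  rw [coeff_C]
  split_ifs
  · exact hf
  · exact differentiableOn_const 0

theorem const (z : ℂ) : HasHolomorphicCoeffs B (MvPolynomial.C fun _ => z) :=
  C (differentiableOn_const z)

theorem X (i : Fin 2) : HasHolomorphicCoeffs B (X i) := by
  intro m
  rw [coeff_X]
  split_ifs
  · exact differentiableOn_const 1
  · exact differentiableOn_const 0

theorem add (hP : HasHolomorphicCoeffs B P) (hQ : HasHolomorphicCoeffs B Q) :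
    HasHolomorphicCoeffs B (P + Q) := fun m => by
  rw [coeff_add]; exact (hP m).add (hQ m)

theorem mul (hP : HasHolomorphicCoeffs B P) (hQ : HasHolomorphicCoeffs B Q) :
    HasHolomorphicCoeffs B (P * Q) := fun m => by
  rw [coeff_mul]
  exact DifferentiableOn.sum fun i _ => (hP i.1).mul (hQ i.2)

theorem pow (hP : HasHolomorphicCoeffs B P) (n : ℕ) : HasHolomorphicCoeffs B (P ^ n) := by
  induction n with
  | zero => rw [pow_zero]; exact const 1
  | succ n ih => rw [pow_succ]; exact ih.mul hP

end HasHolomorphicCoeffs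

/-! ### The system in the three charts -/

/-- The centre data with first entries `q`, `q'`. -/
def centersOf (q a b : ℂ → ℂ) (t : ℂ) : CenterData ℂ := ⟨q t, deriv q t, a t, b t⟩

/-- The derivative of a function of `(x, y, t)` along the vector field, computed along a line. -/
theorem fderiv_vectorField_eq {q : ℂ → ℂ} {x y t : ℂ} {f g : ℂ × ℂ × ℂ → ℂ}
    (hf : DifferentiableAt ℂ f (x, y, t)) (hg : DifferentiableAt ℂ g (x, y, t)) {f' g' : ℂ}
    (hf' : HasDerivAt (fun s : ℂ => f ((x, y, t) + s • vectorField q (x, y, t))) f' 0)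
    (hg' : HasDerivAt (fun s : ℂ => g ((x, y, t) + s • vectorField q (x, y, t))) g' 0) :
    fderiv ℂ (fun p => (f p, g p)) (x, y, t) (vectorField q (x, y, t)) = (f', g') := by
  rw [(hf.hasFDerivAt.prodMk hg.hasFDerivAt).fderiv, ContinuousLinearMap.prod_apply]
  have h1 := (hf.hasFDerivAt.hasLineDerivAt (vectorField q (x, y, t)))
  have h2 := (hg.hasFDerivAt.hasLineDerivAt (vectorField q (x, y, t)))
  rw [HasDerivAt.unique h1 hf', HasDerivAt.unique h2 hg']

section Charts

variable {B : Set ℂ} {q a b : ℂ → ℂ}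

theorem fderiv_chart_zero (x y t : ℂ) :
    fderiv ℂ (fun p : ℂ × ℂ × ℂ => chartMap (centersOf q a b p.2.2) p.1 p.2.1 0) (x, y, t)
      (vectorField q (x, y, t)) = (y, -x * y + x ^ 3 - 12 * q t * x + 12 * deriv q t) := by
  refine fderiv_vectorField_eq (f := fun p => p.1) (g := fun p => p.2.1) (by fun_prop)
    (by fun_prop) ?_ ?_
  · simpa [vectorField] using ((hasDerivAt_id (0 : ℂ)).mul_const y).const_add x
  · simpa [vectorField] using ((hasDerivAt_id (0 : ℂ)).mul_const
      (-x * y + x ^ 3 - 12 * q t * x + 12 * deriv q t)).const_add y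

theorem hasDerivAt_line (z v : ℂ) : HasDerivAt (fun s : ℂ => z + s * v) v 0 := by
  simpa using ((hasDerivAt_id (0 : ℂ)).mul_const v).const_add z

theorem hasDerivAt_comp_time {f : ℂ → ℂ} {f' t : ℂ} (hf : HasDerivAt f f' t) :
    HasDerivAt (fun s : ℂ => f (t + s * 1)) f' 0 := by
  exact (hf.comp_of_eq 0 (hasDerivAt_line t 1) (by simp)).congr_deriv (mul_one f')

theorem differentiableAt_comp_time {f : ℂ → ℂ} {x y t : ℂ} (hf : DifferentiableAt ℂ f t) :
    DifferentiableAt ℂ (fun p : ℂ × ℂ × ℂ => f p.2.2) (x, y, t) :=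
  DifferentiableAt.comp (x, y, t) (g := f) (f := fun p : ℂ × ℂ × ℂ => p.2.2) hf (by fun_prop)

theorem hasDerivAt_inv_line {x v : ℂ} (hx : x ≠ 0) :
    HasDerivAt (fun s : ℂ => 1 / (x + s * v)) (-v / x ^ 2) 0 := by
  simp only [one_div]
  exact ((hasDerivAt_line x v).inv (by simpa using hx)).congr_deriv (by simp)

/-- Along the system, `Y = y + x² - 12 q` satisfies `Y' = x Y`, because the terms `12 q'` cancel.
This is why chart 1 imposes no condition: in `y₁' = (Y x)'` the poles cancel identically. -/
theorem fderiv_chart_one (x y t : ℂ) (hx : x ≠ 0) (hq : DifferentiableAt ℂ q t) :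
    fderiv ℂ (fun p : ℂ × ℂ × ℂ => chartMap (centersOf q a b p.2.2) p.1 p.2.1 1) (x, y, t)
      (vectorField q (x, y, t)) =
      (-y / x ^ 2, (x * (y + x ^ 2 - 12 * q t)) * x + (y + x ^ 2 - 12 * q t) * y) := by
  have hq' := differentiableAt_comp_time (x := x) (y := y) hq
  refine fderiv_vectorField_eq (f := fun p => 1 / p.1)
    (g := fun p => (p.2.1 + p.1 ^ 2 - 12 * q p.2.2) * p.1)
    (by fun_prop (disch := assumption)) (by fun_prop) (hasDerivAt_inv_line hx) ?_
  have dx := hasDerivAt_line x y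
  have dy := hasDerivAt_line y (-x * y + x ^ 3 - 12 * q t * x + 12 * deriv q t)
  have dq := hasDerivAt_comp_time hq.hasDerivAt
  refine (((dy.add (dx.pow 2)).sub (dq.const_mul 12)).mul dx).congr_deriv ?_
  simp [-mul_eq_mul_right_iff]
  ring

theorem fderiv_chart_two (x y t : ℂ) (hx : x ≠ 0) (hq : DifferentiableAt ℂ q t)
    (hdq : DifferentiableAt ℂ (deriv q) t) (ha : DifferentiableAt ℂ a t)
    (hb : DifferentiableAt ℂ b t) :
    fderiv ℂ (fun p : ℂ × ℂ × ℂ => chartMap (centersOf q a b p.2.2) p.1 p.2.1 2) (x, y, t)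
      (vectorField q (x, y, t)) =
      (-y / x ^ 2,
        (((((-x * y + x ^ 3 - 12 * q t * x + 12 * deriv q t) - x * y + 6 * deriv q t) * x +
          (y - x ^ 2 / 2 + 6 * q t) * y - 12 * deriv (deriv q) t) * x +
          ((y - x ^ 2 / 2 + 6 * q t) * x - 12 * deriv q t) * y + deriv a t) * x +
          (((y - x ^ 2 / 2 + 6 * q t) * x - 12 * deriv q t) * x + a t) * y - deriv b t) * x +
          ((((y - x ^ 2 / 2 + 6 * q t) * x - 12 * deriv q t) * x + a t) * x - b t) * y) := by
  have hq' := differentiableAt_comp_time (x := x) (y := y) hq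
  have hdq' := differentiableAt_comp_time (x := x) (y := y) hdq
  have ha' := differentiableAt_comp_time (x := x) (y := y) ha
  have hb' := differentiableAt_comp_time (x := x) (y := y) hb
  refine fderiv_vectorField_eq (f := fun p => 1 / p.1)
    (g := fun p => ((((p.2.1 - p.1 ^ 2 / 2 + 6 * q p.2.2) * p.1 - 12 * deriv q p.2.2) * p.1 +
      a p.2.2) * p.1 - b p.2.2) * p.1)
    (by fun_prop (disch := assumption)) (by fun_prop) (hasDerivAt_inv_line hx) ?_
  have dx := hasDerivAt_line x y
  have dy := hasDerivAt_line y (-x * y + x ^ 3 - 12 * q t * x + 12 * deriv q t)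
  have dq := hasDerivAt_comp_time hq.hasDerivAt
  have ddq := hasDerivAt_comp_time hdq.hasDerivAt
  have da := hasDerivAt_comp_time ha.hasDerivAt
  have db := hasDerivAt_comp_time hb.hasDerivAt
  refine ((((((((dy.sub ((dx.pow 2).div_const 2)).add (dq.const_mul 6)).mul dx).sub
    (ddq.const_mul 12)).mul dx).add da).mul dx).sub db |>.mul dx).congr_deriv ?_
  simp [-mul_eq_mul_right_iff]
  ring

theorem isPolynomialInChart_zero (hq : DifferentiableOn ℂ q B)
    (hdq : DifferentiableOn ℂ (deriv q) B) :
    IsPolynomialInChart B q (centersOf q a b) 0 := by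
  refine ⟨X 1, C (fun _ => -1) * X 0 * X 1 + X 0 ^ 3 + C (fun _ => -12) * C q * X 0 +
    C (fun _ => 12) * C (deriv q), fun m => ⟨?_, ?_⟩, fun x y t ht _ => ?_⟩
  · exact HasHolomorphicCoeffs.X 1 m
  · exact ((((((HasHolomorphicCoeffs.const _).mul (.X 0)).mul (.X 1)).add (.pow (.X 0) 3)).add
      (((HasHolomorphicCoeffs.const _).mul (.C hq)).mul (.X 0))).add
      ((HasHolomorphicCoeffs.const _).mul (.C hdq))) m
  · rw [fderiv_chart_zero]
    simp [chartMap]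
    ring

theorem isPolynomialInChart_one (hB : IsOpen B) (hq : DifferentiableOn ℂ q B) :
    IsPolynomialInChart B q (centersOf q a b) 1 := by
  refine ⟨C (fun _ => 1) + C (fun _ => -12) * C q * X 0 ^ 2 + C (fun _ => -1) * X 0 ^ 3 * X 1,
    (X 0 * X 1 + C (fun _ => 12) * C q) * X 0 * X 1, fun m => ⟨?_, ?_⟩, fun x y t ht hx => ?_⟩
  · exact (((HasHolomorphicCoeffs.const _).add
      (((HasHolomorphicCoeffs.const _).mul (.C hq)).mul (.pow (.X 0) 2))).add
      (((HasHolomorphicCoeffs.const _).mul (.pow (.X 0) 3)).mul (.X 1))) m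
  · exact (((((HasHolomorphicCoeffs.X 0).mul (.X 1)).add
      ((HasHolomorphicCoeffs.const _).mul (.C hq))).mul (.X 0)).mul (.X 1)) m
  · have hx := hx (by decide)
    rw [fderiv_chart_one x y t hx (hq.differentiableAt (hB.mem_nhds ht))]
    simp only [chartMap, centersOf, Matrix.cons_val_one, Matrix.cons_val_zero, eval₂_add,
      eval₂_mul, eval₂_pow, eval₂_C, eval₂_X, Pi.evalRingHom_apply]
    refine Prod.ext ?_ ?_
    · field_simp
      ring
    · field_simp
      ring

/-- The part of `y₂'` without negative powers of `x₂`, with the values of `q`, `q'`, `a`, `b`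
as parameters. -/
def regularPart {R : Type*} [CommRing R] (q dq a b u v : R) : R :=
  -(36 * dq * a) - 18 * q * b + (2 * a ^ 2 + 48 * dq * b - 24 * v * q) * u +
    (60 * v * dq - 5 * a * b) * u ^ 2 + (3 * b ^ 2 - 6 * v * a) * u ^ 3 + 7 * v * b * u ^ 4 +
    4 * v ^ 2 * u ^ 5

/-- The second component of the system in the second chart, as a Laurent polynomial in `x₂`. -/
theorem fderiv_chart_two_eq (u v t : ℂ) (hu : u ≠ 0) (hq : DifferentiableAt ℂ q t)
    (hdq : DifferentiableAt ℂ (deriv q) t) (ha : DifferentiableAt ℂ a t)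
    (hb : DifferentiableAt ℂ b t) {x y : ℂ} (h : chartMap (centersOf q a b t) x y 2 = (u, v)) :
    fderiv ℂ (fun p : ℂ × ℂ × ℂ => chartMap (centersOf q a b p.2.2) p.1 p.2.1 2) (x, y, t)
      (vectorField q (x, y, t)) =
      (-1 / 2 + 6 * q t * u ^ 2 - 12 * deriv q t * u ^ 3 + a t * u ^ 4 - b t * u ^ 5 - v * u ^ 6,
        regularPart (q t) (deriv q t) (a t) (b t) u v +
        ((a t - 12 * deriv (deriv q) t) + (deriv a t - 72 * q t * deriv q t - b t / 2) * u +
          (144 * deriv q t ^ 2 + 12 * a t * q t - deriv b t) * u ^ 2) / u ^ 3) := by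
  obtain ⟨h1, h2⟩ := Prod.ext_iff.1 h
  simp only [chartMap, centersOf, Matrix.cons_val] at h1 h2
  have hx : x ≠ 0 := by rintro rfl; simp at h1; exact hu h1.symm
  rw [fderiv_chart_two x y t hx hq hdq ha hb]
  subst h1
  have hy : y = x ^ 2 / 2 - 6 * q t + 12 * deriv q t / x - a t / x ^ 2 + b t / x ^ 3 +
      v / x ^ 4 := by
    subst h2
    field_simp
    ring
  clear h2 h
  subst hy
  unfold regularPart
  refine Prod.ext ?_ ?_
  · field_simp
    ring
  · field_simp
    ring

theorem isPolynomialInChart_two (hB : IsOpen B) (hq : DifferentiableOn ℂ q B)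
    (ha : DifferentiableOn ℂ a B) (hb : DifferentiableOn ℂ b B)
    (h : ∀ t ∈ B, a t = 12 * deriv (deriv q) t ∧ b t = 2 * deriv a t - 144 * q t * deriv q t ∧
      deriv b t = 144 * deriv q t ^ 2 + 12 * a t * q t) :
    IsPolynomialInChart B q (centersOf q a b) 2 := by
  have hdq := hq.deriv hB
  have k : ∀ z : ℂ, HasHolomorphicCoeffs B (C fun _ => z) := HasHolomorphicCoeffs.const
  have cq := HasHolomorphicCoeffs.C hq
  have cdq := HasHolomorphicCoeffs.C hdq
  have ca := HasHolomorphicCoeffs.C ha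
  have cb := HasHolomorphicCoeffs.C hb
  have x0 := HasHolomorphicCoeffs.X (B := B) 0
  have x1 := HasHolomorphicCoeffs.X (B := B) 1
  refine ⟨C (fun _ => -1 / 2) + C (fun _ => 6) * C q * X 0 ^ 2 +
      C (fun _ => -12) * C (deriv q) * X 0 ^ 3 + C a * X 0 ^ 4 +
      C (fun _ => -1) * C b * X 0 ^ 5 + C (fun _ => -1) * X 1 * X 0 ^ 6,
    C (fun _ => -36) * C (deriv q) * C a + C (fun _ => -18) * C q * C b +
      (C (fun _ => 2) * C a ^ 2 + C (fun _ => 48) * C (deriv q) * C b +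
        C (fun _ => -24) * X 1 * C q) * X 0 +
      (C (fun _ => 60) * X 1 * C (deriv q) + C (fun _ => -5) * C a * C b) * X 0 ^ 2 +
      (C (fun _ => 3) * C b ^ 2 + C (fun _ => -6) * X 1 * C a) * X 0 ^ 3 +
      C (fun _ => 7) * X 1 * C b * X 0 ^ 4 + C (fun _ => 4) * X 1 ^ 2 * X 0 ^ 5,
    fun m => ⟨?_, ?_⟩, fun x y t ht hx => ?_⟩
  · exact ((((((k _).add (((k _).mul cq).mul (x0.pow 2))).add
      (((k _).mul cdq).mul (x0.pow 3))).add (ca.mul (x0.pow 4))).add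
      (((k _).mul cb).mul (x0.pow 5))).add (((k _).mul x1).mul (x0.pow 6))) m
  · exact (((((((((k _).mul cdq).mul ca).add (((k _).mul cq).mul cb)).add
      (((((k _).mul (ca.pow 2)).add (((k _).mul cdq).mul cb)).add
        (((k _).mul x1).mul cq)).mul x0)).add
      (((((k _).mul x1).mul cdq).add (((k _).mul ca).mul cb)).mul (x0.pow 2))).add
      ((((k _).mul (cb.pow 2)).add (((k _).mul x1).mul ca)).mul (x0.pow 3))).add
      ((((k _).mul x1).mul cb).mul (x0.pow 4))).add
      (((k _).mul (x1.pow 2)).mul (x0.pow 5))) m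
  · have hx := hx (by decide)
    have hB' := hB.mem_nhds ht
    obtain ⟨e1, e2, e3⟩ := h t ht
    rw [fderiv_chart_two_eq (chartMap (centersOf q a b t) x y 2).1
      (chartMap (centersOf q a b t) x y 2).2 t (by simp [chartMap, hx])
      (hq.differentiableAt hB') (hdq.differentiableAt hB') (ha.differentiableAt hB')
      (hb.differentiableAt hB') rfl,
      show a t - 12 * deriv (deriv q) t = 0 by rw [e1]; ring,
      show deriv a t - 72 * q t * deriv q t - b t / 2 = 0 by rw [e2]; ring,
      show 144 * deriv q t ^ 2 + 12 * a t * q t - deriv b t = 0 by rw [e3]; ring]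
    generalize (chartMap (centersOf q a b t) x y 2).1 = u
    generalize (chartMap (centersOf q a b t) x y 2).2 = v
    simp only [eval₂_add, eval₂_mul, eval₂_pow, eval₂_C, eval₂_X, Pi.evalRingHom_apply,
      regularPart, Matrix.cons_val_one, Matrix.cons_val_zero]
    refine Prod.ext ?_ ?_
    · ring
    · ring

/-- An identity at infinitely many `u` is an identity of polynomials, and a multiple of `X³` has no
coefficients in degrees `0`, `1`, `2`. -/
theorem eq_zero_of_pow_three_mul_eval {r : Polynomial ℂ} {α β γ : ℂ}
    (h : ∀ u : ℂ, u ≠ 0 → u ^ 3 * r.eval u = α + β * u + γ * u ^ 2) :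
    α = 0 ∧ β = 0 ∧ γ = 0 := by
  have key : r * Polynomial.X ^ 3 = Polynomial.C α + Polynomial.C β * Polynomial.X +
      Polynomial.C γ * Polynomial.X ^ 2 := by
    refine Polynomial.eq_of_infinite_eval_eq _ _
      ((Set.finite_singleton (0 : ℂ)).infinite_compl.mono fun u hu => ?_)
    simp only [Set.mem_ofPred_eq, Polynomial.eval_add, Polynomial.eval_mul, Polynomial.eval_pow,
      Polynomial.eval_X, Polynomial.eval_C]
    rw [← h u hu, mul_comm]
  have h0 := congrArg (fun p => Polynomial.coeff p 0) key
  have h1 := congrArg (fun p => Polynomial.coeff p 1) key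
  have h2 := congrArg (fun p => Polynomial.coeff p 2) key
  simp [Polynomial.coeff_mul_X_pow', Polynomial.coeff_X, Polynomial.coeff_X_pow,
    Polynomial.coeff_C] at h0 h1 h2
  exact ⟨h0.symm, h1.symm, h2.symm⟩

/-- The polar part of `y₂'` does not involve `y₂`, so it suffices to look at the line `y₂ = 0` at a
fixed time. There the polynomial right-hand side minus the regular part is a polynomial in `x₂`
equal to the polar part, which must vanish. -/
theorem eqns_of_isPolynomialInChart_two (hB : IsOpen B) (hq : DifferentiableOn ℂ q B)
    (ha : DifferentiableOn ℂ a B) (hb : DifferentiableOn ℂ b B)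
    (h : IsPolynomialInChart B q (centersOf q a b) 2) {t : ℂ} (ht : t ∈ B) :
    a t = 12 * deriv (deriv q) t ∧ b t = 2 * deriv a t - 144 * q t * deriv q t ∧
      deriv b t = 144 * deriv q t ^ 2 + 12 * a t * q t := by
  obtain ⟨P, Q, -, h⟩ := h
  have hB' := hB.mem_nhds ht
  let r : Polynomial ℂ :=
    eval₂ (Polynomial.C.comp (Pi.evalRingHom (fun _ : ℂ => ℂ) t)) ![Polynomial.X, 0] Q -
      regularPart (Polynomial.C (q t)) (Polynomial.C (deriv q t)) (Polynomial.C (a t))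
        (Polynomial.C (b t)) Polynomial.X 0
  have hr : ∀ u : ℂ, r.eval u = eval₂ (Pi.evalRingHom (fun _ : ℂ => ℂ) t) ![u, 0] Q -
      regularPart (q t) (deriv q t) (a t) (b t) u 0 := by
    intro u
    simp only [r, Polynomial.eval_sub]
    congr 1
    · rw [← Polynomial.coe_evalRingHom, eval₂_comp_left]
      congr 1
      · ext; simp
      · ext i; fin_cases i <;> simp
    · simp [regularPart]
  obtain ⟨h1, h2, h3⟩ := eq_zero_of_pow_three_mul_eval (r := r)
    (α := a t - 12 * deriv (deriv q) t)
    (β := deriv a t - 72 * q t * deriv q t - b t / 2)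
    (γ := 144 * deriv q t ^ 2 + 12 * a t * q t - deriv b t) (by
      intro u hu
      have hc : chartMap (centersOf q a b t) (1 / u)
          (chartInv (centersOf q a b t) u 0 2).2 2 = (u, 0) := by
        simp only [chartMap, chartInv, Matrix.cons_val]
        refine Prod.ext ?_ ?_
        · field_simp
        · field_simp
          ring
      have h' := h (1 / u) (chartInv (centersOf q a b t) u 0 2).2 t ht
        fun _ => one_div_ne_zero hu
      rw [fderiv_chart_two_eq u 0 t hu (hq.differentiableAt hB')
        ((hq.deriv hB).differentiableAt hB') (ha.differentiableAt hB')
        (hb.differentiableAt hB') hc, hc] at h'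
      have h2 := (Prod.ext_iff.1 h').2
      dsimp only at h2
      rw [hr, ← h2, add_sub_cancel_left]
      field_simp)
  refine ⟨by linear_combination h1, by linear_combination -2 * h2, by linear_combination -h3⟩

/-- All conditions come from chart 2; they are the vanishing of the coefficients of `x₂⁻³`, `x₂⁻²`
and `x₂⁻¹` in `y₂'`. -/
theorem forall_isPolynomialInChart_iff (hB : IsOpen B) (hq : DifferentiableOn ℂ q B)
    (ha : DifferentiableOn ℂ a B) (hb : DifferentiableOn ℂ b B) :
    (∀ j, IsPolynomialInChart B q (centersOf q a b) j) ↔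
      ∀ t ∈ B, a t = 12 * deriv (deriv q) t ∧ b t = 2 * deriv a t - 144 * q t * deriv q t ∧
        deriv b t = 144 * deriv q t ^ 2 + 12 * a t * q t := by
  refine ⟨fun h t ht => eqns_of_isPolynomialInChart_two hB hq ha hb (h 2) ht, fun h j => ?_⟩
  fin_cases j
  · exact isPolynomialInChart_zero hq (hq.deriv hB)
  · exact isPolynomialInChart_one hB hq
  · exact isPolynomialInChart_two hB hq ha hb h

theorem hasContinuousCenters_centersOf (hB : IsOpen B) (hq : DifferentiableOn ℂ q B)
    (ha : DifferentiableOn ℂ a B) (hb : DifferentiableOn ℂ b B) :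
    HasContinuousCenters B (centersOf q a b) :=
  ⟨hq.continuousOn, (hq.deriv hB).continuousOn, ha.continuousOn, hb.continuousOn⟩

end Charts

/-! ### The two families -/

section Families

variable {B : Set ℂ} {q : ℂ → ℂ}

theorem iteratedDeriv_two_eq : iteratedDeriv 2 q = deriv (deriv q) := by
  rw [iteratedDeriv_succ, iteratedDeriv_one]

theorem iteratedDeriv_three_eq : iteratedDeriv 3 q = deriv (deriv (deriv q)) := by
  rw [iteratedDeriv_succ, iteratedDeriv_two_eq]

theorem deriv_eq_of_eqOn (hB : IsOpen B) {f g : ℂ → ℂ} (h : ∀ t ∈ B, f t = g t) {t g' : ℂ}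
    (ht : t ∈ B) (hg : HasDerivAt g g' t) : deriv f t = g' :=
  (hg.congr_of_eventuallyEq (Filter.eventuallyEq_of_mem (hB.mem_nhds ht) h)).deriv

/-- The condition on `a` is the equation itself. The one on `b` holds by the choice of `a` and `b`,
and the one on `b'` is the equation multiplied by `144 q`. -/
theorem isPolynomial_centersOfConstants_iff (hB : IsOpen B) (hq : DifferentiableOn ℂ q B)
    (C₁ C₂ : ℂ) :
    (∀ j, IsPolynomialInChart B q (centersOfConstants q C₁ C₂) j) ↔
      ∀ t ∈ B, iteratedDeriv 2 q t = 6 * q t ^ 2 - C₁ * t - C₂ := by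
  have hdq := hq.deriv hB
  refine (forall_isPolynomialInChart_iff hB hq
    (a := fun t => 12 * (6 * q t ^ 2 - C₁ * t - C₂))
    (b := fun t => 144 * q t * deriv q t - 24 * C₁) (by fun_prop) (by fun_prop)).trans ?_
  rw [iteratedDeriv_two_eq]
  refine forall₂_congr fun t ht => ?_
  have d0 := (hq.differentiableAt (hB.mem_nhds ht)).hasDerivAt
  have d1 := (hdq.differentiableAt (hB.mem_nhds ht)).hasDerivAt
  have e1 : deriv (fun t => 12 * (6 * q t ^ 2 - C₁ * t - C₂)) t =
      144 * q t * deriv q t - 12 * C₁ := by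
    refine HasDerivAt.deriv (((((d0.pow 2).const_mul 6).sub
      ((hasDerivAt_id t).const_mul C₁)).sub_const C₂ |>.const_mul 12).congr_deriv ?_)
    simp
    ring
  have e2 : deriv (fun t => 144 * q t * deriv q t - 24 * C₁) t =
      144 * deriv q t ^ 2 + 144 * q t * deriv (deriv q) t := by
    refine HasDerivAt.deriv ((((d0.const_mul 144).mul d1).sub_const (24 * C₁)).congr_deriv ?_)
    ring
  rw [e1, e2]
  constructor
  · rintro ⟨h, -, -⟩
    linear_combination -h / 12
  · intro h
    refine ⟨by linear_combination -12 * h, by ring, by linear_combination 144 * q t * h⟩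

theorem fourth_deriv_eq_iff (hB : IsOpen B) (hBc : IsPreconnected B)
    (hq : DifferentiableOn ℂ q B) :
    (∀ t ∈ B, deriv (deriv (deriv (deriv q))) t =
        12 * deriv q t ^ 2 + 12 * q t * deriv (deriv q) t) ↔
      ∃ C₁ C₂ : ℂ, ∀ t ∈ B, deriv (deriv q) t = 6 * q t ^ 2 - C₁ * t - C₂ := by
  have h1 := hq.deriv hB
  have h2 := h1.deriv hB
  have h3 := h2.deriv hB
  have d0 : ∀ t ∈ B, HasDerivAt q (deriv q t) t := fun t ht =>
    (hq.differentiableAt (hB.mem_nhds ht)).hasDerivAt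
  have d1 : ∀ t ∈ B, HasDerivAt (deriv q) (deriv (deriv q) t) t := fun t ht =>
    (h1.differentiableAt (hB.mem_nhds ht)).hasDerivAt
  have d2 : ∀ t ∈ B, HasDerivAt (deriv (deriv q)) (deriv (deriv (deriv q)) t) t := fun t ht =>
    (h2.differentiableAt (hB.mem_nhds ht)).hasDerivAt
  have d3 : ∀ t ∈ B, HasDerivAt (deriv (deriv (deriv q))) (deriv (deriv (deriv (deriv q))) t) t :=
    fun t ht => (h3.differentiableAt (hB.mem_nhds ht)).hasDerivAt
  have dqq : ∀ t ∈ B, HasDerivAt (fun t => 12 * q t * deriv q t)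
      (12 * deriv q t ^ 2 + 12 * q t * deriv (deriv q) t) t := fun t ht =>
    (((d0 t ht).const_mul 12).mul (d1 t ht)).congr_deriv (by ring)
  constructor
  · intro h
    -- The right-hand side is the derivative of `12 q q'`, which in turn is the derivative of `6
    -- q²`. Two integrations on the connected open set give `q'' = 6 q² + α t + β`.
    obtain ⟨α, hα⟩ := hB.exists_is_const_of_deriv_eq_zero hBc
      (f := fun t => deriv (deriv (deriv q)) t - 12 * q t * deriv q t) (by fun_prop)
      (fun t ht => (((d3 t ht).sub (dqq t ht)).congr_deriv
        (by rw [h t ht, sub_self]; rfl)).deriv)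
    obtain ⟨β, hβ⟩ := hB.exists_is_const_of_deriv_eq_zero hBc
      (f := fun t => deriv (deriv q) t - 6 * q t ^ 2 - α * t) (by fun_prop)
      (fun t ht => ((((d2 t ht).sub (((d0 t ht).pow 2).const_mul 6)).sub
        ((hasDerivAt_id t).const_mul α)).congr_deriv
        (by simp; linear_combination hα t ht)).deriv)
    exact ⟨-α, -β, fun t ht => by linear_combination hβ t ht⟩
  · rintro ⟨C₁, C₂, h⟩ t ht
    have h' : ∀ t ∈ B, deriv (deriv (deriv q)) t = 12 * q t * deriv q t - C₁ := fun t ht =>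
      deriv_eq_of_eqOn hB h ht (((((d0 t ht).pow 2).const_mul 6).sub
        ((hasDerivAt_id t).const_mul C₁)).sub_const C₂ |>.congr_deriv (by simp; ring))
    exact deriv_eq_of_eqOn hB h' ht ((dqq t ht).sub_const C₁)

/-- Here `a` and `b` solve the first two conditions by construction; the third is the fourth-order
equation of `fourth_deriv_eq_iff`, multiplied by `24`. -/
theorem isPolynomial_centersOfDerivatives_iff (hB : IsOpen B) (hBc : IsPreconnected B)
    (hq : DifferentiableOn ℂ q B) :
    (∀ j, IsPolynomialInChart B q (centersOfDerivatives q) j) ↔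
      ∃ C₁ C₂ : ℂ, ∀ t ∈ B, iteratedDeriv 2 q t = 6 * q t ^ 2 - C₁ * t - C₂ := by
  have h1 := hq.deriv hB
  have h2 := h1.deriv hB
  have h3 := h2.deriv hB
  have e : centersOfDerivatives q = centersOf q (fun t => 12 * deriv (deriv q) t)
      (fun t => 24 * deriv (deriv (deriv q)) t - 144 * q t * deriv q t) := by
    rw [← iteratedDeriv_three_eq, ← iteratedDeriv_two_eq]; rfl
  rw [e, forall_isPolynomialInChart_iff hB hq (by fun_prop) (by fun_prop), iteratedDeriv_two_eq,
    ← fourth_deriv_eq_iff hB hBc hq]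
  refine forall₂_congr fun t ht => ?_
  have d0 := (hq.differentiableAt (hB.mem_nhds ht)).hasDerivAt
  have d1 := (h1.differentiableAt (hB.mem_nhds ht)).hasDerivAt
  have d2 := (h2.differentiableAt (hB.mem_nhds ht)).hasDerivAt
  have d3 := (h3.differentiableAt (hB.mem_nhds ht)).hasDerivAt
  have e4 : deriv (fun t => 24 * deriv (deriv (deriv q)) t - 144 * q t * deriv q t) t = _ :=
    ((d3.const_mul 24).sub ((d0.const_mul 144).mul d1)).deriv
  rw [(d2.const_mul 12).deriv, e4]
  constructor
  · rintro ⟨-, -, h⟩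
    linear_combination h / 24
  · intro h
    exact ⟨rfl, by ring, by linear_combination 24 * h⟩

theorem isGluedFromCharts_centersOfConstants (hB : IsOpen B) (hq : DifferentiableOn ℂ q B)
    (C₁ C₂ : ℂ) : IsGluedFromCharts B (centersOfConstants q C₁ C₂) := by
  have h1 := hq.deriv hB
  exact isGluedFromCharts (hasContinuousCenters_centersOf hB hq
    (a := fun t => 12 * (6 * q t ^ 2 - C₁ * t - C₂))
    (b := fun t => 144 * q t * deriv q t - 24 * C₁) (by fun_prop) (by fun_prop))

theorem isGluedFromCharts_centersOfDerivatives (hB : IsOpen B) (hq : DifferentiableOn ℂ q B) :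
    IsGluedFromCharts B (centersOfDerivatives q) := by
  have h1 := hq.deriv hB
  have h2 : DifferentiableOn ℂ (iteratedDeriv 2 q) B := by
    rw [iteratedDeriv_two_eq]; exact h1.deriv hB
  have h3 : DifferentiableOn ℂ (iteratedDeriv 3 q) B := by
    rw [iteratedDeriv_succ]; exact h2.deriv hB
  exact isGluedFromCharts (hasContinuousCenters_centersOf hB hq
    (a := fun t => 12 * iteratedDeriv 2 q t)
    (b := fun t => 24 * iteratedDeriv 3 q t - 144 * q t * deriv q t) (by fun_prop) (by fun_prop))

end Families

end InceX

end

theorem mainTheorem1 (B : Set ℂ) (hBo : IsOpen B) (hBc : IsConnected B)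
    (q : ℂ → ℂ) (hq : DifferentiableOn ℂ q B) :
    (∀ C₁ C₂ : ℂ,
      (∀ t ∈ B, IsResolutionOfTypeE8 (centersOfConstants q C₁ C₂ t)) ∧
      IsGluedFromCharts B (centersOfConstants q C₁ C₂) ∧
      ((∀ j, IsPolynomialInChart B q (centersOfConstants q C₁ C₂) j) ↔
        ∀ t ∈ B, iteratedDeriv 2 q t = 6 * q t ^ 2 - C₁ * t - C₂)) ∧
    (∀ t ∈ B, IsResolutionOfTypeE8 (centersOfDerivatives q t)) ∧
    IsGluedFromCharts B (centersOfDerivatives q) ∧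
    ((∀ j, IsPolynomialInChart B q (centersOfDerivatives q) j) ↔
      ∃ C₁ C₂ : ℂ, ∀ t ∈ B, iteratedDeriv 2 q t = 6 * q t ^ 2 - C₁ * t - C₂) := by
  refine ⟨fun C₁ C₂ => ⟨fun t _ => isResolutionOfTypeE8 _,
    isGluedFromCharts_centersOfConstants hBo hq C₁ C₂,
    isPolynomial_centersOfConstants_iff hBo hq C₁ C₂⟩, fun t _ => isResolutionOfTypeE8 _,
    isGluedFromCharts_centersOfDerivatives hBo hq,
    isPolynomial_centersOfDerivatives_iff hBo hBc.isPreconnected hq⟩
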